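/- Let $\mathcal C_3\subset O(\mathbb R^2)$ be the group generated by the $3$-fold rotation about the origin, let $\tau:\mathbb Z/3\mathbb Z\to\mathcal C_3$ be a faithful representation, and let $G$ be a finite simple graph with an action $\theta:\mathbb Z/3\mathbb Z\to\mathrm{Aut}(G)$ that is free on $V(G)$. A framework $(G,p)$ is a map $p:V(G)\to\mathbb R^2$ with $p(u)\neq p(v)$ for every edge $\{u,v\}$; it is $\mathcal C_3$-symmetric if $\tau(\gamma)p(v)=p(\theta(\gamma)v)$ for all $\gamma,v$, and $\mathcal C_3$-regular if moreover its rigidity matrix $R(G,p)$ has maximal rank among all $\mathcal C_3$-symmetric frameworks on $G$ (with respect to $\theta,\tau$). Here $R(G,p)$ is the $|E(G)|\times 2|V(G)|$ matrix whose row for $\{u,v\}$ has $p(u)-p(v)$ in the columns of $u$, $p(v)-p(u)$ in the columns of $v$, and $0$ elsewhere. The quotient gain graph $(H,\psi)$ of $G$ has the vertex orbits as vertices and the edge orbits as edges: after choosing a representative of each vertex orbit and an orientation of each edge orbit, an edge orbit $\{\{gu,ghv\}: g\in\mathbb Z/3\mathbb Z\}$ with representatives $u,v$, oriented from the orbit of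 $u$ to that of $v$, has gain $\psi=h$. Let $\tilde p(\tilde v)=p(v)$ for the representative $v$ of $\tilde v$. A set $F\subseteq E(H)$ is balanced if every cycle in $F$ has trivial total gain (gains of edges traversed backwards being inverted), and $V(F)$ is the set of vertices incident to $F$. A set $S\subseteq E(H)$ is $(2,3,1)$-gain-sparse if every nonempty $F\subseteq S$ satisfies $|F|\le 2|V(F)|-1$, and $|F|\le 2|V(F)|-3$ if $F$ is balanced; $(H,\psi)$ is $(2,3,1)$-gain-sparse if $E(H)$ is. For $j\in\{1,2\}$, with $\omega=e^{2\pi\sqrt{-1}/3}$, $O_j(H,\psi,\tilde p)$ is the complex $|E(H)|\times 2|V(H)|$ matrix whose row for an edge $\tilde e=(\tilde u,\tilde v)$ has $\tilde p(\tilde u)-\tau(\psi_{\tilde e})\tilde p(\tilde v)$ in the columns of $\tilde u$ and $\omega^{j\psi_{\tilde e}}\bigl(\tilde p(\tilde v)-\tau(\psi_{\tilde e})^{-1}\tilde p(\tilde u)\bigr)$ in the columns of $\tilde v$ (the sum of the two if $\tilde e$ is a loop), and $0$ elsewhere. Theorem. Let $(G,p)$ be $\mathcal C_3$-regular, with any choice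 of representatives and orientations for $(H,\psi)$. Then: (1) the $(2,3,1)$-gain-sparse subsets of $E(H)$ are the independent sets of a matroid $\mathcal M_{2,3,1}(H,\psi)$ on $E(H)$, and $$\operatorname{rank} R(G,p)=3\,\operatorname{rank}\mathcal M_{2,3,1}(H,\psi);$$ (2) for each $j\in\{1,2\}$, $O_j(H,\psi,\tilde p)$ is row independent if and only if $(H,\psi)$ is $(2,3,1)$-gain-sparse. -/

import Mathlib

noncomputable section

open scoped Classical in
/-- The rigidity matrix: the row of an edge `{u, v}` has `p u - p v` in the columns of `u`,
`p v - p u` in the columns of `v`, and `0` elsewhere. -/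
def rigidityMatrix {V : Type*} {d : ℕ} (G : SimpleGraph V) (p : V → Fin d → ℝ) :
    Matrix G.edgeSet (V × Fin d) ℝ :=
  fun e w => if h : w.1 ∈ e.1 then p w.1 w.2 - p (Sym2.Mem.other h) w.2 else 0

/-- `(G, p)` is a bar-joint framework: adjacent vertices are placed at distinct points. -/
def IsFramework {V : Type*} {d : ℕ} (G : SimpleGraph V) (p : V → Fin d → ℝ) : Prop :=
  ∀ u v, G.Adj u v → p u ≠ p v

section Symmetric

variable {Γ : Type*} [Group Γ] {V : Type*} {G : SimpleGraph V} {d : ℕ}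

/-- The action `θ` is free on the vertex set. -/
def IsFreeOnVertices (θ : Γ →* (G ≃g G)) : Prop :=
  ∀ γ : Γ, γ ≠ 1 → ∀ v : V, θ γ v ≠ v

/-- `(G, p)` is a `Γ`-symmetric framework with respect to `θ` and `τ`. -/
def IsSymmetricFramework (θ : Γ →* (G ≃g G)) (τ : Γ →* Matrix.orthogonalGroup (Fin d) ℝ)
    (p : V → Fin d → ℝ) : Prop :=
  IsFramework G p ∧
    ∀ (γ : Γ) (v : V), (τ γ : Matrix (Fin d) (Fin d) ℝ).mulVec (p v) = p (θ γ v)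

/-- `(G, p)` is a `Γ`-regular framework: its rigidity matrix has maximal rank among all
`Γ`-symmetric realizations of `G` (with respect to the same `θ` and `τ`). -/
def IsRegularFramework [Fintype V] (θ : Γ →* (G ≃g G))
    (τ : Γ →* Matrix.orthogonalGroup (Fin d) ℝ) (p : V → Fin d → ℝ) : Prop :=
  IsSymmetricFramework θ τ p ∧
    ∀ q : V → Fin d → ℝ, IsSymmetricFramework θ τ q →
      (rigidityMatrix G q).rank ≤ (rigidityMatrix G p).rank

/-- Two vertices are equivalent if they lie in the same vertex orbit. -/
def vertexOrbitSetoid (θ : Γ →* (G ≃g G)) : Setoid V where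
  r u v := ∃ γ : Γ, θ γ u = v
  iseqv :=
    { refl := fun u => ⟨1, by simp⟩
      symm := by
        rintro u v ⟨γ, rfl⟩
        refine ⟨γ⁻¹, ?_⟩
        rw [← RelIso.mul_apply, ← map_mul]
        simp
      trans := by
        rintro u v w ⟨γ, rfl⟩ ⟨δ, rfl⟩
        refine ⟨δ * γ, ?_⟩
        rw [map_mul, RelIso.mul_apply] }

/-- Two edges are equivalent if they lie in the same edge orbit. -/
def edgeOrbitSetoid (θ : Γ →* (G ≃g G)) : Setoid G.edgeSet where
  r e f := ∃ γ : Γ, Sym2.map (θ γ) e.1 = f.1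
  iseqv :=
    { refl := fun e => ⟨1, by
        have h : (⇑(θ 1) : V → V) = id := by ext; simp
        rw [h, Sym2.map_id, id]⟩
      symm := by
        rintro e f ⟨γ, h⟩
        refine ⟨γ⁻¹, ?_⟩
        have h' : (⇑(θ γ⁻¹) ∘ ⇑(θ γ) : V → V) = id := by
          ext x
          rw [Function.comp_apply, ← RelIso.mul_apply, ← map_mul]
          simp
        rw [← h, Sym2.map_map, h', Sym2.map_id, id]
      trans := by
        rintro e f g ⟨γ, h⟩ ⟨δ, h'⟩
        refine ⟨δ * γ, ?_⟩
        have h'' : (⇑(θ (δ * γ)) : V → V) = ⇑(θ δ) ∘ ⇑(θ γ) := by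
          ext x
          rw [map_mul, RelIso.mul_apply, Function.comp_apply]
        rw [h'', ← Sym2.map_map, h, h'] }

/-- The vertex set `V(G)/Γ` of the quotient graph. -/
abbrev VertexOrbit (θ : Γ →* (G ≃g G)) : Type _ := Quotient (vertexOrbitSetoid θ)

/-- The edge set `E(G)/Γ` of the quotient graph. -/
abbrev EdgeOrbit (θ : Γ →* (G ≃g G)) : Type _ := Quotient (edgeOrbitSetoid θ)

end Symmetric

/-- A `Γ`-gain graph on vertex type `V` and edge type `E` (loops and parallel edges allowed). -/
structure GainGraph (Γ V E : Type*) where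
  src : E → V
  tgt : E → V
  gain : E → Γ

namespace GainGraph

variable {Γ : Type*} [Group Γ] {V E : Type*} (H : GainGraph Γ V E)

/-- The start of an edge traversed forwards (`true`) or backwards (`false`). -/
def start (a : E × Bool) : V := if a.2 then H.src a.1 else H.tgt a.1

/-- The end of an edge traversed forwards (`true`) or backwards (`false`). -/
def finish (a : E × Bool) : V := if a.2 then H.tgt a.1 else H.src a.1

/-- The gain of an edge traversed forwards (`true`) or backwards (`false`). -/
def signedGain (a : E × Bool) : Γ := if a.2 then H.gain a.1 else (H.gain a.1)⁻¹

/-- A cycle `v₁, e₁, v₂, e₂, …, vₖ, eₖ, v₁` with `k ≥ 1`, given by its list of traversed edges: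
consecutive edges match up cyclically, and no vertex and no edge is repeated. -/
def IsCycle (c : List (E × Bool)) : Prop :=
  c.IsChain (fun a b => H.finish a = H.start b) ∧
    (∃ h : c ≠ [], H.finish (c.getLast h) = H.start (c.head h)) ∧
    (c.map H.start).Nodup ∧ (c.map Prod.fst).Nodup

/-- An edge set is balanced if the product of the gains along each of its cycles is trivial. -/
def IsBalanced (F : Set E) : Prop :=
  ∀ c : List (E × Bool), H.IsCycle c → (∀ a ∈ c, a.1 ∈ F) → (c.map H.signedGain).prod = 1

/-- The set `V(F)` of the vertices incident to the edges of `F`. -/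
def incidentVertices (F : Set E) : Set V := H.src '' F ∪ H.tgt '' F

/-- `(k, ℓ, m)`-gain-sparsity of an edge set `S`; the gain graph itself is
`(k, ℓ, m)`-gain-sparse if `S = Set.univ` is. -/
def IsGainSparse (k l m : ℕ) (S : Set E) : Prop :=
  ∀ F : Finset E, F.Nonempty → (F : Set E) ⊆ S →
    (H.IsBalanced F → (F.card : ℤ) ≤ k * (H.incidentVertices F).ncard - l) ∧
      (F.card : ℤ) ≤ k * (H.incidentVertices F).ncard - m

open scoped Classical in
/-- The orbit rigidity matrix of `(H, ψ, q)` for a one-dimensional representation `ρ`: the row of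
`e = (u, v)` has `q u - τ(ψ e) (q v)` in the columns of `u`, and
`ρ(ψ e) (q v - τ(ψ e)⁻¹ (q u))` in the columns of `v`; for a loop the two are added. -/
def orbitRigidityMatrix {d : ℕ} (τ : Γ →* Matrix.orthogonalGroup (Fin d) ℝ) (ρ : Γ → ℂ)
    (q : V → Fin d → ℝ) : Matrix E (V × Fin d) ℂ :=
  fun e w =>
    (if w.1 = H.src e then
      (((q (H.src e) - (τ (H.gain e) : Matrix (Fin d) (Fin d) ℝ).mulVec (q (H.tgt e))) w.2 : ℝ) : ℂ)
      else 0) +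
    (if w.1 = H.tgt e then
      ρ (H.gain e) * (((q (H.tgt e) -
        ((τ (H.gain e))⁻¹ : Matrix.orthogonalGroup (Fin d) ℝ).1.mulVec (q (H.src e))) w.2 : ℝ) : ℂ)
      else 0)

end GainGraph

/-- The choices on which the quotient gain graph depends: a representative vertex of each vertex
orbit, and for each edge orbit an orientation, given by an oriented edge in it. -/
structure QuotientChoice {Γ : Type*} [Group Γ] {V : Type*} {G : SimpleGraph V}
    (θ : Γ →* (G ≃g G)) where
  rep : VertexOrbit θ → V
  rep_spec : ∀ o : VertexOrbit θ, (Quotient.mk (vertexOrbitSetoid θ) (rep o)) = o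
  dart : EdgeOrbit θ → G.Dart
  dart_spec : ∀ o : EdgeOrbit θ,
    (Quotient.mk (edgeOrbitSetoid θ) ⟨(dart o).edge, (dart o).edge_mem⟩) = o

namespace QuotientChoice

variable {Γ : Type*} [Group Γ] {V : Type*} {G : SimpleGraph V} {θ : Γ →* (G ≃g G)}

theorem exists_label (C : QuotientChoice θ) (v : V) :
    ∃ γ : Γ, θ γ (C.rep (Quotient.mk (vertexOrbitSetoid θ) v)) = v :=
  Quotient.exact (C.rep_spec (Quotient.mk (vertexOrbitSetoid θ) v))

/-- The element `γ` with `v = γ r`, where `r` is the representative of the orbit of `v`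
(unique when the action is free on the vertices). -/
def label (C : QuotientChoice θ) (v : V) : Γ := (C.exists_label v).choose

/-- The quotient gain graph of `G`. An oriented edge from `g u` to `g h v`, with `u` and `v`
representatives, gives an edge from the orbit of `u` to the orbit of `v` of gain
`h = g⁻¹ (g h)`. -/
def quotientGainGraph (C : QuotientChoice θ) : GainGraph Γ (VertexOrbit θ) (EdgeOrbit θ) where
  src o := Quotient.mk (vertexOrbitSetoid θ) (C.dart o).fst
  tgt o := Quotient.mk (vertexOrbitSetoid θ) (C.dart o).snd
  gain o := (C.label (C.dart o).fst)⁻¹ * C.label (C.dart o).snd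

/-- The quotient of a placement `p` of the vertices of `G`. -/
def quotientPlacement {d : ℕ} (C : QuotientChoice θ) (p : V → Fin d → ℝ) :
    VertexOrbit θ → Fin d → ℝ :=
  fun o => p (C.rep o)

end QuotientChoice

/-- The `k`-fold rotation of the plane. -/
def planeRotation (k : ℕ) : Matrix.orthogonalGroup (Fin 2) ℝ :=
  ⟨!![Real.cos (2 * Real.pi / k), Real.sin (2 * Real.pi / k);
      -Real.sin (2 * Real.pi / k), Real.cos (2 * Real.pi / k)], by
    have h := Real.sin_sq_add_cos_sq (2 * Real.pi / k)
    rw [Matrix.mem_orthogonalGroup_iff]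
    ext i j
    fin_cases i <;> fin_cases j <;>
      simp [Matrix.mul_apply, Fin.sum_univ_two] <;> nlinarith⟩

/-- The point group `𝒞ₖ` generated by the `k`-fold rotation of the plane. -/
def rotationPointGroup (k : ℕ) : Subgroup (Matrix.orthogonalGroup (Fin 2) ℝ) :=
  Subgroup.zpowers (planeRotation k)

/-- The irreducible representation `ρⱼ : i ↦ ω ^ (i j)` of `ℤ/kℤ`, with `ω = exp (2 π √-1 / k)`. -/
def cyclicCharacter (k j : ℕ) (γ : Multiplicative (ZMod k)) : ℂ :=
  Complex.exp (2 * Real.pi * Complex.I / k) ^ ((Multiplicative.toAdd γ).val * j)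

end

/-! ## Potentials and balance -/

theorem List.exists_append_of_not_nodup_map {α β : Type*} (f : α → β) (l : List α)
    (h : ¬ (l.map f).Nodup) :
    ∃ l₁ a l₂ b l₃, l = l₁ ++ a :: (l₂ ++ b :: l₃) ∧ f a = f b := by
  induction l with
  | nil => simp at h
  | cons x l ih =>
    by_cases hx : f x ∈ l.map f
    · obtain ⟨b, hb, hbx⟩ := List.mem_map.1 hx
      obtain ⟨l₂, l₃, rfl⟩ := List.append_of_mem hb
      exact ⟨[], x, l₂, b, l₃, rfl, hbx.symm⟩
    · have h' : ¬ (l.map f).Nodup := fun hl => h (by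
        rw [List.map_cons, List.nodup_cons]; exact ⟨hx, hl⟩)
      obtain ⟨l₁, a, l₂, b, l₃, rfl, hab⟩ := ih h'
      exact ⟨x :: l₁, a, l₂, b, l₃, rfl, hab⟩

namespace GainGraph

variable {Γ V E : Type*} {H : GainGraph Γ V E}

variable (H) in
/-- `c` lists the edges traversed by a walk from `x` to `y` in `F`. -/
def IsWalk (F : Set E) : V → List (E × Bool) → V → Prop
  | x, [], y => x = y
  | x, a :: c, y => H.start a = x ∧ a.1 ∈ F ∧ IsWalk F (H.finish a) c y

theorem isWalk_append {F : Set E} {x z : V} {c d : List (E × Bool)} :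
    H.IsWalk F x (c ++ d) z ↔ ∃ y, H.IsWalk F x c y ∧ H.IsWalk F y d z := by
  induction c generalizing x with
  | nil => simp [IsWalk]
  | cons a c ih => simp only [List.cons_append, IsWalk, ih]; tauto

theorem IsWalk.mem {F : Set E} {x y : V} {c : List (E × Bool)} (h : H.IsWalk F x c y) :
    ∀ a ∈ c, a.1 ∈ F := by
  induction c generalizing x with
  | nil => simp
  | cons a c ih =>
    obtain ⟨-, h₂, h₃⟩ := h
    intro b hb
    rcases List.mem_cons.1 hb with rfl | hb
    · exact h₂
    · exact ih h₃ b hb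

theorem IsWalk.isChain {F : Set E} {x y : V} {c : List (E × Bool)} (h : H.IsWalk F x c y) :
    c.IsChain (fun a b => H.finish a = H.start b) := by
  induction c generalizing x with
  | nil => simp
  | cons a c ih =>
    obtain ⟨-, -, h₃⟩ := h
    cases c with
    | nil => simp
    | cons b c =>
      rw [List.isChain_cons_cons]
      exact ⟨h₃.1.symm, ih h₃⟩

theorem IsWalk.finish_getLast {F : Set E} {x y : V} {c : List (E × Bool)} (h : H.IsWalk F x c y)
    (hc : c ≠ []) : H.finish (c.getLast hc) = y := by
  induction c generalizing x with
  | nil => exact absurd rfl hc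
  | cons a c ih =>
    cases c with
    | nil => exact h.2.2
    | cons b c =>
      rw [List.getLast_cons (List.cons_ne_nil b c)]
      exact ih h.2.2 _

theorem IsWalk.start_head {F : Set E} {x y : V} {c : List (E × Bool)} (h : H.IsWalk F x c y)
    (hc : c ≠ []) : H.start (c.head hc) = x := by
  cases c with
  | nil => exact absurd rfl hc
  | cons a c => exact h.1

open scoped Classical in
variable (H) in
/-- The finite set of the vertices incident to the edges of `F`. -/
noncomputable def verts (F : Finset E) : Finset V := F.image H.src ∪ F.image H.tgt

theorem mem_verts {F : Finset E} {v : V} :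
    v ∈ H.verts F ↔ ∃ e ∈ F, H.src e = v ∨ H.tgt e = v := by
  classical
  simp only [verts, Finset.mem_union, Finset.mem_image]
  constructor
  · rintro (⟨e, he, h⟩ | ⟨e, he, h⟩)
    exacts [⟨e, he, Or.inl h⟩, ⟨e, he, Or.inr h⟩]
  · rintro ⟨e, he, h | h⟩
    exacts [Or.inl ⟨e, he, h⟩, Or.inr ⟨e, he, h⟩]

theorem src_mem_verts {F : Finset E} {e : E} (he : e ∈ F) : H.src e ∈ H.verts F :=
  mem_verts.2 ⟨e, he, Or.inl rfl⟩

theorem tgt_mem_verts {F : Finset E} {e : E} (he : e ∈ F) : H.tgt e ∈ H.verts F :=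
  mem_verts.2 ⟨e, he, Or.inr rfl⟩

theorem verts_mono {F F' : Finset E} (h : F ⊆ F') : H.verts F ⊆ H.verts F' := fun _ hv => by
  obtain ⟨e, he, h'⟩ := mem_verts.1 hv
  exact mem_verts.2 ⟨e, h he, h'⟩

theorem coe_verts (F : Finset E) : (H.verts F : Set V) = H.incidentVertices F := by
  classical
  simp [verts, incidentVertices]

theorem verts_union [DecidableEq V] [DecidableEq E] (F F' : Finset E) :
    H.verts (F ∪ F') = H.verts F ∪ H.verts F' := by
  ext v
  simp only [mem_verts, Finset.mem_union]
  constructor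
  · rintro ⟨e, he | he, h⟩
    exacts [Or.inl ⟨e, he, h⟩, Or.inr ⟨e, he, h⟩]
  · rintro (⟨e, he, h⟩ | ⟨e, he, h⟩)
    exacts [⟨e, Or.inl he, h⟩, ⟨e, Or.inr he, h⟩]

theorem verts_inter_subset [DecidableEq V] [DecidableEq E] (F F' : Finset E) :
    H.verts (F ∩ F') ⊆ H.verts F ∩ H.verts F' :=
  Finset.subset_inter (verts_mono Finset.inter_subset_left) (verts_mono Finset.inter_subset_right)

variable [Group Γ]

variable (H) in
/-- `g` is a potential of `F`: the gain of each edge of `F` is the quotient of the values of `g` at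
its ends. -/
def IsPotential (F : Set E) (g : V → Γ) : Prop :=
  ∀ e ∈ F, H.gain e = (g (H.src e))⁻¹ * g (H.tgt e)

theorem IsPotential.mono {F F' : Set E} {g : V → Γ} (h : H.IsPotential F' g) (hF : F ⊆ F') :
    H.IsPotential F g := fun e he => h e (hF he)

theorem IsPotential.prod_signedGain {F : Set E} {g : V → Γ} (hg : H.IsPotential F g) :
    ∀ (c : List (E × Bool)) (hc : c ≠ []), c.IsChain (fun a b => H.finish a = H.start b) →
      (∀ a ∈ c, a.1 ∈ F) → (c.map H.signedGain).prod =
        (g (H.start (c.head hc)))⁻¹ * g (H.finish (c.getLast hc)) := by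
  have key : ∀ a : E × Bool, a.1 ∈ F →
      H.signedGain a = (g (H.start a))⁻¹ * g (H.finish a) := by
    rintro ⟨e, b⟩ he
    cases b <;> simp [signedGain, start, finish, hg e he]
  intro c
  induction c with
  | nil => intro hc; exact absurd rfl hc
  | cons a c ih =>
    intro hc hch hF
    cases c with
    | nil => simpa using key a (hF a (by simp))
    | cons b c =>
      rw [List.isChain_cons_cons] at hch
      rw [List.map_cons, List.prod_cons,
        ih (List.cons_ne_nil b c) hch.2 (fun x hx => hF x (List.mem_cons_of_mem _ hx)),
        key a (hF a (by simp)), List.getLast_cons (List.cons_ne_nil b c)]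
      simp [hch.1]

theorem IsPotential.isBalanced {F : Set E} {g : V → Γ} (hg : H.IsPotential F g) :
    H.IsBalanced F := by
  rintro c ⟨hch, ⟨hc, hcl⟩, -, -⟩ hF
  rw [hg.prod_signedGain c hc hch hF, hcl, inv_mul_cancel]

theorem IsBalanced.prod_eq_one_of_isWalk {F : Set E} (hF : H.IsBalanced F) :
    ∀ (n : ℕ) (c : List (E × Bool)) (x : V), c.length = n → H.IsWalk F x c x →
      (c.map H.signedGain).prod = 1 := by
  intro n
  induction n using Nat.strong_induction_on with
  | _ n ih =>
  intro c x hn hw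
  rcases eq_or_ne c [] with rfl | hc
  · simp
  by_cases h₁ : (c.map H.start).Nodup
  · by_cases h₂ : (c.map Prod.fst).Nodup
    · exact hF c ⟨hw.isChain, ⟨hc, by rw [hw.finish_getLast hc, hw.start_head hc]⟩, h₁, h₂⟩ hw.mem
    · obtain ⟨l₁, a, l₂, b, l₃, rfl, hab⟩ := List.exists_append_of_not_nodup_map _ _ h₂
      have hne : H.start a ≠ H.start b := by
        intro h
        simp only [List.map_append, List.map_cons] at h₁
        have := (List.nodup_append.1 h₁).2.1
        rw [List.nodup_cons] at this
        exact this.1 (by simp [h])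
      have hs : H.start b = H.finish a ∧ H.finish b = H.start a ∧
          H.signedGain b = (H.signedGain a)⁻¹ := by
        obtain ⟨e, i⟩ := a
        obtain ⟨e', j⟩ := b
        obtain rfl : e = e' := hab
        cases i <;> cases j <;> simp_all [start, finish, signedGain]
      obtain ⟨y, hw₁, hy, hya, hw₂⟩ := isWalk_append.1 hw
      obtain ⟨z, hw₃, hz, hzb, hw₄⟩ := isWalk_append.1 hw₂
      rw [← hz, hs.1] at hw₃
      rw [hs.2.1, hy] at hw₄
      simp only [List.length_append, List.length_cons] at hn
      have e₁ := ih _ (by omega) l₂ _ rfl hw₃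
      have e₂ := ih _ (by simp only [List.length_append]; omega) (l₁ ++ l₃) x rfl
        (isWalk_append.2 ⟨y, hw₁, hw₄⟩)
      simp only [List.map_append, List.prod_append, List.map_cons, List.prod_cons] at e₂ ⊢
      rw [e₁, hs.2.2, one_mul, mul_inv_cancel_left, e₂]
  · obtain ⟨l₁, a, l₂, b, l₃, rfl, hab⟩ := List.exists_append_of_not_nodup_map _ _ h₁
    obtain ⟨y, hw₁, hy, hya, hw₂⟩ := isWalk_append.1 hw
    obtain ⟨z, hw₃, hz, hzb, hw₄⟩ := isWalk_append.1 hw₂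
    simp only [List.length_append, List.length_cons] at hn
    have hzy : z = y := by rw [← hz, ← hab, hy]
    subst hzy
    have e₁ := ih _ (by simp only [List.length_cons]; omega) (a :: l₂) z rfl ⟨hy, hya, hw₃⟩
    have e₂ := ih _ (by simp only [List.length_append, List.length_cons]; omega)
      (l₁ ++ b :: l₃) x rfl (isWalk_append.2 ⟨z, hw₁, hz, hzb, hw₄⟩)
    simp only [List.map_append, List.prod_append, List.map_cons, List.prod_cons] at e₁ e₂ ⊢
    rw [← mul_assoc (H.signedGain a), e₁, one_mul, e₂]

theorem IsWalk.exists_reverse {F : Set E} {x y : V} {c : List (E × Bool)}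
    (h : H.IsWalk F x c y) :
    ∃ d, H.IsWalk F y d x ∧ (d.map H.signedGain).prod = ((c.map H.signedGain).prod)⁻¹ := by
  induction c generalizing x with
  | nil => exact ⟨[], Eq.symm h, by simp⟩
  | cons a c ih =>
    obtain ⟨d, hd, hp⟩ := ih h.2.2
    refine ⟨d ++ [(a.1, !a.2)], isWalk_append.2 ⟨_, hd, ?_, h.2.1, ?_⟩, ?_⟩
    · obtain ⟨e, i⟩ := a
      cases i <;> simp [start, finish]
    · rw [← h.1]
      obtain ⟨e, i⟩ := a
      cases i <;> simp [start, finish, IsWalk]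
    · obtain ⟨e, i⟩ := a
      cases i <;> simp [hp, signedGain]

theorem IsBalanced.exists_isPotential {F : Set E} (hF : H.IsBalanced F) :
    ∃ g : V → Γ, H.IsPotential F g := by
  let s : Setoid V :=
    { r := fun x y => ∃ c, H.IsWalk F x c y
      iseqv :=
        { refl := fun x => ⟨[], rfl⟩
          symm := by
            rintro x y ⟨c, hc⟩
            obtain ⟨d, hd, -⟩ := hc.exists_reverse
            exact ⟨d, hd⟩
          trans := by
            rintro x y z ⟨c, hc⟩ ⟨d, hd⟩
            exact ⟨c ++ d, isWalk_append.2 ⟨y, hc, hd⟩⟩ } }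
  have hw : ∀ x : V, ∃ c, H.IsWalk F (Quotient.out (Quotient.mk s x)) c x := fun x =>
    Quotient.exact (Quotient.out_eq (Quotient.mk s x))
  choose c hc using hw
  refine ⟨fun x => ((c x).map H.signedGain).prod, fun e he => ?_⟩
  have hq : Quotient.mk s (H.src e) = Quotient.mk s (H.tgt e) :=
    Quotient.sound ⟨[(e, true)], rfl, he, rfl⟩
  obtain ⟨d, hd, hp⟩ := (hc (H.tgt e)).exists_reverse
  have h := hF.prod_eq_one_of_isWalk _ (c (H.src e) ++ (e, true) :: d) _ rfl
    (isWalk_append.2 ⟨H.src e, hc (H.src e), rfl, he, by rw [hq]; exact hd⟩)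
  simp only [List.map_append, List.map_cons, List.prod_append, List.prod_cons, hp] at h
  have h' : H.signedGain (e, true) = H.gain e := by simp [signedGain]
  rw [h', ← mul_assoc, mul_inv_eq_one] at h
  simp only [← h, inv_mul_cancel_left]

theorem isBalanced_iff {F : Set E} : H.IsBalanced F ↔ ∃ g : V → Γ, H.IsPotential F g :=
  ⟨fun h => h.exists_isPotential, fun ⟨_, hg⟩ => hg.isBalanced⟩

variable (H) in
/-- `(2, 3, 1)`-gain-sparsity of a finite edge set, with balance expressed by potentials. -/
def Sparse (F : Finset E) : Prop :=
  ∀ A ⊆ F, A.Nonempty → A.card + 1 ≤ 2 * (H.verts A).card ∧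
    ((∃ g, H.IsPotential (A : Set E) g) → A.card + 3 ≤ 2 * (H.verts A).card)

theorem Sparse.mono {F F' : Finset E} (h : H.Sparse F') (hF : F ⊆ F') : H.Sparse F :=
  fun A hA => h A (hA.trans hF)

theorem isGainSparse_coe_iff (F : Finset E) : H.IsGainSparse 2 3 1 (F : Set E) ↔ H.Sparse F := by
  have key : ∀ A : Finset E, (H.incidentVertices (A : Set E)).ncard = (H.verts A).card :=
    fun A => by rw [← coe_verts, Set.ncard_coe_finset]
  refine ⟨fun h A hA hne => ?_, fun h A hne hA => ?_⟩
  · have := h A hne (by exact_mod_cast hA)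
    rw [key, isBalanced_iff] at this
    refine ⟨by have := this.2; push_cast at this; omega, fun hg => ?_⟩
    have := this.1 hg
    push_cast at this
    omega
  · have := h A (by exact_mod_cast hA) hne
    rw [key, isBalanced_iff]
    refine ⟨fun hg => ?_, by have := this.1; push_cast; omega⟩
    have := this.2 hg
    push_cast
    omega

/-- A nonempty sparse edge set has a vertex of degree at most `3`. -/
theorem Sparse.exists_degree_le {F : Finset E} (h : H.Sparse F) (hF : F.Nonempty) :
    ∃ v ∈ H.verts F, (open scoped Classical in (F.filter (fun e => H.src e = v)).card +
      (F.filter (fun e => H.tgt e = v)).card) ≤ 3 := by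
  classical
  by_contra! hc
  have h₁ := Finset.card_eq_sum_card_fiberwise (f := H.src) (s := F) (t := H.verts F)
    (fun e he => src_mem_verts he)
  have h₂ := Finset.card_eq_sum_card_fiberwise (f := H.tgt) (s := F) (t := H.verts F)
    (fun e he => tgt_mem_verts he)
  have h₃ : ∑ v ∈ H.verts F, 4 ≤ ∑ v ∈ H.verts F, ((F.filter (fun e => H.src e = v)).card +
      (F.filter (fun e => H.tgt e = v)).card) := Finset.sum_le_sum fun v hv => hc v hv
  rw [Finset.sum_add_distrib, ← h₁, ← h₂] at h₃
  have h₄ := (h F subset_rfl hF).1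
  simp only [Finset.sum_const, smul_eq_mul] at h₃
  omega

end GainGraph

/-! ## Reducing a vertex of degree three -/

namespace GainGraph

variable {Γ V E : Type*} {H : GainGraph Γ V E}

theorem card_verts_union [DecidableEq V] [DecidableEq E] (A B : Finset E) :
    (H.verts (A ∪ B)).card + (H.verts A ∩ H.verts B).card =
      (H.verts A).card + (H.verts B).card := by
  rw [verts_union]
  exact Finset.card_union_add_card_inter _ _

variable [Group Γ]

open scoped Classical in
/-- Potentials which agree on the common vertices of two edge sets can be merged. -/
theorem IsPotential.merge {A B : Finset E} {g g' : V → Γ} (hA : H.IsPotential (A : Set E) g)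
    (hB : H.IsPotential (B : Set E) g')
    (hgg' : ∀ v ∈ H.verts A ∩ H.verts B, g v = g' v) :
    ∃ f, H.IsPotential ((A ∪ B : Finset E) : Set E) f ∧ (∀ v ∈ H.verts A, f v = g v) ∧
      ∀ v ∈ H.verts B, f v = g' v := by
  have h₁ : ∀ v ∈ H.verts A, (if v ∈ H.verts A then g v else g' v) = g v := fun v hv => if_pos hv
  have h₂ : ∀ v ∈ H.verts B, (if v ∈ H.verts A then g v else g' v) = g' v := fun v hv => by
    split_ifs with h
    · exact hgg' v (Finset.mem_inter.2 ⟨h, hv⟩)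
    · rfl
  refine ⟨fun v => if v ∈ H.verts A then g v else g' v, fun e he => ?_, h₁, h₂⟩
  rcases Finset.mem_union.1 (Finset.mem_coe.1 he) with he | he
  · simp only [h₁ _ (src_mem_verts he), h₁ _ (tgt_mem_verts he)]
    exact hA e he
  · simp only [h₂ _ (src_mem_verts he), h₂ _ (tgt_mem_verts he)]
    exact hB e he

theorem Sparse.card_le {F A : Finset E} (h : H.Sparse F) (hA : A ⊆ F) {W : Finset V}
    (hW : W.Nonempty) (hAW : H.verts A ⊆ W) : A.card + 1 ≤ 2 * W.card := by
  have h₀ := Finset.card_pos.2 hW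
  rcases A.eq_empty_or_nonempty with rfl | hne
  · rw [Finset.card_empty]; omega
  · have h₁ := (h A hA hne).1
    have h₂ := Finset.card_le_card hAW
    omega

theorem Sparse.card_le_of_isPotential {F A : Finset E} (h : H.Sparse F) (hA : A ⊆ F)
    {g : V → Γ} (hg : H.IsPotential (A : Set E) g) {W : Finset V} (hW : W.Nonempty)
    (hAW : H.verts A ⊆ W) : A.card + 3 ≤ 2 * W.card ∨ A.card = 0 ∧ W.card = 1 := by
  have h₀ := Finset.card_pos.2 hW
  rcases A.eq_empty_or_nonempty with rfl | hne
  · rw [Finset.card_empty]; omega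
  · have h₁ := (h A hA hne).2 ⟨g, hg⟩
    have h₂ := Finset.card_le_card hAW
    omega

open scoped Classical in
/-- Two balanced edge sets whose potentials agree at some but not all common vertices have few
common edges. -/
theorem Sparse.card_inter_of_disagree {F A B : Finset E} (h : H.Sparse F) (hA : A ⊆ F)
    {g g' : V → Γ} (hg : H.IsPotential (A : Set E) g) (hg' : H.IsPotential (B : Set E) g')
    {x y : V} (hx : x ∈ H.verts A ∩ H.verts B) (hy : y ∈ H.verts A ∩ H.verts B)
    (hgx : g x = g' x) (hgy : g y ≠ g' y) :
    (A ∩ B).card + 5 ≤ 2 * (H.verts A ∩ H.verts B).card ∨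
      (A ∩ B).card = 0 ∧ (H.verts A ∩ H.verts B).card = 2 := by
  have hst : ∀ e ∈ A ∩ B, (g (H.src e) = g' (H.src e) ↔ g (H.tgt e) = g' (H.tgt e)) := by
    intro e he
    rw [Finset.mem_inter] at he
    have h₁ := hg e he.1
    rw [hg' e he.2] at h₁
    constructor
    · intro h₂
      rw [h₂] at h₁
      exact (mul_left_cancel h₁).symm
    · intro h₂
      rw [h₂] at h₁
      exact (inv_injective (mul_right_cancel h₁)).symm
  have hsub : A ∩ B ⊆ A := Finset.inter_subset_left
  have h₁ := h.card_le_of_isPotential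
    (A := (A ∩ B).filter fun e => g (H.src e) = g' (H.src e)) (g := g)
    (W := (H.verts A ∩ H.verts B).filter fun v => g v = g' v)
    ((Finset.filter_subset _ _).trans (hsub.trans hA))
    (hg.mono (by exact_mod_cast (Finset.filter_subset _ _).trans hsub))
    ⟨x, Finset.mem_filter.2 ⟨hx, hgx⟩⟩ (by
      intro v hv
      obtain ⟨e, he, hev⟩ := mem_verts.1 hv
      rw [Finset.mem_filter] at he
      have hv' := verts_inter_subset A B (mem_verts.2 ⟨e, he.1, hev⟩)
      refine Finset.mem_filter.2 ⟨hv', ?_⟩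
      rcases hev with rfl | rfl
      · exact he.2
      · exact (hst e he.1).1 he.2)
  have h₂ := h.card_le_of_isPotential
    (A := (A ∩ B).filter fun e => ¬ g (H.src e) = g' (H.src e)) (g := g)
    (W := (H.verts A ∩ H.verts B).filter fun v => ¬ g v = g' v)
    ((Finset.filter_subset _ _).trans (hsub.trans hA))
    (hg.mono (by exact_mod_cast (Finset.filter_subset _ _).trans hsub))
    ⟨y, Finset.mem_filter.2 ⟨hy, hgy⟩⟩ (by
      intro v hv
      obtain ⟨e, he, hev⟩ := mem_verts.1 hv
      rw [Finset.mem_filter] at he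
      have hv' := verts_inter_subset A B (mem_verts.2 ⟨e, he.1, hev⟩)
      refine Finset.mem_filter.2 ⟨hv', ?_⟩
      rcases hev with rfl | rfl
      · exact he.2
      · exact fun h' => he.2 ((hst e he.1).2 h'))
  have h₃ := Finset.card_filter_add_card_filter_not (s := A ∩ B)
    (fun e => g (H.src e) = g' (H.src e))
  have h₄ := Finset.card_filter_add_card_filter_not (s := H.verts A ∩ H.verts B)
    (fun v => g v = g' v)
  omega

variable (H) in
/-- A subset of `F` which obstructs the insertion of an edge of gain `h⁻¹ * h'` from `u` to `u'`:
an unbalanced or a balanced tight set. -/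
def Obstructed (F : Finset E) (u : V) (h : Γ) (u' : V) (h' : Γ) : Prop :=
  ∃ A ⊆ F, u ∈ H.verts A ∧ u' ∈ H.verts A ∧ (2 * (H.verts A).card ≤ A.card + 1 ∨
    ∃ g, H.IsPotential (A : Set E) g ∧ g u = h ∧ g u' = h' ∧ 2 * (H.verts A).card ≤ A.card + 3)

variable (H) in
/-- The bounds which an edge set `F` satisfies if it remains sparse when a new vertex is joined
to the vertices `u i` by edges of gains `h i`. -/
structure AdmitsThree (F : Finset E) (u₁ : V) (h₁ : Γ) (u₂ : V) (h₂ : Γ) (u₃ : V) (h₃ : Γ) :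
    Prop where
  sparse : H.Sparse F
  card_le : ∀ A ⊆ F, u₁ ∈ H.verts A → u₂ ∈ H.verts A → u₃ ∈ H.verts A →
    A.card + 2 ≤ 2 * (H.verts A).card
  card_le_of_isPotential : ∀ A ⊆ F, ∀ g, H.IsPotential (A : Set E) g →
    u₁ ∈ H.verts A → u₂ ∈ H.verts A → u₃ ∈ H.verts A → g u₁ = h₁ → g u₂ = h₂ → g u₃ = h₃ →
    A.card + 4 ≤ 2 * (H.verts A).card

section AdmitsThree

variable {F A B C : Finset E} {u₁ u₂ u₃ : V} {h₁ h₂ h₃ : Γ}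

theorem AdmitsThree.swap (h : H.AdmitsThree F u₁ h₁ u₂ h₂ u₃ h₃) :
    H.AdmitsThree F u₂ h₂ u₁ h₁ u₃ h₃ :=
  ⟨h.sparse, fun A hA a b c => h.card_le A hA b a c,
    fun A hA g hg a b c a' b' c' => h.card_le_of_isPotential A hA g hg b a c b' a' c'⟩

theorem AdmitsThree.rotate (h : H.AdmitsThree F u₁ h₁ u₂ h₂ u₃ h₃) :
    H.AdmitsThree F u₂ h₂ u₃ h₃ u₁ h₁ :=
  ⟨h.sparse, fun A hA a b c => h.card_le A hA c a b,
    fun A hA g hg a b c a' b' c' => h.card_le_of_isPotential A hA g hg c a b c' a' b'⟩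

theorem AdmitsThree.not_tight_tight (h : H.AdmitsThree F u₁ h₁ u₂ h₂ u₃ h₃) (hA : A ⊆ F)
    (hB : B ⊆ F) (hA₁ : u₁ ∈ H.verts A) (hA₂ : u₂ ∈ H.verts A) (hB₁ : u₁ ∈ H.verts B)
    (hB₃ : u₃ ∈ H.verts B) (hAt : 2 * (H.verts A).card ≤ A.card + 1)
    (hBt : 2 * (H.verts B).card ≤ B.card + 1) : False := by
  classical
  have e₁ := Finset.card_union_add_card_inter A B
  have e₂ := H.card_verts_union A B
  have e₃ := h.sparse.card_le (Finset.inter_subset_left.trans hA)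
    ⟨u₁, Finset.mem_inter.2 ⟨hA₁, hB₁⟩⟩ (verts_inter_subset A B)
  have e₄ := h.card_le (A ∪ B) (Finset.union_subset hA hB)
    (verts_mono Finset.subset_union_left hA₁) (verts_mono Finset.subset_union_left hA₂)
    (verts_mono Finset.subset_union_right hB₃)
  omega

open scoped Classical in
theorem AdmitsThree.card_inter_of_tight (h : H.AdmitsThree F u₁ h₁ u₂ h₂ u₃ h₃) (hA : A ⊆ F)
    (hB : B ⊆ F) (hA₁ : u₁ ∈ H.verts A) (hA₂ : u₂ ∈ H.verts A) (hB₁ : u₁ ∈ H.verts B)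
    (hB₃ : u₃ ∈ H.verts B) (hAt : 2 * (H.verts A).card ≤ A.card + 1) {g : V → Γ}
    (hg : H.IsPotential (B : Set E) g) (hBt : 2 * (H.verts B).card ≤ B.card + 3) :
    (A ∩ B).card = 0 := by
  have e₁ := Finset.card_union_add_card_inter A B
  have e₂ := H.card_verts_union A B
  have e₃ := h.sparse.card_le_of_isPotential (Finset.inter_subset_left.trans hA)
    (hg.mono (by exact_mod_cast Finset.inter_subset_right))
    ⟨u₁, Finset.mem_inter.2 ⟨hA₁, hB₁⟩⟩ (verts_inter_subset A B)
  have e₄ := h.card_le (A ∪ B) (Finset.union_subset hA hB)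
    (verts_mono Finset.subset_union_left hA₁) (verts_mono Finset.subset_union_left hA₂)
    (verts_mono Finset.subset_union_right hB₃)
  omega

theorem AdmitsThree.not_tight_balanced_balanced (h : H.AdmitsThree F u₁ h₁ u₂ h₂ u₃ h₃)
    (h₁₂ : u₁ = u₂ → h₁ ≠ h₂) (hA : A ⊆ F) (hB : B ⊆ F) (hC : C ⊆ F)
    (hA₁ : u₁ ∈ H.verts A) (hA₂ : u₂ ∈ H.verts A) (hB₁ : u₁ ∈ H.verts B)
    (hB₃ : u₃ ∈ H.verts B) (hC₂ : u₂ ∈ H.verts C) (hC₃ : u₃ ∈ H.verts C)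
    (hAt : 2 * (H.verts A).card ≤ A.card + 1) {g g' : V → Γ}
    (hg : H.IsPotential (B : Set E) g) (hBt : 2 * (H.verts B).card ≤ B.card + 3)
    (hg' : H.IsPotential (C : Set E) g') (hCt : 2 * (H.verts C).card ≤ C.card + 3)
    (hg₁ : g u₁ = h₁) (hg₃ : g u₃ = h₃) (hg'₂ : g' u₂ = h₂) (hg'₃ : g' u₃ = h₃) : False := by
  classical
  have e₁ := h.card_inter_of_tight hA hB hA₁ hA₂ hB₁ hB₃ hAt hg hBt
  have e₂ := h.swap.card_inter_of_tight hA hC hA₂ hA₁ hC₂ hC₃ hAt hg' hCt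
  have e₃ : (A ∩ (B ∪ C)).card = 0 := by
    rw [Finset.inter_union_distrib_left]
    have := Finset.card_union_le (A ∩ B) (A ∩ C)
    omega
  have e₄ := Finset.card_union_add_card_inter A (B ∪ C)
  have e₅ := H.card_verts_union A (B ∪ C)
  have e₆ := Finset.card_union_add_card_inter B C
  have e₇ := H.card_verts_union B C
  have m₁ : u₁ ∈ H.verts A ∩ H.verts (B ∪ C) :=
    Finset.mem_inter.2 ⟨hA₁, verts_mono Finset.subset_union_left hB₁⟩
  have m₂ : u₂ ∈ H.verts A ∩ H.verts (B ∪ C) :=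
    Finset.mem_inter.2 ⟨hA₂, verts_mono Finset.subset_union_right hC₂⟩
  have m₃ : u₃ ∈ H.verts B ∩ H.verts C := Finset.mem_inter.2 ⟨hB₃, hC₃⟩
  have e₈ := h.card_le (A ∪ (B ∪ C)) (Finset.union_subset hA (Finset.union_subset hB hC))
    (verts_mono Finset.subset_union_left hA₁) (verts_mono Finset.subset_union_left hA₂)
    (verts_mono (Finset.subset_union_left.trans Finset.subset_union_right) hB₃)
  by_cases hu : u₁ = u₂
  · have e₉ := Finset.card_pos.2 ⟨u₁, m₁⟩
    have e₁₀ := h.sparse.card_inter_of_disagree hB hg hg' m₃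
      (Finset.mem_inter.2 ⟨hB₁, by rw [hu]; exact hC₂⟩) (hg₃.trans hg'₃.symm)
      (by rw [hg₁, hu, hg'₂]; exact h₁₂ hu)
    omega
  · have e₉ := Finset.one_lt_card.2 ⟨u₁, m₁, u₂, m₂, hu⟩
    have e₁₀ := h.sparse.card_le_of_isPotential (Finset.inter_subset_left.trans hB)
      (hg.mono (by exact_mod_cast Finset.inter_subset_left)) ⟨u₃, m₃⟩ (verts_inter_subset B C)
    omega

open scoped Classical in
theorem AdmitsThree.card_inter_of_balanced (h : H.AdmitsThree F u₁ h₁ u₂ h₂ u₃ h₃) (hA : A ⊆ F)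
    (hB : B ⊆ F) (hA₁ : u₁ ∈ H.verts A) (hA₂ : u₂ ∈ H.verts A) (hB₁ : u₁ ∈ H.verts B)
    (hB₃ : u₃ ∈ H.verts B) {g g' : V → Γ}
    (hg : H.IsPotential (A : Set E) g) (hAt : 2 * (H.verts A).card ≤ A.card + 3)
    (hg' : H.IsPotential (B : Set E) g') (hBt : 2 * (H.verts B).card ≤ B.card + 3)
    (hg₁ : g u₁ = h₁) (hg₂ : g u₂ = h₂) (hg'₁ : g' u₁ = h₁) (hg'₃ : g' u₃ = h₃) :
    (A ∩ B).card = 0 ∧ ((H.verts A ∩ H.verts B).card = 2 ∨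
      (H.verts A ∩ H.verts B).card = 1) := by
  have m₁ : u₁ ∈ H.verts A ∩ H.verts B := Finset.mem_inter.2 ⟨hA₁, hB₁⟩
  have e₁ := Finset.card_union_add_card_inter A B
  have e₂ := H.card_verts_union A B
  have v₁ : u₁ ∈ H.verts (A ∪ B) := verts_mono Finset.subset_union_left hA₁
  have v₂ : u₂ ∈ H.verts (A ∪ B) := verts_mono Finset.subset_union_left hA₂
  have v₃ : u₃ ∈ H.verts (A ∪ B) := verts_mono Finset.subset_union_right hB₃
  by_cases hgg' : ∀ v ∈ H.verts A ∩ H.verts B, g v = g' v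
  · obtain ⟨f, hf, hfA, hfB⟩ := hg.merge hg' hgg'
    have e₃ := h.card_le_of_isPotential (A ∪ B) (Finset.union_subset hA hB) f hf v₁ v₂ v₃
      ((hfA _ hA₁).trans hg₁) ((hfA _ hA₂).trans hg₂) ((hfB _ hB₃).trans hg'₃)
    have e₄ := h.sparse.card_le_of_isPotential (Finset.inter_subset_left.trans hA)
      (hg.mono (by exact_mod_cast Finset.inter_subset_left)) ⟨u₁, m₁⟩ (verts_inter_subset A B)
    omega
  · push Not at hgg'
    obtain ⟨y, hy, hgy⟩ := hgg'
    have e₃ := h.card_le (A ∪ B) (Finset.union_subset hA hB) v₁ v₂ v₃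
    have e₄ := h.sparse.card_inter_of_disagree hA hg hg' m₁ hy (hg₁.trans hg'₁.symm) hgy
    omega

theorem AdmitsThree.not_balanced_balanced_balanced (h : H.AdmitsThree F u₁ h₁ u₂ h₂ u₃ h₃)
    (h₁₂ : u₁ = u₂ → h₁ ≠ h₂) (h₁₃ : u₁ = u₃ → h₁ ≠ h₃) (h₂₃ : u₂ = u₃ → h₂ ≠ h₃)
    (hA : A ⊆ F) (hB : B ⊆ F) (hC : C ⊆ F)
    (hA₁ : u₁ ∈ H.verts A) (hA₂ : u₂ ∈ H.verts A) (hB₁ : u₁ ∈ H.verts B)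
    (hB₃ : u₃ ∈ H.verts B) (hC₂ : u₂ ∈ H.verts C) (hC₃ : u₃ ∈ H.verts C) {g g' g'' : V → Γ}
    (hg : H.IsPotential (A : Set E) g) (hAt : 2 * (H.verts A).card ≤ A.card + 3)
    (hg' : H.IsPotential (B : Set E) g') (hBt : 2 * (H.verts B).card ≤ B.card + 3)
    (hg'' : H.IsPotential (C : Set E) g'') (hCt : 2 * (H.verts C).card ≤ C.card + 3)
    (hg₁ : g u₁ = h₁) (hg₂ : g u₂ = h₂) (hg'₁ : g' u₁ = h₁) (hg'₃ : g' u₃ = h₃)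
    (hg''₂ : g'' u₂ = h₂) (hg''₃ : g'' u₃ = h₃) : False := by
  classical
  obtain ⟨ab, wab⟩ := h.card_inter_of_balanced hA hB hA₁ hA₂ hB₁ hB₃ hg hAt hg' hBt
    hg₁ hg₂ hg'₁ hg'₃
  obtain ⟨ac, -⟩ := h.swap.card_inter_of_balanced hA hC hA₂ hA₁ hC₂ hC₃ hg hAt hg'' hCt
    hg₂ hg₁ hg''₂ hg''₃
  obtain ⟨bc, -⟩ := h.rotate.rotate.card_inter_of_balanced hB hC hB₃ hB₁ hC₃ hC₂ hg' hBt
    hg'' hCt hg'₃ hg'₁ hg''₃ hg''₂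
  have u₁₂ : u₁ ≠ u₂ := fun hu => h₁₂ hu (by rw [← hg₁, hu, hg₂])
  have u₁₃ : u₁ ≠ u₃ := fun hu => h₁₃ hu (by rw [← hg'₁, hu, hg'₃])
  have u₂₃ : u₂ ≠ u₃ := fun hu => h₂₃ hu (by rw [← hg''₂, hu, hg''₃])
  have k₁ := Finset.card_union_add_card_inter A B
  have k₂ := Finset.card_union_add_card_inter (A ∪ B) C
  have k₃ := H.card_verts_union A B
  have k₄ := H.card_verts_union (A ∪ B) C
  have k₅ : ((A ∪ B) ∩ C).card = 0 := by
    rw [Finset.union_inter_distrib_right]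
    have := Finset.card_union_le (A ∩ C) (B ∩ C)
    omega
  have hV : H.verts (A ∪ B) ∩ H.verts C =
      (H.verts A ∩ H.verts C) ∪ (H.verts B ∩ H.verts C) := by
    rw [verts_union, Finset.union_inter_distrib_right]
  have mab : u₁ ∈ H.verts A ∩ H.verts B := Finset.mem_inter.2 ⟨hA₁, hB₁⟩
  have mac : u₂ ∈ H.verts A ∩ H.verts C := Finset.mem_inter.2 ⟨hA₂, hC₂⟩
  have mbc : u₃ ∈ H.verts B ∩ H.verts C := Finset.mem_inter.2 ⟨hB₃, hC₃⟩
  have k₆ : 1 < (H.verts (A ∪ B) ∩ H.verts C).card := by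
    rw [hV]
    exact Finset.one_lt_card.2 ⟨u₂, Finset.mem_union_left _ mac, u₃,
      Finset.mem_union_right _ mbc, u₂₃⟩
  have hsub : A ∪ B ∪ C ⊆ F := Finset.union_subset (Finset.union_subset hA hB) hC
  have v₁ : u₁ ∈ H.verts (A ∪ B ∪ C) :=
    verts_mono (Finset.subset_union_left.trans Finset.subset_union_left) hA₁
  have v₂ : u₂ ∈ H.verts (A ∪ B ∪ C) := verts_mono Finset.subset_union_right hC₂
  have v₃ : u₃ ∈ H.verts (A ∪ B ∪ C) := verts_mono Finset.subset_union_right hC₃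
  have k₇ := h.card_le _ hsub v₁ v₂ v₃
  have wab' : (H.verts A ∩ H.verts B).card = 1 := by omega
  have wD : (H.verts (A ∪ B) ∩ H.verts C).card = 2 := by omega
  obtain ⟨x, hx⟩ := Finset.card_eq_one.1 wab'
  obtain ⟨f, hf, hfA, hfB⟩ := hg.merge hg' (by
    rw [hx, Finset.mem_singleton] at mab
    intro v hv
    rw [hx, Finset.mem_singleton] at hv
    rw [hv, ← mab, hg₁, hg'₁])
  have hD : {u₂, u₃} = H.verts (A ∪ B) ∩ H.verts C := by
    refine Finset.eq_of_subset_of_card_le ?_ (by rw [wD, Finset.card_pair u₂₃])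
    rw [hV]
    exact Finset.insert_subset (Finset.mem_union_left _ mac)
      (Finset.singleton_subset_iff.2 (Finset.mem_union_right _ mbc))
  obtain ⟨f', hf', hfD, hfC⟩ := hf.merge hg'' (by
    rw [← hD]
    intro v hv
    rcases Finset.mem_insert.1 hv with rfl | hv
    · rw [hfA _ hA₂, hg₂, hg''₂]
    · rw [Finset.mem_singleton.1 hv, hfB _ hB₃, hg'₃, hg''₃])
  have k₈ := h.card_le_of_isPotential _ hsub f' hf' v₁ v₂ v₃
    (by rw [hfD _ (verts_mono Finset.subset_union_left hA₁), hfA _ hA₁, hg₁])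
    ((hfC _ hC₂).trans hg''₂) ((hfC _ hC₃).trans hg''₃)
  omega

/-- One of the three edges which may replace a vertex of degree three is not obstructed. -/
theorem AdmitsThree.exists_not_obstructed (h : H.AdmitsThree F u₁ h₁ u₂ h₂ u₃ h₃)
    (h₁₂ : u₁ = u₂ → h₁ ≠ h₂) (h₁₃ : u₁ = u₃ → h₁ ≠ h₃) (h₂₃ : u₂ = u₃ → h₂ ≠ h₃) :
    ¬ H.Obstructed F u₁ h₁ u₂ h₂ ∨ ¬ H.Obstructed F u₁ h₁ u₃ h₃ ∨
      ¬ H.Obstructed F u₂ h₂ u₃ h₃ := by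
  by_contra! hc
  obtain ⟨⟨A, hA, hA₁, hA₂, hAt⟩, ⟨B, hB, hB₁, hB₃, hBt⟩, C, hC, hC₂, hC₃, hCt⟩ := hc
  rcases hAt with hAt | ⟨g, hg, hg₁, hg₂, hAt⟩
  · rcases hBt with hBt | ⟨g', hg', hg'₁, hg'₃, hBt⟩
    · exact h.not_tight_tight hA hB hA₁ hA₂ hB₁ hB₃ hAt hBt
    · rcases hCt with hCt | ⟨g'', hg'', hg''₂, hg''₃, hCt⟩
      · exact h.swap.not_tight_tight hA hC hA₂ hA₁ hC₂ hC₃ hAt hCt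
      · exact h.not_tight_balanced_balanced h₁₂ hA hB hC hA₁ hA₂ hB₁ hB₃ hC₂ hC₃ hAt hg' hBt
          hg'' hCt hg'₁ hg'₃ hg''₂ hg''₃
  · rcases hBt with hBt | ⟨g', hg', hg'₁, hg'₃, hBt⟩
    · rcases hCt with hCt | ⟨g'', hg'', hg''₂, hg''₃, hCt⟩
      · exact h.rotate.rotate.not_tight_tight hB hC hB₃ hB₁ hC₃ hC₂ hBt hCt
      · exact h.swap.rotate.not_tight_balanced_balanced h₁₃ hB hA hC hB₁ hB₃
          hA₁ hA₂ hC₃ hC₂ hBt hg hAt hg'' hCt hg₁ hg₂ hg''₃ hg''₂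
    · rcases hCt with hCt | ⟨g'', hg'', hg''₂, hg''₃, hCt⟩
      · exact h.rotate.not_tight_balanced_balanced h₂₃ hC hA hB hC₂ hC₃
          hA₂ hA₁ hB₃ hB₁ hCt hg hAt hg' hBt hg₂ hg₁ hg'₃ hg'₁
      · exact h.not_balanced_balanced_balanced h₁₂ h₁₃ h₂₃ hA hB hC hA₁ hA₂ hB₁ hB₃ hC₂ hC₃
          hg hAt hg' hBt hg'' hCt hg₁ hg₂ hg'₁ hg'₃ hg''₂ hg''₃

end AdmitsThree

end GainGraph

/-! ## Generic properties -/

section Generic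

variable {P : Type*} [NormedAddCommGroup P] [NormedSpace ℝ P]

theorem AnalyticOnNhd.eventually_residual_ne_zero {f : P → ℂ}
    (hf : AnalyticOnNhd ℝ f Set.univ) {q₀ : P} (h : f q₀ ≠ 0) :
    ∀ᶠ q in residual P, f q ≠ 0 := by
  have hc : Continuous f := by
    rw [← continuousOn_univ]
    exact hf.continuousOn
  refine residual_of_dense_open (s := {q | f q ≠ 0}) (isOpen_ne_fun hc continuous_const) ?_
  intro x
  rw [mem_closure_iff_frequently]
  by_contra hx
  rw [Filter.not_frequently] at hx
  exact h (hf.eqOn_zero_of_preconnected_of_eventuallyEq_zero isPreconnected_univ (Set.mem_univ x)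
    (hx.mono fun y hy => not_not.1 hy) (Set.mem_univ q₀))

theorem eventually_residual_linearIndepOn {ι κ : Type*} [Fintype κ] {f : P → ι → κ → ℂ}
    (hf : ∀ e k, AnalyticOnNhd ℝ (fun q => f q e k) Set.univ) {s : Finset ι} {q₀ : P}
    (h : LinearIndepOn ℂ (f q₀) s) : ∀ᶠ q in residual P, LinearIndepOn ℂ (f q) s := by
  classical
  let A : P → Matrix s κ ℂ := fun q e k => f q e k
  have hA : ∀ q, LinearIndepOn ℂ (f q) s ↔ LinearIndependent ℂ (A q).row := fun q => Iff.rfl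
  obtain ⟨B, hB⟩ : ∃ B : Matrix κ s ℂ, A q₀ * B = 1 := by
    rw [hA, ← Matrix.vecMul_injective_iff] at h
    obtain ⟨g, hg⟩ := LinearMap.exists_leftInverse_of_injective (A q₀).vecMulLinear
      (LinearMap.ker_eq_bot.2 h)
    refine ⟨LinearMap.toMatrixRight' g, ?_⟩
    apply Matrix.toLinearMapRight'.injective
    rw [Matrix.toLinearMapRight'_mul, Matrix.toLinearMapRight'_one,
      (LinearMap.toMatrixRight'.symm_apply_apply g : Matrix.toLinearMapRight' _ = g)]
    exact hg
  have han : AnalyticOnNhd ℝ (fun q => (A q * B).det) Set.univ := by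
    intro q _
    simp only [Matrix.det_apply', Matrix.mul_apply]
    refine Finset.analyticAt_fun_sum _ fun σ _ => analyticAt_const.mul ?_
    refine Finset.analyticAt_fun_prod _ fun e _ => ?_
    refine Finset.analyticAt_fun_sum _ fun k _ => AnalyticAt.mul ?_ analyticAt_const
    exact hf _ k q (Set.mem_univ q)
  filter_upwards [han.eventually_residual_ne_zero (q₀ := q₀) (by simp [hB])] with q hq
  rw [hA, ← Matrix.vecMul_injective_iff]
  refine (injective_iff_map_eq_zero (A q).vecMulLinear).2 fun c hc => ?_
  refine Matrix.eq_zero_of_vecMul_eq_zero hq ?_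
  have hc' : Matrix.vecMul c (A q) = 0 := hc
  rw [← Matrix.vecMul_vecMul, hc', Matrix.zero_vecMul]

end Generic

/-- If the functions indexed by `s` vanish on a set of coordinates where those indexed by `t` are
independent, then independence of the former extends to all. -/
theorem LinearIndepOn.union_of_block {K ι κ : Type*} [Field K] [DecidableEq ι] {f : ι → κ → K}
    {S : Type*} (φ : S → κ)
    {s t : Finset ι} (hs : LinearIndepOn K f s) (h₀ : ∀ e ∈ s, ∀ k, f e (φ k) = 0)
    (ht : LinearIndepOn K (fun e k => f e (φ k)) t) : LinearIndepOn K f ((s ∪ t : Finset ι)) := by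
  rw [linearIndepOn_finset_iff] at *
  have hst : ∀ e ∈ s, e ∉ t := by
    intro e he he'
    have := ht (fun i => if i = e then 1 else 0) (by
      rw [Finset.sum_eq_single_of_mem e he' (fun b _ hb => by simp [hb])]
      ext k
      simp [h₀ e he k]) e he'
    simp at this
  intro c hc
  rw [Finset.sum_union (Finset.disjoint_left.2 hst)] at hc
  have hct : ∀ e ∈ t, c e = 0 := ht c (by
    ext k
    have := congrFun hc (φ k)
    simp only [Pi.add_apply, Finset.sum_apply, Pi.smul_apply, smul_eq_mul, Pi.zero_apply] at this ⊢
    rwa [Finset.sum_eq_zero (s := s) (fun e he => by rw [h₀ e he k, mul_zero]), zero_add] at this)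
  rw [Finset.sum_eq_zero (s := t) (fun e he => by rw [hct e he, zero_smul]), add_zero] at hc
  intro e he
  rcases Finset.mem_union.1 he with he | he
  exacts [hs c hc e he, hct e he]

theorem linearIndepOn_pair_of_det_ne_zero {K ι : Type*} [Field K] {f : ι → Fin 2 → K} {i j : ι}
    (h : f i 0 * f j 1 - f i 1 * f j 0 ≠ 0) : LinearIndepOn K f {i, j} := by
  have hij : i ≠ j := by
    rintro rfl
    exact h (by ring)
  rw [LinearIndepOn.pair_iff f hij]
  intro c d hcd
  have h₀ := congrFun hcd 0
  have h₁ := congrFun hcd 1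
  simp only [Pi.add_apply, Pi.smul_apply, smul_eq_mul, Pi.zero_apply] at h₀ h₁
  constructor
  · refine (mul_eq_zero.1 (?_ : c * (f i 0 * f j 1 - f i 1 * f j 0) = 0)).resolve_right h
    linear_combination h₀ * f j 1 - h₁ * f j 0
  · refine (mul_eq_zero.1 (?_ : d * (f i 0 * f j 1 - f i 1 * f j 0) = 0)).resolve_right h
    linear_combination h₁ * f i 0 - h₀ * f i 1

/-! ## Planar rotation actions -/

/-- `τ` acts by planar rotations, and no non-identity element acts by `1` or `-1`. -/
structure IsRotationAction {Γ : Type*} [Group Γ] (τ : Γ →* Matrix.orthogonalGroup (Fin 2) ℝ) :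
    Prop where
  one_one : ∀ h, (τ h).1 1 1 = (τ h).1 0 0
  one_zero : ∀ h, (τ h).1 1 0 = -(τ h).1 0 1
  zero_one_ne_zero : ∀ h, h ≠ 1 → (τ h).1 0 1 ≠ 0

namespace IsRotationAction

variable {Γ : Type*} [Group Γ] {τ : Γ →* Matrix.orthogonalGroup (Fin 2) ℝ}

theorem sq_add_sq (h : Γ) :
    (τ h).1 0 0 ^ 2 + (τ h).1 0 1 ^ 2 = 1 := by
  have := congrFun (congrFun ((Matrix.mem_orthogonalGroup_iff (Fin 2) ℝ).1 (τ h).2) 0) 0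
  simp only [Matrix.mul_apply, Fin.sum_univ_two, Matrix.transpose_apply,
    Matrix.one_apply_eq] at this
  linear_combination this

theorem mul_zero_zero (hτ : IsRotationAction τ) (g h : Γ) :
    (τ (g * h)).1 0 0 = (τ g).1 0 0 * (τ h).1 0 0 - (τ g).1 0 1 * (τ h).1 0 1 := by
  rw [map_mul]
  simp only [Submonoid.coe_mul, Matrix.mul_apply, Fin.sum_univ_two, hτ.one_zero]
  ring

theorem mul_zero_one (hτ : IsRotationAction τ) (g h : Γ) :
    (τ (g * h)).1 0 1 = (τ g).1 0 0 * (τ h).1 0 1 + (τ g).1 0 1 * (τ h).1 0 0 := by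
  rw [map_mul]
  simp only [Submonoid.coe_mul, Matrix.mul_apply, Fin.sum_univ_two, hτ.one_one]

theorem inv_apply (g : Γ) (i j : Fin 2) : ((τ g)⁻¹).1 i j = (τ g).1 j i := by
  rfl

theorem inv_zero_zero (g : Γ) : (τ g⁻¹).1 0 0 = (τ g).1 0 0 := by
  rw [map_inv]; rfl

theorem inv_zero_one (hτ : IsRotationAction τ) (g : Γ) : (τ g⁻¹).1 0 1 = -(τ g).1 0 1 := by
  rw [map_inv, inv_apply, hτ.one_zero]

end IsRotationAction

/-! ## The complete gain graph -/

/-- The gain graph on `V` with an edge of each gain between any two vertices. -/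
def completeGainGraph (Γ V : Type*) : GainGraph Γ V (V × V × Γ) where
  src e := e.1
  tgt e := e.2.1
  gain e := e.2.2

section Rows

variable {Γ V : Type*} [Group Γ] {τ : Γ →* Matrix.orthogonalGroup (Fin 2) ℝ} {ρ : Γ →* ℂ}

open scoped Classical in
theorem completeGainGraph_row_zero (hτ : IsRotationAction τ) (q : V → Fin 2 → ℝ) (u v w : V)
    (h : Γ) :
    (completeGainGraph Γ V).orbitRigidityMatrix τ ρ q (u, v, h) (w, 0) =
      (if w = u then (q u 0 - ((τ h).1 0 0 * q v 0 + (τ h).1 0 1 * q v 1) : ℂ) else 0) +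
      (if w = v then ρ h * (q v 0 - ((τ h).1 0 0 * q u 0 - (τ h).1 0 1 * q u 1) : ℂ) else 0) := by
  simp only [GainGraph.orbitRigidityMatrix, completeGainGraph, Pi.sub_apply, Matrix.mulVec,
    dotProduct, Fin.sum_univ_two, IsRotationAction.inv_apply, hτ.one_zero]
  push_cast
  simp only [neg_mul, sub_eq_add_neg]

open scoped Classical in
theorem completeGainGraph_row_one (hτ : IsRotationAction τ) (q : V → Fin 2 → ℝ) (u v w : V)
    (h : Γ) :
    (completeGainGraph Γ V).orbitRigidityMatrix τ ρ q (u, v, h) (w, 1) =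
      (if w = u then (q u 1 - ((τ h).1 0 0 * q v 1 - (τ h).1 0 1 * q v 0) : ℂ) else 0) +
      (if w = v then ρ h * (q v 1 - ((τ h).1 0 0 * q u 1 + (τ h).1 0 1 * q u 0) : ℂ) else 0) := by
  simp only [GainGraph.orbitRigidityMatrix, completeGainGraph, Pi.sub_apply, Matrix.mulVec,
    dotProduct, Fin.sum_univ_two, IsRotationAction.inv_apply, hτ.one_zero, hτ.one_one]
  push_cast
  congr 3 <;> ring

theorem completeGainGraph_row_reverse (hτ : IsRotationAction τ) (q : V → Fin 2 → ℝ) (u v : V)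
    (h : Γ) :
    (completeGainGraph Γ V).orbitRigidityMatrix τ ρ q (u, v, h⁻¹) =
      ρ h⁻¹ • (completeGainGraph Γ V).orbitRigidityMatrix τ ρ q (v, u, h) := by
  have hρ : ρ h⁻¹ * ρ h = 1 := by rw [← map_mul, inv_mul_cancel, map_one]
  ext ⟨w, i⟩
  rw [Pi.smul_apply, smul_eq_mul]
  fin_cases i
  · simp only [Fin.zero_eta, completeGainGraph_row_zero hτ, IsRotationAction.inv_zero_zero,
      hτ.inv_zero_one]
    push_cast
    split_ifs <;> first
      | ring1
      | linear_combination (-(q u 0 : ℂ) + ((τ h).1 0 0 * q v 0 - (τ h).1 0 1 * q v 1)) * hρ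
  · simp only [Fin.mk_one, completeGainGraph_row_one hτ, IsRotationAction.inv_zero_zero,
      hτ.inv_zero_one]
    push_cast
    split_ifs <;> first
      | ring1
      | linear_combination (-(q u 1 : ℂ) + ((τ h).1 0 0 * q v 1 + (τ h).1 0 1 * q v 0)) * hρ

theorem analyticOnNhd_orbitRigidityMatrix [Fintype V] {E : Type*} (H : GainGraph Γ V E) (e : E)
    (k : V × Fin 2) :
    AnalyticOnNhd ℝ (fun q => H.orbitRigidityMatrix τ ρ q e k) Set.univ := by
  intro q _
  have key : ∀ v i, AnalyticAt ℝ (fun q : V → Fin 2 → ℝ => (q v i : ℂ)) q := by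
    intro v i
    exact (Complex.ofRealCLM.comp ((ContinuousLinearMap.proj i).comp
      (ContinuousLinearMap.proj (R := ℝ) (φ := fun _ : V => Fin 2 → ℝ) v))).analyticAt q
  simp only [GainGraph.orbitRigidityMatrix, Pi.sub_apply, Matrix.mulVec,
    dotProduct, Fin.sum_univ_two]
  push_cast
  split_ifs <;> fun_prop

end Rows

/-! ## Rotated positions -/

section Positions

variable {Γ V : Type*} [Group Γ] {τ : Γ →* Matrix.orthogonalGroup (Fin 2) ℝ} {ρ : Γ →* ℂ}

theorem mulVec_map_inv_mulVec (h : Γ) (x : Fin 2 → ℝ) :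
    (τ h).1.mulVec ((τ h⁻¹).1.mulVec x) = x := by
  rw [Matrix.mulVec_mulVec, ← Submonoid.coe_mul, ← map_mul, mul_inv_cancel, map_one]
  exact Matrix.one_mulVec x

theorem mulVec_map_mulVec (g h : Γ) (x : Fin 2 → ℝ) :
    (τ g).1.mulVec ((τ h).1.mulVec x) = (τ (g * h)).1.mulVec x := by
  rw [Matrix.mulVec_mulVec, ← Submonoid.coe_mul, ← map_mul]

theorem IsRotationAction.mulVec_zero (h : Γ) (x : Fin 2 → ℝ) :
    (τ h).1.mulVec x 0 = (τ h).1 0 0 * x 0 + (τ h).1 0 1 * x 1 := by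
  simp [Matrix.mulVec, dotProduct, Fin.sum_univ_two]

theorem IsRotationAction.mulVec_one (hτ : IsRotationAction τ) (h : Γ) (x : Fin 2 → ℝ) :
    (τ h).1.mulVec x 1 = (τ h).1 0 0 * x 1 - (τ h).1 0 1 * x 0 := by
  simp [Matrix.mulVec, dotProduct, Fin.sum_univ_two, hτ.one_zero, hτ.one_one]
  ring

/-- The area spanned by two points with the origin. -/
def area₂ (x y : Fin 2 → ℝ) : ℝ := x 0 * y 1 - x 1 * y 0

/-- The area spanned by three points. -/
def area₃ (x y z : Fin 2 → ℝ) : ℝ := area₂ (y - x) (z - x)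

theorem IsRotationAction.exists_area₂_ne_zero (hτ : IsRotationAction τ) {u₁ u₂ : V} {h₁ h₂ : Γ}
    (h₁₂ : u₁ = u₂ → h₁ ≠ h₂) : ∃ q : V → Fin 2 → ℝ, (∀ v, v ≠ u₁ → v ≠ u₂ → q v = 0) ∧
      area₂ ((τ h₁).1.mulVec (q u₁)) ((τ h₂).1.mulVec (q u₂)) ≠ 0 := by
  classical
  by_cases hu : u₁ = u₂
  · subst hu
    refine ⟨Function.update 0 u₁ ((τ h₁⁻¹).1.mulVec ![1, 0]), fun v hv _ => by simp [hv], ?_⟩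
    rw [Function.update_self, mulVec_map_inv_mulVec, mulVec_map_mulVec]
    have := hτ.zero_one_ne_zero (h₂ * h₁⁻¹) (by
      rw [Ne, mul_inv_eq_one]
      exact (h₁₂ rfl).symm)
    generalize h₂ * h₁⁻¹ = g at *
    simpa [area₂, hτ.mulVec_one] using this
  · refine ⟨Function.update (Function.update 0 u₁ ((τ h₁⁻¹).1.mulVec ![1, 0])) u₂
      ((τ h₂⁻¹).1.mulVec ![0, 1]), fun v hv hv' => by simp [hv, hv'], ?_⟩
    rw [Function.update_of_ne hu, Function.update_self, Function.update_self,
      mulVec_map_inv_mulVec, mulVec_map_inv_mulVec]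
    simp [area₂]

theorem IsRotationAction.exists_area₃_ne_zero (hτ : IsRotationAction τ) {u₁ u₂ u₃ : V}
    {h₁ h₂ h₃ : Γ} (h₁₂ : u₁ = u₂ → h₁ ≠ h₂) (h₁₃ : u₁ = u₃ → h₁ ≠ h₃)
    (h₂₃ : u₂ = u₃ → h₂ ≠ h₃) : ∃ q : V → Fin 2 → ℝ,
      area₃ ((τ h₁).1.mulVec (q u₁)) ((τ h₂).1.mulVec (q u₂)) ((τ h₃).1.mulVec (q u₃)) ≠ 0 := by
  classical
  have key : ∀ {u₁ u₂ u₃ : V} {h₁ h₂ h₃ : Γ}, (u₁ = u₂ → h₁ ≠ h₂) → u₁ ≠ u₃ → u₂ ≠ u₃ →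
      ∃ q : V → Fin 2 → ℝ, area₃ ((τ h₁).1.mulVec (q u₁)) ((τ h₂).1.mulVec (q u₂))
        ((τ h₃).1.mulVec (q u₃)) ≠ 0 := by
    intro u₁ u₂ u₃ h₁ h₂ h₃ h₁₂ h₁₃ h₂₃
    obtain ⟨q, hq, hq'⟩ := hτ.exists_area₂_ne_zero h₁₂
    refine ⟨q, ?_⟩
    rw [hq u₃ h₁₃.symm h₂₃.symm, Matrix.mulVec_zero]
    intro h
    refine hq' ?_
    simp only [area₃, area₂, Pi.sub_apply, Pi.zero_apply] at h ⊢
    linear_combination h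
  have hrot : ∀ x y z, area₃ x y z = area₃ y z x := by
    intro x y z
    simp only [area₃, area₂, Pi.sub_apply]
    ring
  by_cases e₁₃ : u₁ = u₃
  · by_cases e₁₂ : u₁ = u₂
    · subst e₁₃ e₁₂
      refine ⟨fun _ => (τ h₁⁻¹).1.mulVec ![1, 0], ?_⟩
      rw [mulVec_map_inv_mulVec, mulVec_map_mulVec, mulVec_map_mulVec]
      have n₂ := hτ.zero_one_ne_zero (h₂ * h₁⁻¹) (by
        rw [Ne, mul_inv_eq_one]; exact (h₁₂ rfl).symm)
      have n₃ := hτ.zero_one_ne_zero (h₃ * h₁⁻¹) (by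
        rw [Ne, mul_inv_eq_one]; exact (h₁₃ rfl).symm)
      have n₂₃ := hτ.zero_one_ne_zero ((h₂ * h₁⁻¹) * (h₃ * h₁⁻¹)⁻¹) (by
        rw [Ne, mul_inv_eq_one, mul_left_inj]; exact h₂₃ rfl)
      rw [hτ.mul_zero_one, hτ.inv_zero_one, IsRotationAction.inv_zero_zero] at n₂₃
      have s₂ := IsRotationAction.sq_add_sq (τ := τ) (h₂ * h₁⁻¹)
      have s₃ := IsRotationAction.sq_add_sq (τ := τ) (h₃ * h₁⁻¹)
      simp only [area₃, area₂, Pi.sub_apply, hτ.mulVec_one, IsRotationAction.mulVec_zero]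
      generalize (τ (h₂ * h₁⁻¹)).1 0 0 = c at *
      generalize (τ (h₂ * h₁⁻¹)).1 0 1 = s at *
      generalize (τ (h₃ * h₁⁻¹)).1 0 0 = c' at *
      generalize (τ (h₃ * h₁⁻¹)).1 0 1 = s' at *
      intro h
      have e : (c - 1) * s' = (c' - 1) * s := by
        simp at h
        linear_combination -h
      have hc : c ≠ 1 := by
        rintro rfl
        exact n₂ (by nlinarith)
      have hc' : c' ≠ 1 := by
        rintro rfl
        exact n₃ (by nlinarith)
      have e₁ : (c - 1) * (c' - 1) * (2 * (c' - c)) = 0 := by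
        linear_combination ((c - 1) * s' + (c' - 1) * s) * e - (c - 1) ^ 2 * s₃ +
          (c' - 1) ^ 2 * s₂
      have e₂ : c' = c := by
        rcases mul_eq_zero.1 e₁ with e₁ | e₁
        · rcases mul_eq_zero.1 e₁ with e₁ | e₁
          · exact absurd (sub_eq_zero.1 e₁) hc
          · exact absurd (sub_eq_zero.1 e₁) hc'
        · linarith
      subst e₂
      have e₃ : s' = s := mul_left_cancel₀ (sub_ne_zero.2 hc') e
      subst e₃
      exact n₂₃ (by ring)
    · obtain ⟨q, hq⟩ := key (h₁ := h₃) (h₂ := h₁) (h₃ := h₂) (fun e => (h₁₃ e.symm).symm)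
        (fun e => e₁₂ (e₁₃.trans e)) e₁₂
      exact ⟨q, by rwa [hrot] at hq⟩
  · by_cases e₂₃ : u₂ = u₃
    · obtain ⟨q, hq⟩ := key (h₁ := h₂) (h₂ := h₃) (h₃ := h₁) h₂₃ (fun e => e₁₃ (e.symm.trans e₂₃))
        (fun e => e₁₃ e.symm)
      exact ⟨q, by rwa [hrot]⟩
    · exact key h₁₂ e₁₃ e₂₃

theorem analyticOnNhd_mulVec [Fintype V] (h : Γ) (u : V) (i : Fin 2) :
    AnalyticOnNhd ℝ (fun q : V → Fin 2 → ℝ => ((τ h).1.mulVec (q u) i : ℂ)) Set.univ := by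
  intro q _
  have key : ∀ v i, AnalyticAt ℝ (fun q : V → Fin 2 → ℝ => (q v i : ℂ)) q := by
    intro v i
    exact (Complex.ofRealCLM.comp ((ContinuousLinearMap.proj i).comp
      (ContinuousLinearMap.proj (R := ℝ) (φ := fun _ : V => Fin 2 → ℝ) v))).analyticAt q
  simp only [Matrix.mulVec, dotProduct, Fin.sum_univ_two]
  push_cast
  fun_prop

theorem IsRotationAction.eventually_area₃_ne_zero [Fintype V] (hτ : IsRotationAction τ)
    {u₁ u₂ u₃ : V} {h₁ h₂ h₃ : Γ} (h₁₂ : u₁ = u₂ → h₁ ≠ h₂) (h₁₃ : u₁ = u₃ → h₁ ≠ h₃)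
    (h₂₃ : u₂ = u₃ → h₂ ≠ h₃) : ∀ᶠ q in residual (V → Fin 2 → ℝ),
      area₃ ((τ h₁).1.mulVec (q u₁)) ((τ h₂).1.mulVec (q u₂)) ((τ h₃).1.mulVec (q u₃)) ≠ 0 := by
  obtain ⟨q₀, hq₀⟩ := hτ.exists_area₃_ne_zero h₁₂ h₁₃ h₂₃
  have han : AnalyticOnNhd ℝ (fun q : V → Fin 2 → ℝ => (area₃ ((τ h₁).1.mulVec (q u₁))
      ((τ h₂).1.mulVec (q u₂)) ((τ h₃).1.mulVec (q u₃)) : ℂ)) Set.univ := by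
    intro q _
    have key : ∀ h u i, AnalyticAt ℝ
        (fun q : V → Fin 2 → ℝ => ((τ h).1.mulVec (q u) i : ℂ)) q :=
      fun h u i => analyticOnNhd_mulVec h u i q (Set.mem_univ q)
    simp only [area₃, area₂, Pi.sub_apply]
    push_cast
    fun_prop
  filter_upwards [han.eventually_residual_ne_zero (by exact_mod_cast hq₀)] with q hq
  exact_mod_cast hq

end Positions

/-! ## Generic independence of sparse edge sets -/

section Extension

variable {Γ V : Type*} [Group Γ] {τ : Γ →* Matrix.orthogonalGroup (Fin 2) ℝ} {ρ : Γ →* ℂ}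

/-- `e` joins `v` to a different vertex `u`, with gain `h` when oriented away from `v`. -/
def IsPort (v : V) (e : V × V × Γ) (u : V) (h : Γ) : Prop :=
  u ≠ v ∧ (e = (v, u, h) ∨ e = (u, v, h⁻¹))

theorem MonoidHom.apply_ne_zero_of_group (ρ : Γ →* ℂ) (h : Γ) : ρ h ≠ 0 := by
  intro h₀
  have : ρ (h⁻¹ * h) = 0 := by rw [map_mul, h₀, mul_zero]
  simp at this

theorem IsPort.exists_row_eq (hτ : IsRotationAction τ) (ρ : Γ →* ℂ) {v u : V} {e : V × V × Γ}
    {h : Γ} (he : IsPort v e u h) : ∃ κ : ℂ, κ ≠ 0 ∧ ∀ q : V → Fin 2 → ℝ,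
      (completeGainGraph Γ V).orbitRigidityMatrix τ ρ q e =
        κ • (completeGainGraph Γ V).orbitRigidityMatrix τ ρ q (v, u, h) := by
  rcases he.2 with rfl | rfl
  · exact ⟨1, one_ne_zero, fun q => (one_smul _ _).symm⟩
  · exact ⟨ρ h⁻¹, ρ.apply_ne_zero_of_group _, fun q => completeGainGraph_row_reverse hτ q u v h⟩

theorem completeGainGraph_row_src (q : V → Fin 2 → ℝ) {u v : V} (h : Γ) (huv : u ≠ v)
    (i : Fin 2) :
    (completeGainGraph Γ V).orbitRigidityMatrix τ ρ q (u, v, h) (u, i) =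
      (q u i - (τ h).1.mulVec (q v) i : ℝ) := by
  simp [GainGraph.orbitRigidityMatrix, completeGainGraph, huv]

theorem completeGainGraph_row_eq_zero (q : V → Fin 2 → ℝ) {e : V × V × Γ} {v : V}
    (h₁ : e.1 ≠ v) (h₂ : e.2.1 ≠ v) (i : Fin 2) :
    (completeGainGraph Γ V).orbitRigidityMatrix τ ρ q e (v, i) = 0 := by
  simp [GainGraph.orbitRigidityMatrix, completeGainGraph, h₁.symm, h₂.symm]

theorem completeGainGraph_row_update [DecidableEq V] (q : V → Fin 2 → ℝ) {e : V × V × Γ} {v : V}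
    (h₁ : e.1 ≠ v) (h₂ : e.2.1 ≠ v) (x : Fin 2 → ℝ) :
    (completeGainGraph Γ V).orbitRigidityMatrix τ ρ (Function.update q v x) e =
      (completeGainGraph Γ V).orbitRigidityMatrix τ ρ q e := by
  ext k
  simp [GainGraph.orbitRigidityMatrix, completeGainGraph, h₁, h₂]

theorem exists_linearIndepOn_port (hτ : IsRotationAction τ) {v u : V} {e : V × V × Γ}
    {h : Γ} (he : IsPort v e u h) : ∃ q : V → Fin 2 → ℝ, LinearIndepOn ℂ
      (fun e (i : Fin 2) => (completeGainGraph Γ V).orbitRigidityMatrix τ ρ q e (v, i)) {e} := by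
  classical
  obtain ⟨κ, hκ, hrow⟩ := he.exists_row_eq hτ ρ
  refine ⟨Function.update 0 v ![1, 0], LinearIndepOn.singleton fun h₀ => ?_⟩
  have := congrFun h₀ 0
  simp only [hrow, Pi.smul_apply, completeGainGraph_row_src _ _ he.1.symm, Pi.zero_apply] at this
  simp [Function.update_of_ne he.1, hκ] at this

theorem exists_linearIndepOn_port_port (hτ : IsRotationAction τ) {v u₁ u₂ : V}
    {e₁ e₂ : V × V × Γ} {h₁ h₂ : Γ} (he₁ : IsPort v e₁ u₁ h₁) (he₂ : IsPort v e₂ u₂ h₂)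
    (h₁₂ : u₁ = u₂ → h₁ ≠ h₂) : ∃ q : V → Fin 2 → ℝ, LinearIndepOn ℂ
      (fun e (i : Fin 2) => (completeGainGraph Γ V).orbitRigidityMatrix τ ρ q e (v, i))
        {e₁, e₂} := by
  obtain ⟨κ₁, hκ₁, hrow₁⟩ := he₁.exists_row_eq hτ ρ
  obtain ⟨κ₂, hκ₂, hrow₂⟩ := he₂.exists_row_eq hτ ρ
  obtain ⟨q, hq, hq'⟩ := hτ.exists_area₂_ne_zero h₁₂
  refine ⟨q, linearIndepOn_pair_of_det_ne_zero ?_⟩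
  simp only [hrow₁, hrow₂, Pi.smul_apply, completeGainGraph_row_src _ _ he₁.1.symm,
    completeGainGraph_row_src _ _ he₂.1.symm, hq v he₁.1.symm he₂.1.symm, Pi.zero_apply,
    smul_eq_mul]
  have : (κ₁ * κ₂ * (area₂ ((τ h₁).1.mulVec (q u₁)) ((τ h₂).1.mulVec (q u₂)) : ℝ) : ℂ) ≠ 0 :=
    mul_ne_zero (mul_ne_zero hκ₁ hκ₂) (by exact_mod_cast hq')
  convert this using 1
  simp only [area₂]
  push_cast
  ring

theorem loop_row_ne_zero (hτ : IsRotationAction τ) {v : V} {h : Γ} (hh : h ≠ 1)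
    {q : V → Fin 2 → ℝ} (hq : q v = ![1, 0]) :
    (fun i : Fin 2 => (completeGainGraph Γ V).orbitRigidityMatrix τ ρ q (v, v, h) (v, i)) ≠ 0 := by
  intro h₀
  have e₀ := congrFun h₀ 0
  have e₁ := congrFun h₀ 1
  simp only [completeGainGraph_row_zero hτ, completeGainGraph_row_one hτ, if_true, hq,
    Pi.zero_apply, Matrix.cons_val_zero, Matrix.cons_val_one] at e₀ e₁
  have hs := hτ.zero_one_ne_zero h hh
  have hsq := IsRotationAction.sq_add_sq (τ := τ) h
  have hc : (τ h).1 0 0 ≠ 1 := by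
    intro hc
    rw [hc] at hsq
    exact hs (by nlinarith)
  have e₂ : ((τ h).1 0 1 : ℂ) * (1 - ρ h) = 0 := by
    push_cast at e₁
    linear_combination e₁
  have e₃ : ρ h = 1 := by
    rcases mul_eq_zero.1 e₂ with e₂ | e₂
    · exact absurd (by exact_mod_cast e₂) hs
    · exact (sub_eq_zero.1 e₂).symm
  rw [e₃] at e₀
  refine hc ?_
  have e₄ : (2 * (1 - (τ h).1 0 0) : ℂ) = 0 := by
    push_cast at e₀
    linear_combination e₀
  have e₅ : (2 * (1 - (τ h).1 0 0) : ℝ) = 0 := by exact_mod_cast e₄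
  linarith

theorem exists_linearIndepOn_loop (hτ : IsRotationAction τ) {v : V} {h : Γ} (hh : h ≠ 1) :
    ∃ q : V → Fin 2 → ℝ, LinearIndepOn ℂ
      (fun e (i : Fin 2) => (completeGainGraph Γ V).orbitRigidityMatrix τ ρ q e (v, i))
        {(v, v, h)} :=
  ⟨fun _ => ![1, 0], LinearIndepOn.singleton (loop_row_ne_zero hτ hh rfl)⟩

theorem exists_linearIndepOn_loop_port (hτ : IsRotationAction τ) {v u : V} {e : V × V × Γ}
    {g h : Γ} (hg : g ≠ 1) (he : IsPort v e u h) :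
    ∃ q : V → Fin 2 → ℝ, LinearIndepOn ℂ
      (fun e (i : Fin 2) => (completeGainGraph Γ V).orbitRigidityMatrix τ ρ q e (v, i))
        {(v, v, g), e} := by
  classical
  obtain ⟨κ, hκ, hrow⟩ := he.exists_row_eq hτ ρ
  let Q : (Fin 2 → ℝ) → V → Fin 2 → ℝ := fun r => Function.update
    (fun _ => (τ h⁻¹).1.mulVec (![1, 0] - r)) v ![1, 0]
  have hQv : ∀ r, Q r v = ![1, 0] := fun r => Function.update_self _ _ _
  have hQe : ∀ r i, (completeGainGraph Γ V).orbitRigidityMatrix τ ρ (Q r) e (v, i) =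
      κ * (r i : ℝ) := by
    intro r i
    rw [hrow, Pi.smul_apply, completeGainGraph_row_src _ _ he.1.symm, hQv]
    have : Q r u = (τ h⁻¹).1.mulVec (![1, 0] - r) := Function.update_of_ne he.1 _ _
    rw [this, mulVec_map_inv_mulVec]
    simp
  have hQl : ∀ r i, (completeGainGraph Γ V).orbitRigidityMatrix τ ρ (Q r) (v, v, g) (v, i) =
      (completeGainGraph Γ V).orbitRigidityMatrix τ ρ (Q 0) (v, v, g) (v, i) := by
    intro r i
    simp [GainGraph.orbitRigidityMatrix, completeGainGraph, hQv]
  have hne := loop_row_ne_zero (ρ := ρ) hτ hg (hQv 0)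
  by_cases h₀ : (completeGainGraph Γ V).orbitRigidityMatrix τ ρ (Q 0) (v, v, g) (v, 0) = 0
  · have h₁ : (completeGainGraph Γ V).orbitRigidityMatrix τ ρ (Q 0) (v, v, g) (v, 1) ≠ 0 := by
      intro h₁
      exact hne (funext fun i => by fin_cases i <;> assumption)
    refine ⟨Q ![1, 0], linearIndepOn_pair_of_det_ne_zero ?_⟩
    simp only [hQe, hQl]
    simp [hκ, h₁]
  · refine ⟨Q ![0, 1], linearIndepOn_pair_of_det_ne_zero ?_⟩
    simp only [hQe, hQl]
    simp [hκ, h₀]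

variable [Fintype V]

open scoped Classical in
/-- Adding edges at a new vertex which are independent there preserves generic independence. -/
theorem eventually_linearIndepOn_union {F D : Finset (V × V × Γ)} {v : V}
    (hF : ∀ e ∈ F, e.1 ≠ v ∧ e.2.1 ≠ v)
    (h : ∀ᶠ q in residual (V → Fin 2 → ℝ),
      LinearIndepOn ℂ ((completeGainGraph Γ V).orbitRigidityMatrix τ ρ q).row F)
    (hD : ∃ q : V → Fin 2 → ℝ, LinearIndepOn ℂ (fun e (i : Fin 2) =>
      (completeGainGraph Γ V).orbitRigidityMatrix τ ρ q e (v, i)) D) :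
    ∀ᶠ q in residual (V → Fin 2 → ℝ),
      LinearIndepOn ℂ ((completeGainGraph Γ V).orbitRigidityMatrix τ ρ q).row (F ∪ D : Finset _) := by
  obtain ⟨q₀, hq₀⟩ := hD
  filter_upwards [h, eventually_residual_linearIndepOn (fun e k =>
    analyticOnNhd_orbitRigidityMatrix (τ := τ) (ρ := ρ) (completeGainGraph Γ V) e (v, k)) hq₀]
    with q h₁ h₂
  exact h₁.union_of_block (fun i => (v, i))
    (fun e he i => completeGainGraph_row_eq_zero q (hF e he).1 (hF e he).2 i) h₂

end Extension

namespace GainGraph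

open scoped Classical in
theorem verts_insert_complete {Γ V : Type*} (A : Finset (V × V × Γ)) (e : V × V × Γ) :
    (completeGainGraph Γ V).verts (insert e A) =
      {e.1, e.2.1} ∪ (completeGainGraph Γ V).verts A := by
  ext x
  simp only [mem_verts, Finset.mem_insert, Finset.mem_union, Finset.mem_singleton,
    exists_eq_or_imp]
  simp only [completeGainGraph, eq_comm]

end GainGraph

section Reduction

variable {Γ V : Type*} [Group Γ] {v u u₁ u₂ u₃ : V} {h h₁ h₂ h₃ : Γ} {e e₁ e₂ e₃ : V × V × Γ}
  {F : Finset (V × V × Γ)}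

theorem IsPort.ne_of_ne (he₁ : IsPort v e₁ u₁ h₁) (he₂ : IsPort v e₂ u₂ h₂)
    (h₁₂ : u₁ = u₂ → h₁ ≠ h₂) : e₁ ≠ e₂ := by
  obtain ⟨n₁, he₁⟩ := he₁
  obtain ⟨n₂, he₂⟩ := he₂
  rintro rfl
  rcases he₁ with rfl | rfl <;> rcases he₂ with he₂ | he₂ <;>
    simp only [Prod.mk.injEq, inv_inj] at he₂
  · exact h₁₂ he₂.2.1 he₂.2.2
  · exact n₂ he₂.1.symm
  · exact n₁ he₂.1
  · exact h₁₂ he₂.1 he₂.2.2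

theorem IsPort.gain_eq (he : IsPort v e u h) {g : V → Γ} (hv : g v = 1) (hu : g u = h) :
    (completeGainGraph Γ V).gain e =
      (g ((completeGainGraph Γ V).src e))⁻¹ * g ((completeGainGraph Γ V).tgt e) := by
  rcases he.2 with rfl | rfl <;> simp [completeGainGraph, hv, hu]

theorem IsPort.src_eq_or (he : IsPort v e u h) : e.1 = v ∨ e.1 = u := by
  rcases he.2 with rfl | rfl <;> simp

theorem IsPort.tgt_eq_or (he : IsPort v e u h) : e.2.1 = v ∨ e.2.1 = u := by
  rcases he.2 with rfl | rfl <;> simp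

theorem IsPort.not_avoids (he : IsPort v e u h) : ¬ (e.1 ≠ v ∧ e.2.1 ≠ v) := by
  rcases he.2 with rfl | rfl <;> simp

theorem exists_isPort_of_ne (hv : e.1 = v ∨ e.2.1 = v) (hl : ¬ (e.1 = v ∧ e.2.1 = v)) :
    ∃ u h, IsPort v e u h := by
  obtain ⟨x, y, g⟩ := e
  rcases hv with rfl | rfl
  · exact ⟨y, g, fun hy => hl ⟨rfl, hy⟩, Or.inl rfl⟩
  · exact ⟨x, g⁻¹, fun hx => hl ⟨hx, rfl⟩, Or.inr (by rw [inv_inv])⟩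

namespace GainGraph

theorem Sparse.gain_ne_one_of_loop (hF : (completeGainGraph Γ V).Sparse F)
    (he : (v, v, h) ∈ F) : h ≠ 1 := by
  classical
  rintro rfl
  have h₁ := (hF {(v, v, 1)} (Finset.singleton_subset_iff.2 he) (Finset.singleton_nonempty _)).2
    ⟨fun _ => 1, by
      intro e he
      obtain rfl : e = (v, v, 1) := by simpa using he
      simp [completeGainGraph]⟩
  have h₂ : (completeGainGraph Γ V).verts {(v, v, 1)} = {v} := by
    ext x
    simp [mem_verts, completeGainGraph, eq_comm]
  rw [h₂, Finset.card_singleton, Finset.card_singleton] at h₁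
  omega

theorem Sparse.gain_ne_of_isPort (hF : (completeGainGraph Γ V).Sparse F)
    (m₁ : e₁ ∈ F) (m₂ : e₂ ∈ F) (hne : e₁ ≠ e₂) (he₁ : IsPort v e₁ u₁ h₁)
    (he₂ : IsPort v e₂ u₂ h₂) (hu : u₁ = u₂) : h₁ ≠ h₂ := by
  classical
  rintro rfl
  subst hu
  have k₁ := (hF {e₁, e₂} (Finset.insert_subset m₁ (Finset.singleton_subset_iff.2 m₂))
    ⟨e₁, by simp⟩).2 ⟨Function.update (fun _ => h₁) v 1, by
      have a : Function.update (fun _ => h₁) v 1 v = 1 := Function.update_self _ _ _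
      have b : Function.update (fun _ => h₁) v 1 u₁ = h₁ := Function.update_of_ne he₁.1 _ _
      intro e he
      rcases Finset.mem_insert.1 (Finset.mem_coe.1 he) with rfl | he
      · exact he₁.gain_eq a b
      · rw [Finset.mem_singleton.1 he]
        exact he₂.gain_eq a b⟩
  have k₂ : (completeGainGraph Γ V).verts {e₁, e₂} ⊆ {v, u₁} := by
    intro x hx
    obtain ⟨e, he, hex⟩ := mem_verts.1 hx
    simp only [Finset.mem_insert, Finset.mem_singleton] at he ⊢
    rcases he with rfl | rfl <;> rcases hex with hex | hex <;> rw [← hex]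
    exacts [he₁.src_eq_or, he₁.tgt_eq_or, he₂.src_eq_or, he₂.tgt_eq_or]
  have k₃ := Finset.card_le_card k₂
  rw [Finset.card_pair he₁.1.symm] at k₃
  rw [Finset.card_pair hne] at k₁
  omega

theorem Sparse.admitsThree {F' : Finset (V × V × Γ)} (hF : (completeGainGraph Γ V).Sparse F)
    (hF' : F' ⊆ F) (hv : ∀ e ∈ F', e.1 ≠ v ∧ e.2.1 ≠ v)
    (m₁ : e₁ ∈ F) (m₂ : e₂ ∈ F) (m₃ : e₃ ∈ F) (h₁₂ : e₁ ≠ e₂) (h₁₃ : e₁ ≠ e₃) (h₂₃ : e₂ ≠ e₃)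
    (he₁ : IsPort v e₁ u₁ h₁) (he₂ : IsPort v e₂ u₂ h₂) (he₃ : IsPort v e₃ u₃ h₃) :
    (completeGainGraph Γ V).AdmitsThree F' u₁ h₁ u₂ h₂ u₃ h₃ := by
  classical
  have hD : ({e₁, e₂, e₃} : Finset (V × V × Γ)).card = 3 := by
    rw [Finset.card_eq_three]
    exact ⟨e₁, e₂, e₃, h₁₂, h₁₃, h₂₃, rfl⟩
  have key : ∀ A ⊆ F', u₁ ∈ (completeGainGraph Γ V).verts A →
      u₂ ∈ (completeGainGraph Γ V).verts A → u₃ ∈ (completeGainGraph Γ V).verts A →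
      A ∪ {e₁, e₂, e₃} ⊆ F ∧ (A ∪ {e₁, e₂, e₃}).Nonempty ∧
      (A ∪ {e₁, e₂, e₃}).card = A.card + 3 ∧
      ((completeGainGraph Γ V).verts (A ∪ {e₁, e₂, e₃})).card ≤
        ((completeGainGraph Γ V).verts A).card + 1 := by
    intro A hA a₁ a₂ a₃
    refine ⟨Finset.union_subset (hA.trans hF') ?_, ⟨e₁, by simp⟩, ?_, ?_⟩
    · intro e he
      simp only [Finset.mem_insert, Finset.mem_singleton] at he
      rcases he with rfl | rfl | rfl <;> assumption
    · rw [Finset.card_union_of_disjoint, hD]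
      rw [Finset.disjoint_left]
      intro e he he'
      have := hv e (hA he)
      simp only [Finset.mem_insert, Finset.mem_singleton] at he'
      rcases he' with rfl | rfl | rfl
      exacts [he₁.not_avoids this, he₂.not_avoids this, he₃.not_avoids this]
    · refine (Finset.card_le_card (?_ : _ ⊆ insert v ((completeGainGraph Γ V).verts A))).trans
        (Finset.card_insert_le _ _)
      rw [verts_union]
      refine Finset.union_subset (Finset.subset_insert _ _) ?_
      intro x hx
      obtain ⟨e, he, hx⟩ := mem_verts.1 hx
      simp only [Finset.mem_insert, Finset.mem_singleton] at he ⊢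
      have : ∀ {u : V} {h : Γ}, IsPort v e u h → x = v ∨ x = u := fun hp => by
        rcases hx with rfl | rfl
        exacts [hp.src_eq_or, hp.tgt_eq_or]
      rcases he with rfl | rfl | rfl
      · rcases this he₁ with hx | hx <;> simp [hx, a₁]
      · rcases this he₂ with hx | hx <;> simp [hx, a₂]
      · rcases this he₃ with hx | hx <;> simp [hx, a₃]
  refine ⟨hF.mono hF', fun A hA a₁ a₂ a₃ => ?_, fun A hA g hg a₁ a₂ a₃ g₁ g₂ g₃ => ?_⟩
  · obtain ⟨k₁, k₂, k₃, k₄⟩ := key A hA a₁ a₂ a₃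
    have := (hF _ k₁ k₂).1
    omega
  · obtain ⟨k₁, k₂, k₃, k₄⟩ := key A hA a₁ a₂ a₃
    have gv : Function.update g v 1 v = 1 := Function.update_self _ _ _
    have gn : ∀ x, x ≠ v → Function.update g v 1 x = g x :=
      fun x hx => Function.update_of_ne hx _ _
    have := (hF _ k₁ k₂).2 ⟨Function.update g v 1, by
      intro e he
      simp only [Finset.coe_union, Finset.coe_insert, Finset.coe_singleton, Set.mem_union,
        Finset.mem_coe, Set.mem_insert_iff, Set.mem_singleton_iff] at he
      rcases he with he | rfl | rfl | rfl
      · have hev := hv e (hA he)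
        exact (hg e he).trans
          (congrArg₂ (fun a b => a⁻¹ * b) (gn _ hev.1) (gn _ hev.2)).symm
      · exact he₁.gain_eq gv ((gn _ he₁.1).trans g₁)
      · exact he₂.gain_eq gv ((gn _ he₂.1).trans g₂)
      · exact he₃.gain_eq gv ((gn _ he₃.1).trans g₃)⟩
    omega

open scoped Classical in
/-- An edge which is not obstructed can be inserted. -/
theorem Sparse.insert_of_not_obstructed (hF : (completeGainGraph Γ V).Sparse F)
    (h₁₂ : u₁ = u₂ → h₁ ≠ h₂)
    (hO : ¬ (completeGainGraph Γ V).Obstructed F u₁ h₁ u₂ h₂) :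
    (u₁, u₂, h₁⁻¹ * h₂) ∉ F ∧
      (completeGainGraph Γ V).Sparse (insert (u₁, u₂, h₁⁻¹ * h₂) F) := by
  have hsing : (completeGainGraph Γ V).verts {(u₁, u₂, h₁⁻¹ * h₂)} = {u₁, u₂} := by
    ext x
    simp [mem_verts, completeGainGraph, eq_comm]
  constructor
  · intro hmem
    refine hO ⟨{(u₁, u₂, h₁⁻¹ * h₂)}, Finset.singleton_subset_iff.2 hmem, ?_, ?_, ?_⟩
    · simp [hsing]
    · simp [hsing]
    · rw [hsing, Finset.card_singleton]
      by_cases hu : u₁ = u₂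
      · subst hu
        simp
      · right
        refine ⟨Function.update (fun _ => h₁) u₂ h₂, ?_, Function.update_of_ne hu _ _,
          Function.update_self _ _ _, by rw [Finset.card_pair hu]⟩
        intro e he
        obtain rfl : e = (u₁, u₂, h₁⁻¹ * h₂) := by simpa using he
        simp [completeGainGraph, Function.update_of_ne hu]
  · intro A hA hne
    by_cases heA : (u₁, u₂, h₁⁻¹ * h₂) ∈ A
    swap
    · exact hF A ((Finset.subset_insert_iff_of_notMem heA).1 hA) hne
    set B := A.erase (u₁, u₂, h₁⁻¹ * h₂) with hB
    have hAB : A = insert (u₁, u₂, h₁⁻¹ * h₂) B := (Finset.insert_erase heA).symm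
    have hBF : B ⊆ F := Finset.subset_insert_iff.1 hA
    have hcard : A.card = B.card + 1 := (Finset.card_erase_add_one heA).symm
    have hverts : (completeGainGraph Γ V).verts A =
        {u₁, u₂} ∪ (completeGainGraph Γ V).verts B := by
      rw [hAB, verts_insert_complete]
    have hBA : B ⊆ A := Finset.erase_subset _ _
    by_cases hu : u₁ ∈ (completeGainGraph Γ V).verts B ∧ u₂ ∈ (completeGainGraph Γ V).verts B
    · have hVB : (completeGainGraph Γ V).verts A = (completeGainGraph Γ V).verts B := by
        rw [hverts, Finset.union_eq_right]
        exact Finset.insert_subset hu.1 (Finset.singleton_subset_iff.2 hu.2)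
      have hOB : ¬ (2 * ((completeGainGraph Γ V).verts B).card ≤ B.card + 1 ∨
          ∃ g, (completeGainGraph Γ V).IsPotential (B : Set (V × V × Γ)) g ∧ g u₁ = h₁ ∧
            g u₂ = h₂ ∧ 2 * ((completeGainGraph Γ V).verts B).card ≤ B.card + 3) :=
        fun h => hO ⟨B, hBF, hu.1, hu.2, h⟩
      rw [not_or] at hOB
      rw [hVB]
      refine ⟨by omega, ?_⟩
      rintro ⟨g, hg⟩
      by_contra hc
      have hg₁₂ : h₁⁻¹ * h₂ = (g u₁)⁻¹ * g u₂ := hg _ (Finset.mem_coe.2 heA)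
      refine hOB.2 ⟨fun x => h₁ * (g u₁)⁻¹ * g x, ?_, by simp, ?_, by omega⟩
      · intro e he
        rw [hg e (Finset.mem_coe.2 (hBA he))]
        simp [mul_assoc]
      · simp only [mul_assoc, ← hg₁₂, mul_inv_cancel_left]
    · rcases B.eq_empty_or_nonempty with hB0 | hBne
      · rw [hAB, hB0]
        simp only [insert_empty_eq, hsing, Finset.card_singleton]
        refine ⟨?_, ?_⟩
        · have : 0 < ({u₁, u₂} : Finset V).card := Finset.card_pos.2 ⟨u₁, by simp⟩
          omega
        · rintro ⟨g, hg⟩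
          by_cases hu : u₁ = u₂
          · exfalso
            have hg₁₂ : h₁⁻¹ * h₂ = (g u₁)⁻¹ * g u₂ := hg (u₁, u₂, h₁⁻¹ * h₂) (by simp)
            rw [hu, inv_mul_cancel, inv_mul_eq_one] at hg₁₂
            exact h₁₂ hu hg₁₂
          · rw [Finset.card_pair hu]
      · have hlt : ((completeGainGraph Γ V).verts B).card + 1 ≤
            ((completeGainGraph Γ V).verts A).card := by
          refine Finset.card_lt_card ((Finset.ssubset_iff_of_subset (verts_mono hBA)).2 ?_)
          rw [hverts]
          by_cases hu₁ : u₁ ∈ (completeGainGraph Γ V).verts B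
          · exact ⟨u₂, by simp, fun hu₂ => hu ⟨hu₁, hu₂⟩⟩
          · exact ⟨u₁, by simp, hu₁⟩
        have k₁ := hF B hBF hBne
        refine ⟨by omega, ?_⟩
        rintro ⟨g, hg⟩
        have := k₁.2 ⟨g, hg.mono (by exact_mod_cast hBA)⟩
        omega

end GainGraph

end Reduction

section OneExtension

variable {Γ V : Type*} [Group Γ] {τ : Γ →* Matrix.orthogonalGroup (Fin 2) ℝ} {ρ : Γ →* ℂ}
  {v u₁ u₂ u₃ : V} {h₁ h₂ h₃ : Γ} {e₁ e₂ e₃ : V × V × Γ}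

/-- If `v` is the midpoint of two rotated positions, the rows of the edges joining `v` to them
combine to the row of an edge between them. -/
theorem row_add_row_of_midpoint {q : V → Fin 2 → ℝ}
    (hq : q v = (1 / 2 : ℝ) • ((τ h₁).1.mulVec (q u₁) + (τ h₂).1.mulVec (q u₂))) :
    (completeGainGraph Γ V).orbitRigidityMatrix τ ρ q (v, u₁, h₁) +
      (completeGainGraph Γ V).orbitRigidityMatrix τ ρ q (v, u₂, h₂) =
    (ρ h₁ / 2) • (completeGainGraph Γ V).orbitRigidityMatrix τ ρ q (u₁, u₂, h₁⁻¹ * h₂) := by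
  have inv : ∀ h : Γ, (τ h)⁻¹ = τ h⁻¹ := fun h => (map_inv τ h).symm
  have A₁ : q v - (τ h₁).1.mulVec (q u₁) =
      (1 / 2 : ℝ) • ((τ h₂).1.mulVec (q u₂) - (τ h₁).1.mulVec (q u₁)) := by
    rw [hq]; module
  have A₂ : q v - (τ h₂).1.mulVec (q u₂) =
      (-1 / 2 : ℝ) • ((τ h₂).1.mulVec (q u₂) - (τ h₁).1.mulVec (q u₁)) := by
    rw [hq]; module
  have B₁ : q u₁ - (τ h₁⁻¹).1.mulVec (q v) =
      (1 / 2 : ℝ) • (q u₁ - (τ (h₁⁻¹ * h₂)).1.mulVec (q u₂)) := by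
    rw [hq, Matrix.mulVec_smul, Matrix.mulVec_add, mulVec_map_mulVec, mulVec_map_mulVec,
      inv_mul_cancel, map_one, OneMemClass.coe_one, Matrix.one_mulVec]
    module
  have B₂ : q u₂ - (τ h₂⁻¹).1.mulVec (q v) =
      (1 / 2 : ℝ) • (q u₂ - (τ (h₁⁻¹ * h₂)⁻¹).1.mulVec (q u₁)) := by
    rw [hq, Matrix.mulVec_smul, Matrix.mulVec_add, mulVec_map_mulVec, mulVec_map_mulVec,
      inv_mul_cancel, map_one, OneMemClass.coe_one, Matrix.one_mulVec, mul_inv_rev, inv_inv]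
    module
  have hρ : ρ h₁ * ρ (h₁⁻¹ * h₂) = ρ h₂ := by rw [← map_mul, mul_inv_cancel_left]
  ext ⟨w, i⟩
  simp only [GainGraph.orbitRigidityMatrix, completeGainGraph, Pi.add_apply, Pi.smul_apply,
    smul_eq_mul, inv, A₁, A₂, B₁, B₂]
  rw [← hρ]
  push_cast
  split_ifs <;> ring

variable [Fintype V]

open scoped Classical in
/-- Subdividing an edge by a new vertex and joining that vertex to a third one preserves generic
independence. -/
theorem eventually_linearIndepOn_oneExtension (hτ : IsRotationAction τ)
    {F : Finset (V × V × Γ)} (hF : ∀ e ∈ F, e.1 ≠ v ∧ e.2.1 ≠ v)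
    (he₁ : IsPort v e₁ u₁ h₁) (he₂ : IsPort v e₂ u₂ h₂) (he₃ : IsPort v e₃ u₃ h₃)
    (h₁₂ : u₁ = u₂ → h₁ ≠ h₂) (h₁₃ : u₁ = u₃ → h₁ ≠ h₃) (h₂₃ : u₂ = u₃ → h₂ ≠ h₃)
    (hnot : (u₁, u₂, h₁⁻¹ * h₂) ∉ F)
    (h : ∀ᶠ q in residual (V → Fin 2 → ℝ),
      LinearIndepOn ℂ ((completeGainGraph Γ V).orbitRigidityMatrix τ ρ q).row
        (insert (u₁, u₂, h₁⁻¹ * h₂) F : Finset _)) :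
    ∀ᶠ q in residual (V → Fin 2 → ℝ),
      LinearIndepOn ℂ ((completeGainGraph Γ V).orbitRigidityMatrix τ ρ q).row
        (F ∪ {e₁, e₂, e₃} : Finset _) := by
  obtain ⟨q', hq', harea⟩ := (dense_of_mem_residual
    (h.and (hτ.eventually_area₃_ne_zero h₁₂ h₁₃ h₂₃))).nonempty
  set P₁ := (τ h₁).1.mulVec (q' u₁) with hP₁
  set P₂ := (τ h₂).1.mulVec (q' u₂) with hP₂
  set P₃ := (τ h₃).1.mulVec (q' u₃) with hP₃
  set q : V → Fin 2 → ℝ := Function.update q' v ((1 / 2 : ℝ) • (P₁ + P₂)) with hq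
  have qv : q v = (1 / 2 : ℝ) • (P₁ + P₂) := Function.update_self _ _ _
  have q₁ : q u₁ = q' u₁ := Function.update_of_ne he₁.1 _ _
  have q₂ : q u₂ = q' u₂ := Function.update_of_ne he₂.1 _ _
  have q₃ : q u₃ = q' u₃ := Function.update_of_ne he₃.1 _ _
  refine eventually_residual_linearIndepOn (fun e k =>
    analyticOnNhd_orbitRigidityMatrix (τ := τ) (ρ := ρ) (completeGainGraph Γ V) e k) (q₀ := q) ?_
  obtain ⟨κ₁, hκ₁, hrow₁⟩ := he₁.exists_row_eq hτ ρ
  obtain ⟨κ₂, hκ₂, hrow₂⟩ := he₂.exists_row_eq hτ ρ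
  obtain ⟨κ₃, hκ₃, hrow₃⟩ := he₃.exists_row_eq hτ ρ
  have hsum := row_add_row_of_midpoint (ρ := ρ) (τ := τ) (u₁ := u₁) (u₂ := u₂) (h₁ := h₁) (h₂ := h₂)
    (v := v) (q := q)
    (by rw [qv, q₁, q₂])
  have hupd : ∀ e : V × V × Γ, e.1 ≠ v → e.2.1 ≠ v →
      (completeGainGraph Γ V).orbitRigidityMatrix τ ρ q e =
      (completeGainGraph Γ V).orbitRigidityMatrix τ ρ q' e :=
    fun e a b => completeGainGraph_row_update q' a b _
  rw [linearIndepOn_finset_iff] at hq'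
  refine linearIndepOn_finset_iff.2 ?_
  simp only [Matrix.row] at hq' ⊢
  have n₁₂ := he₁.ne_of_ne he₂ h₁₂
  have n₁₃ := he₁.ne_of_ne he₃ h₁₃
  have n₂₃ := he₂.ne_of_ne he₃ h₂₃
  intro c hc
  rw [Finset.sum_union (by
      rw [Finset.disjoint_left]
      intro e he he'
      have := hF e he
      simp only [Finset.mem_insert, Finset.mem_singleton] at he'
      rcases he' with rfl | rfl | rfl
      exacts [he₁.not_avoids this, he₂.not_avoids this, he₃.not_avoids this]),
    Finset.sum_insert (by simp [n₁₂, n₁₃]), Finset.sum_pair n₂₃, hrow₁, hrow₂, hrow₃] at hc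
  have hv : ∀ i : Fin 2, c e₁ * κ₁ * ((P₂ i - P₁ i) / 2 : ℂ) - c e₂ * κ₂ * ((P₂ i - P₁ i) / 2) +
      c e₃ * κ₃ * ((P₁ i + P₂ i) / 2 - P₃ i) = 0 := by
    intro i
    have := congrFun hc (v, i)
    simp only [Pi.add_apply, Finset.sum_apply, Pi.smul_apply, smul_eq_mul, Pi.zero_apply,
      completeGainGraph_row_src _ _ he₁.1.symm, completeGainGraph_row_src _ _ he₂.1.symm,
      completeGainGraph_row_src _ _ he₃.1.symm, qv, q₁, q₂, q₃, ← hP₁, ← hP₂, ← hP₃] at this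
    rw [Finset.sum_eq_zero (fun e he => by
      rw [completeGainGraph_row_eq_zero q (hF e he).1 (hF e he).2 i, mul_zero])] at this
    push_cast at this
    linear_combination this
  have harea' : ((P₂ 0 - P₁ 0) * (P₃ 1 - P₁ 1) - (P₂ 1 - P₁ 1) * (P₃ 0 - P₁ 0) : ℂ) ≠ 0 := by
    have : area₃ P₁ P₂ P₃ ≠ 0 := harea
    simp only [area₃, area₂, Pi.sub_apply] at this
    exact_mod_cast this
  have hv₀ := hv 0
  have hv₁ := hv 1
  have c₃ : c e₃ * κ₃ = 0 := by
    refine (mul_eq_zero.1 ?_).resolve_right harea'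
    linear_combination (P₂ 1 - P₁ 1) * hv₀ - (P₂ 0 - P₁ 0) * hv₁
  rw [c₃] at hv₀ hv₁
  have c₁₂ : c e₁ * κ₁ = c e₂ * κ₂ := by
    refine sub_eq_zero.1 ((mul_eq_zero.1 ?_).resolve_right harea')
    linear_combination 2 * (P₃ 1 - P₁ 1) * hv₀ - 2 * (P₃ 0 - P₁ 0) * hv₁
  rw [smul_smul, smul_smul, smul_smul, c₃, zero_smul, add_zero, ← c₁₂, ← smul_add, hsum,
    smul_smul] at hc
  have hnew := hq' (Function.update c (u₁, u₂, h₁⁻¹ * h₂) (c e₁ * κ₁ * (ρ h₁ / 2))) (by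
    rw [Finset.sum_insert hnot, Function.update_self, ← hc, add_comm]
    congr 1
    · refine Finset.sum_congr rfl fun e he => ?_
      rw [Function.update_of_ne (ne_of_mem_of_not_mem he hnot), hupd e (hF e he).1 (hF e he).2]
    · rw [hupd _ he₁.1 he₂.1])
  have c₁ : c e₁ = 0 := by
    have := hnew _ (Finset.mem_insert_self _ _)
    rw [Function.update_self] at this
    simpa [hκ₁, ρ.apply_ne_zero_of_group h₁] using this
  intro e he
  simp only [Finset.mem_union, Finset.mem_insert, Finset.mem_singleton] at he
  rcases he with he | rfl | rfl | rfl
  · have := hnew e (Finset.mem_insert_of_mem he)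
    rwa [Function.update_of_ne (ne_of_mem_of_not_mem he hnot)] at this
  · exact c₁
  · rw [c₁, zero_mul] at c₁₂
    exact (mul_eq_zero.1 c₁₂.symm).resolve_right hκ₂
  · exact (mul_eq_zero.1 c₃).resolve_right hκ₃

open scoped Classical in
/-- The rows of a sparse edge set are independent at generic positions. -/
theorem GainGraph.Sparse.eventually_linearIndepOn (hτ : IsRotationAction τ) (ρ : Γ →* ℂ) :
    ∀ (n : ℕ) (F : Finset (V × V × Γ)), F.card = n → (completeGainGraph Γ V).Sparse F →
    ∀ᶠ q in residual (V → Fin 2 → ℝ),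
      LinearIndepOn ℂ ((completeGainGraph Γ V).orbitRigidityMatrix τ ρ q).row F := by
  intro n
  induction n using Nat.strong_induction_on with
  | _ n ih =>
  rintro F rfl hF
  rcases F.eq_empty_or_nonempty with rfl | hne
  · exact Filter.Eventually.of_forall fun q => by
      rw [Finset.coe_empty]
      exact linearIndepOn_empty ℂ _
  obtain ⟨v, hv, hdeg⟩ := hF.exists_degree_le hne
  set D := F.filter (fun e => e.1 = v ∨ e.2.1 = v) with hD
  set F₀ := F.filter (fun e => ¬ (e.1 = v ∨ e.2.1 = v)) with hF₀
  set L := F.filter (fun e => e.1 = v ∧ e.2.1 = v) with hL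
  have hFD : F = F₀ ∪ D := by
    rw [Finset.union_comm, hD, hF₀, Finset.filter_union_filter_not_eq]
  have hF₀v : ∀ e ∈ F₀, e.1 ≠ v ∧ e.2.1 ≠ v := by
    intro e he
    have := (Finset.mem_filter.1 he).2
    rwa [not_or] at this
  have hcardFD : D.card + F₀.card = F.card := Finset.card_filter_add_card_filter_not _
  have hcardDL : D.card + L.card ≤ 3 := by
    rw [hD, hL, Finset.filter_or, Finset.filter_and, Finset.card_union_add_card_inter]
    exact hdeg
  have hDpos : 0 < D.card := by
    obtain ⟨e, he, hev⟩ := mem_verts.1 hv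
    exact Finset.card_pos.2 ⟨e, Finset.mem_filter.2 ⟨he, hev⟩⟩
  have hDF : ∀ e ∈ D, e ∈ F := fun e he => (Finset.mem_filter.1 he).1
  have hF₀F : F₀ ⊆ F := Finset.filter_subset _ _
  have hport : ∀ e ∈ D, e ∉ L → ∃ u h, IsPort v e u h := fun e he heL =>
    exists_isPort_of_ne (Finset.mem_filter.1 he).2
      fun h' => heL (Finset.mem_filter.2 ⟨hDF e he, h'⟩)
  have hgain : ∀ {e e' u u' h h'}, e ∈ D → e' ∈ D → e ≠ e' → IsPort v e u h → IsPort v e' u' h' →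
      u = u' → h ≠ h' := fun he he' hne hp hp' hu =>
    hF.gain_ne_of_isPort (hDF _ he) (hDF _ he') hne hp hp' hu
  have ih₀ := ih F₀.card (by omega) F₀ rfl (hF.mono hF₀F)
  suffices hcase : (∃ q : V → Fin 2 → ℝ, LinearIndepOn ℂ (fun e (i : Fin 2) =>
      (completeGainGraph Γ V).orbitRigidityMatrix τ ρ q e (v, i)) D) ∨
      ∀ᶠ q in residual (V → Fin 2 → ℝ),
        LinearIndepOn ℂ ((completeGainGraph Γ V).orbitRigidityMatrix τ ρ q).row (F₀ ∪ D : Finset _) by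
    rw [hFD]
    rcases hcase with hcase | hcase
    · exact eventually_linearIndepOn_union hF₀v ih₀ hcase
    · exact hcase
  by_cases hL0 : L = ∅
  · have hLn : ∀ e, e ∉ L := fun e => by simp [hL0]
    obtain h1 | h2 | h3 : D.card = 1 ∨ D.card = 2 ∨ D.card = 3 := by omega
    · obtain ⟨e, he⟩ := Finset.card_eq_one.1 h1
      obtain ⟨u, h, hp⟩ := hport e (by simp [he]) (hLn e)
      left
      rw [he, Finset.coe_singleton]
      exact exists_linearIndepOn_port hτ hp
    · obtain ⟨e₁, e₂, hne, he⟩ := Finset.card_eq_two.1 h2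
      obtain ⟨u₁, h₁, hp₁⟩ := hport e₁ (by simp [he]) (hLn _)
      obtain ⟨u₂, h₂, hp₂⟩ := hport e₂ (by simp [he]) (hLn _)
      left
      have := hgain (by simp [he]) (by simp [he]) hne hp₁ hp₂
      rw [he, Finset.coe_pair]
      exact exists_linearIndepOn_port_port hτ hp₁ hp₂ this
    · obtain ⟨e₁, e₂, e₃, n₁₂, n₁₃, n₂₃, he⟩ := Finset.card_eq_three.1 h3
      have m₁ : e₁ ∈ D := by simp [he]
      have m₂ : e₂ ∈ D := by simp [he]
      have m₃ : e₃ ∈ D := by simp [he]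
      obtain ⟨u₁, h₁, hp₁⟩ := hport e₁ m₁ (hLn _)
      obtain ⟨u₂, h₂, hp₂⟩ := hport e₂ m₂ (hLn _)
      obtain ⟨u₃, h₃, hp₃⟩ := hport e₃ m₃ (hLn _)
      have g₁₂ := hgain m₁ m₂ n₁₂ hp₁ hp₂
      have g₁₃ := hgain m₁ m₃ n₁₃ hp₁ hp₃
      have g₂₃ := hgain m₂ m₃ n₂₃ hp₂ hp₃
      have hadm := hF.admitsThree hF₀F hF₀v (hDF _ m₁) (hDF _ m₂) (hDF _ m₃) n₁₂ n₁₃ n₂₃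
        hp₁ hp₂ hp₃
      have step : ∀ {u u' h h'}, (u = u' → h ≠ h') →
          ¬ (completeGainGraph Γ V).Obstructed F₀ u h u' h' →
          (u, u', h⁻¹ * h') ∉ F₀ ∧ ∀ᶠ q in residual (V → Fin 2 → ℝ),
            LinearIndepOn ℂ ((completeGainGraph Γ V).orbitRigidityMatrix τ ρ q).row
              (insert (u, u', h⁻¹ * h') F₀ : Finset _) := by
        intro u u' h h' hne hO
        obtain ⟨k₁, k₂⟩ := (hF.mono hF₀F).insert_of_not_obstructed hne hO
        refine ⟨k₁, ih _ ?_ _ rfl k₂⟩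
        rw [Finset.card_insert_of_notMem k₁]
        omega
      right
      rcases hadm.exists_not_obstructed g₁₂ g₁₃ g₂₃ with hO | hO | hO
      · obtain ⟨k₁, k₂⟩ := step g₁₂ hO
        have := eventually_linearIndepOn_oneExtension hτ hF₀v hp₁ hp₂ hp₃ g₁₂ g₁₃ g₂₃ k₁ k₂
        rwa [he]
      · obtain ⟨k₁, k₂⟩ := step g₁₃ hO
        have := eventually_linearIndepOn_oneExtension hτ hF₀v hp₁ hp₃ hp₂ g₁₃ g₁₂
          (fun e => (g₂₃ e.symm).symm) k₁ k₂
        rwa [he, show ({e₁, e₂, e₃} : Finset (V × V × Γ)) = {e₁, e₃, e₂} by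
          rw [Finset.pair_comm e₂]]
      · obtain ⟨k₁, k₂⟩ := step g₂₃ hO
        have := eventually_linearIndepOn_oneExtension hτ hF₀v hp₂ hp₃ hp₁ g₂₃
          (fun e => (g₁₂ e.symm).symm) (fun e => (g₁₃ e.symm).symm) k₁ k₂
        rwa [he, show ({e₁, e₂, e₃} : Finset (V × V × Γ)) = {e₂, e₃, e₁} by
          ext; simp only [Finset.mem_insert, Finset.mem_singleton]; tauto]
  · obtain ⟨l, hl⟩ := Finset.nonempty_iff_ne_empty.2 hL0
    have hLsub : L ⊆ D := by
      intro e he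
      obtain ⟨a, b⟩ := Finset.mem_filter.1 he
      exact Finset.mem_filter.2 ⟨a, Or.inl b.1⟩
    have hL1 : L.card ≤ 1 := by
      have k₁ := (hF L (Finset.filter_subset _ _) ⟨l, hl⟩).1
      have k₂ : (completeGainGraph Γ V).verts L ⊆ {v} := by
        intro x hx
        obtain ⟨e, he, hex⟩ := mem_verts.1 hx
        have := (Finset.mem_filter.1 he).2
        rw [Finset.mem_singleton]
        rcases hex with rfl | rfl
        exacts [this.1, this.2]
      have k₃ := Finset.card_le_card k₂
      rw [Finset.card_singleton] at k₃
      omega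
    have hLl : L = {l} := Finset.eq_singleton_iff_unique_mem.2
      ⟨hl, fun x hx => Finset.card_le_one.1 hL1 x hx l hl⟩
    obtain ⟨a, b, g⟩ := l
    obtain ⟨rfl, rfl⟩ : a = v ∧ b = v := (Finset.mem_filter.1 hl).2
    have hg : g ≠ 1 := hF.gain_ne_one_of_loop (Finset.mem_filter.1 hl).1
    rw [hLl, Finset.card_singleton] at hcardDL
    left
    obtain h1 | h2 : D.card = 1 ∨ D.card = 2 := by omega
    · obtain ⟨e, he⟩ := Finset.card_eq_one.1 h1
      obtain rfl : (b, b, g) = e := by simpa [he] using hLsub hl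
      rw [he, Finset.coe_singleton]
      exact exists_linearIndepOn_loop hτ hg
    · obtain ⟨e, heD, hne⟩ := Finset.exists_mem_ne (s := D) (by omega) (b, b, g)
      obtain ⟨u, h, hp⟩ := hport e heD (by simpa [hLl] using hne)
      have he : D = {(b, b, g), e} := by
        refine (Finset.eq_of_subset_of_card_le ?_ ?_).symm
        · exact Finset.insert_subset (hLsub hl) (Finset.singleton_subset_iff.2 heD)
        · rw [h2, Finset.card_pair hne.symm]
      rw [he, Finset.coe_pair]
      exact exists_linearIndepOn_loop_port hτ hg hp

end OneExtension

/-! ## Independent edge sets are sparse -/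

namespace GainGraph

variable {Γ V E : Type*} [Group Γ] {H : GainGraph Γ V E}
  {τ : Γ →* Matrix.orthogonalGroup (Fin 2) ℝ} {ρ : Γ →* ℂ} {q : V → Fin 2 → ℝ}

theorem orbitRigidityMatrix_eq_zero_of_notMem_verts {A : Finset E} {e : E} (he : e ∈ A) {v : V}
    (hv : v ∉ H.verts A) (i : Fin 2) : H.orbitRigidityMatrix τ ρ q e (v, i) = 0 := by
  have h₁ : v ≠ H.src e := fun h => hv (h ▸ src_mem_verts he)
  have h₂ : v ≠ H.tgt e := fun h => hv (h ▸ tgt_mem_verts he)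
  simp [orbitRigidityMatrix, h₁, h₂]

/-- Independent rows which annihilate `k` independent motions span at most `2 |V(A)| - k`
dimensions. -/
theorem card_add_le_of_linearIndepOn [Fintype V] {A : Finset E}
    (hA : LinearIndepOn ℂ (H.orbitRigidityMatrix τ ρ q).row A) {k : ℕ}
    (n : Fin k → V → Fin 2 → ℂ)
    (hker : ∀ e ∈ A, ∀ j, ∑ w : V × Fin 2, H.orbitRigidityMatrix τ ρ q e w * n j w.1 w.2 = 0)
    (hn : ∀ c : Fin k → ℂ, (∀ v ∈ H.verts A, ∀ i, ∑ j, c j * n j v i = 0) → ∀ j, c j = 0) :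
    A.card + k ≤ 2 * (H.verts A).card := by
  classical
  let M : Matrix A (H.verts A × Fin 2) ℂ :=
    fun e w => H.orbitRigidityMatrix τ ρ q e.1 (w.1.1, w.2)
  have hM : LinearIndependent ℂ M.row := by
    rw [Fintype.linearIndependent_iff]
    intro g hg
    refine Fintype.linearIndependent_iff.1 hA g (funext fun w => ?_)
    obtain ⟨v, i⟩ := w
    simp only [Finset.sum_apply, Pi.smul_apply, Pi.zero_apply, smul_eq_mul]
    by_cases hv : v ∈ H.verts A
    · have := congrFun hg (⟨v, hv⟩, i)
      simp only [Finset.sum_apply, Pi.smul_apply, Pi.zero_apply, smul_eq_mul] at this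
      exact this
    · exact Finset.sum_eq_zero fun e _ => by
        rw [show (H.orbitRigidityMatrix τ ρ q).row e.1 (v, i) = 0 from
          orbitRigidityMatrix_eq_zero_of_notMem_verts e.2 hv i, mul_zero]
  have hrank : M.rank = A.card := by rw [hM.rank_matrix, Fintype.card_coe]
  let N : Fin k → (H.verts A × Fin 2 → ℂ) := fun j w => n j w.1.1 w.2
  have hN : LinearIndependent ℂ N := by
    rw [Fintype.linearIndependent_iff]
    intro c hc
    refine hn c fun v hv i => ?_
    have := congrFun hc (⟨v, hv⟩, i)
    simpa only [Finset.sum_apply, Pi.smul_apply, Pi.zero_apply, smul_eq_mul] using this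
  have hle : Submodule.span ℂ (Set.range N) ≤ LinearMap.ker M.mulVecLin := by
    rw [Submodule.span_le]
    rintro _ ⟨j, rfl⟩
    rw [SetLike.mem_coe, LinearMap.mem_ker, Matrix.mulVecLin_apply]
    ext e
    rw [Pi.zero_apply, ← hker e.1 e.2 j]
    simp only [Matrix.mulVec, dotProduct, Fintype.sum_prod_type]
    rw [← Finset.sum_subset (Finset.subset_univ (H.verts A))
      (fun v _ hv => Finset.sum_eq_zero fun i _ => by
        rw [orbitRigidityMatrix_eq_zero_of_notMem_verts e.2 hv i, zero_mul])]
    exact Finset.sum_coe_sort (H.verts A)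
      (fun v => ∑ i, H.orbitRigidityMatrix τ ρ q e (v, i) * n j v i)
  have h₁ := Submodule.finrank_mono hle
  rw [finrank_span_eq_card hN, Fintype.card_fin] at h₁
  have h₂ := LinearMap.finrank_range_add_finrank_ker M.mulVecLin
  rw [show Module.finrank ℂ (LinearMap.range M.mulVecLin) = A.card from hrank,
    Module.finrank_fintype_fun_eq_card, Fintype.card_prod, Fintype.card_coe, Fintype.card_fin] at h₂
  omega

theorem sum_orbitRigidityMatrix_mul [Fintype V] (hτ : IsRotationAction τ) (e : E)
    (m : V → Fin 2 → ℂ) :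
    ∑ w : V × Fin 2, H.orbitRigidityMatrix τ ρ q e w * m w.1 w.2 =
      ((q (H.src e) 0 - ((τ (H.gain e)).1 0 0 * q (H.tgt e) 0 +
        (τ (H.gain e)).1 0 1 * q (H.tgt e) 1)) * m (H.src e) 0 +
      (q (H.src e) 1 - ((τ (H.gain e)).1 0 0 * q (H.tgt e) 1 -
        (τ (H.gain e)).1 0 1 * q (H.tgt e) 0)) * m (H.src e) 1) +
      ρ (H.gain e) * ((q (H.tgt e) 0 - ((τ (H.gain e)).1 0 0 * q (H.src e) 0 -
        (τ (H.gain e)).1 0 1 * q (H.src e) 1)) * m (H.tgt e) 0 +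
      (q (H.tgt e) 1 - ((τ (H.gain e)).1 0 0 * q (H.src e) 1 +
        (τ (H.gain e)).1 0 1 * q (H.src e) 0)) * m (H.tgt e) 1) := by
  classical
  have h₀ := fun w => completeGainGraph_row_zero (ρ := ρ) hτ q (H.src e) (H.tgt e) w (H.gain e)
  have h₁ := fun w => completeGainGraph_row_one (ρ := ρ) hτ q (H.src e) (H.tgt e) w (H.gain e)
  have hr : H.orbitRigidityMatrix τ ρ q e =
    (completeGainGraph Γ V).orbitRigidityMatrix τ ρ q (H.src e, H.tgt e, H.gain e) := rfl
  rw [Fintype.sum_prod_type]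
  simp only [Fin.sum_univ_two, hr, h₀, h₁, add_mul, ite_mul, zero_mul, Finset.sum_add_distrib,
    Finset.sum_ite_eq', Finset.mem_univ, if_true]
  ring

theorem sum_orbitRigidityMatrix_mul_isotropic [Fintype V] (hτ : IsRotationAction τ) {e : E}
    {ζ : ℂ} (hζ : ζ ^ 2 = -1) {l : V → ℂ}
    (hl : l (H.src e) = ρ (H.gain e) * ((τ (H.gain e)).1 0 0 + (τ (H.gain e)).1 0 1 * ζ) *
      l (H.tgt e)) :
    ∑ w : V × Fin 2, H.orbitRigidityMatrix τ ρ q e w * (l w.1 * ![1, ζ] w.2) = 0 := by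
  rw [sum_orbitRigidityMatrix_mul hτ e (fun v i => l v * ![1, ζ] i)]
  have hsq : ((τ (H.gain e)).1 0 0 : ℂ) ^ 2 + (τ (H.gain e)).1 0 1 ^ 2 = 1 := by
    exact_mod_cast IsRotationAction.sq_add_sq (τ := τ) (H.gain e)
  simp only [Matrix.cons_val_zero, Matrix.cons_val_one, hl]
  linear_combination ρ (H.gain e) * l (H.tgt e) * (((τ (H.gain e)).1 0 1 * q (H.src e) 1 +
    (τ (H.gain e)).1 0 1 ^ 2 * q (H.tgt e) 0 -
    (τ (H.gain e)).1 0 0 * (τ (H.gain e)).1 0 1 * q (H.tgt e) 1) * hζ -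
    (q (H.tgt e) 0 + ζ * q (H.tgt e) 1) * hsq)

theorem sum_orbitRigidityMatrix_mul_rotation [Fintype V] (hτ : IsRotationAction τ) {e : E}
    {l : V → ℂ} (hl : l (H.src e) = ρ (H.gain e) * l (H.tgt e)) :
    ∑ w : V × Fin 2, H.orbitRigidityMatrix τ ρ q e w *
      (l w.1 * ![-(q w.1 1 : ℂ), q w.1 0] w.2) = 0 := by
  rw [sum_orbitRigidityMatrix_mul hτ e (fun v i => l v * ![-(q v 1 : ℂ), q v 0] i)]
  have hsq : ((τ (H.gain e)).1 0 0 : ℂ) ^ 2 + (τ (H.gain e)).1 0 1 ^ 2 = 1 := by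
    exact_mod_cast IsRotationAction.sq_add_sq (τ := τ) (H.gain e)
  simp only [Matrix.cons_val_zero, Matrix.cons_val_one, hl]
  ring

/-- `ρ` is trivial or inverse to an eigenvalue of the rotations: there is a nonzero motion which is
annihilated by all rows. -/
def HasMotion (τ : Γ →* Matrix.orthogonalGroup (Fin 2) ℝ) (ρ : Γ →* ℂ) : Prop :=
  (∀ h, ρ h = 1) ∨ ∃ ζ : ℂ, ζ ^ 2 = -1 ∧
    ∀ h, ρ h * ((τ h).1 0 0 + (τ h).1 0 1 * ζ) = 1

theorem sparse_of_linearIndepOn [Fintype V] (hτ : IsRotationAction τ) (hρ : HasMotion τ ρ)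
    {F : Finset E}
    (hq : ∀ e ∈ F, q (H.src e) ≠ (τ (H.gain e)).1.mulVec (q (H.tgt e)))
    (hF : LinearIndepOn ℂ (H.orbitRigidityMatrix τ ρ q).row F) : H.Sparse F := by
  intro A hAF hne
  have hA := hF.mono (Finset.coe_subset.2 hAF)
  obtain ⟨e, he⟩ := hne
  have hs := H.src_mem_verts he
  have ht := H.tgt_mem_verts he
  constructor
  · rcases hρ with hρ | ⟨ζ, hζ, hρ⟩
    · refine card_add_le_of_linearIndepOn hA (fun (_ : Fin 1) v => ![-(q v 1 : ℂ), q v 0]) ?_ ?_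
      · intro e _ _
        have := H.sum_orbitRigidityMatrix_mul_rotation (q := q) (ρ := ρ) hτ (e := e) (l := 1)
          (by simp [hρ])
        simpa using this
      · intro c hc j
        by_contra hcj
        rw [Subsingleton.elim j 0] at hcj
        have hz : ∀ v ∈ H.verts A, q v = 0 := by
          intro v hv
          have h₀ := hc v hv 0
          have h₁ := hc v hv 1
          simp [hcj] at h₀ h₁
          ext i
          fin_cases i <;> simp [h₀, h₁]
        refine hq e (hAF he) ?_
        rw [hz _ hs, hz _ ht, Matrix.mulVec_zero]
    · refine card_add_le_of_linearIndepOn hA (fun (_ : Fin 1) v => ![1, ζ]) ?_ ?_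
      · intro e _ _
        have := H.sum_orbitRigidityMatrix_mul_isotropic (q := q) (ρ := ρ) hτ (e := e) hζ (l := 1)
          (by simp [hρ])
        simpa using this
      · intro c hc j
        have := hc _ hs 0
        rw [Subsingleton.elim j 0]
        simpa using this
  · rintro ⟨g, hg⟩
    have hmul : ∀ ζ : ℂ, ζ ^ 2 = -1 → ∀ a b : Γ, ((τ (a * b)).1 0 0 + (τ (a * b)).1 0 1 * ζ : ℂ) =
        ((τ a).1 0 0 + (τ a).1 0 1 * ζ) * ((τ b).1 0 0 + (τ b).1 0 1 * ζ) := by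
      intro ζ hζ a b
      rw [hτ.mul_zero_zero, hτ.mul_zero_one]
      push_cast
      linear_combination -((τ a).1 0 1 * (τ b).1 0 1 : ℂ) * hζ
    have hI : (-Complex.I) ^ 2 = -1 := by simp
    have hge : ∀ e ∈ A, (g (H.src e))⁻¹ = H.gain e * (g (H.tgt e))⁻¹ := fun e he => by
      rw [hg e he, mul_inv_cancel_right]
    obtain ⟨n₁, hn₁⟩ : ∃ n : V → Fin 2 → ℂ, n = fun v i => (ρ (g v)⁻¹ *
      ((τ (g v)⁻¹).1 0 0 + (τ (g v)⁻¹).1 0 1 * Complex.I)) * ![1, Complex.I] i := ⟨_, rfl⟩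
    obtain ⟨n₂, hn₂⟩ : ∃ n : V → Fin 2 → ℂ, n = fun v i => (ρ (g v)⁻¹ *
      ((τ (g v)⁻¹).1 0 0 + (τ (g v)⁻¹).1 0 1 * -Complex.I)) * ![1, -Complex.I] i := ⟨_, rfl⟩
    obtain ⟨n₃, hn₃⟩ : ∃ n : V → Fin 2 → ℂ, n = fun v i =>
      ρ (g v)⁻¹ * ![-(q v 1 : ℂ), q v 0] i := ⟨_, rfl⟩
    have k₁ : ∀ e ∈ A, ∑ w : V × Fin 2, H.orbitRigidityMatrix τ ρ q e w * n₁ w.1 w.2 = 0 := by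
      intro e he
      rw [hn₁]
      refine H.sum_orbitRigidityMatrix_mul_isotropic hτ Complex.I_sq (l := fun v => ρ (g v)⁻¹ *
        ((τ (g v)⁻¹).1 0 0 + (τ (g v)⁻¹).1 0 1 * Complex.I)) ?_
      rw [hge e he, hmul _ Complex.I_sq, map_mul]
      ring
    have k₂ : ∀ e ∈ A, ∑ w : V × Fin 2, H.orbitRigidityMatrix τ ρ q e w * n₂ w.1 w.2 = 0 := by
      intro e he
      rw [hn₂]
      refine H.sum_orbitRigidityMatrix_mul_isotropic hτ hI (l := fun v => ρ (g v)⁻¹ *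
        ((τ (g v)⁻¹).1 0 0 + (τ (g v)⁻¹).1 0 1 * -Complex.I)) ?_
      rw [hge e he, hmul _ hI, map_mul]
      ring
    have k₃ : ∀ e ∈ A, ∑ w : V × Fin 2, H.orbitRigidityMatrix τ ρ q e w * n₃ w.1 w.2 = 0 := by
      intro e he
      rw [hn₃]
      refine H.sum_orbitRigidityMatrix_mul_rotation hτ (l := fun v => ρ (g v)⁻¹) ?_
      rw [hge e he, map_mul]
    refine card_add_le_of_linearIndepOn hA (k := 3) ![n₁, n₂, n₃] ?_ ?_
    · intro e he j
      fin_cases j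
      exacts [k₁ e he, k₂ e he, k₃ e he]
    · intro c hc
      have key : ∀ v ∈ H.verts A, c 0 + c 1 = c 2 * ((τ (g v)).1.mulVec (q v) 1 : ℝ) ∧
          Complex.I * (c 0 - c 1) = -(c 2 * ((τ (g v)).1.mulVec (q v) 0 : ℝ)) := by
        intro v hv
        have h₀ := hc v hv 0
        have h₁ := hc v hv 1
        have hr := ρ.apply_ne_zero_of_group (g v)⁻¹
        simp only [Fin.sum_univ_three, Matrix.cons_val_zero, Matrix.cons_val_one,
          Matrix.cons_val, hn₁, hn₂, hn₃, hτ.inv_zero_one,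
          IsRotationAction.inv_zero_zero] at h₀ h₁
        rw [hτ.mulVec_one, IsRotationAction.mulVec_zero]
        have hsq : ((τ (g v)).1 0 0 : ℂ) ^ 2 + (τ (g v)).1 0 1 ^ 2 = 1 := by
          exact_mod_cast IsRotationAction.sq_add_sq (τ := τ) (g v)
        have hi := Complex.I_sq
        push_cast at h₀ h₁ ⊢
        generalize ((τ (g v)).1 0 0 : ℂ) = C at *
        generalize ((τ (g v)).1 0 1 : ℂ) = S at *
        generalize ρ (g v)⁻¹ = r at *
        generalize Complex.I = I at *
        have e₀ : C * (c 0 + c 1) - S * (I * (c 0 - c 1)) = c 2 * q v 1 :=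
          mul_left_cancel₀ hr (by linear_combination h₀)
        have e₁ : C * (I * (c 0 - c 1)) + S * (c 0 + c 1) = -(c 2 * q v 0) :=
          mul_left_cancel₀ hr (by linear_combination h₁ + r * S * (c 0 + c 1) * hi)
        constructor
        · linear_combination C * e₀ + S * e₁ - (c 0 + c 1) * hsq
        · linear_combination C * e₁ - S * e₀ - I * (c 0 - c 1) * hsq
      obtain ⟨s₁, s₀⟩ := key _ hs
      obtain ⟨t₁, t₀⟩ := key _ ht
      have hc₂ : c 2 = 0 := by
        by_contra hc₂
        have p₁ : (τ (g (H.src e))).1.mulVec (q (H.src e)) 1 =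
            (τ (g (H.tgt e))).1.mulVec (q (H.tgt e)) 1 := by
          exact_mod_cast mul_left_cancel₀ hc₂ (s₁.symm.trans t₁)
        have p₀ : (τ (g (H.src e))).1.mulVec (q (H.src e)) 0 =
            (τ (g (H.tgt e))).1.mulVec (q (H.tgt e)) 0 := by
          exact_mod_cast mul_left_cancel₀ hc₂ (neg_injective (s₀.symm.trans t₀))
        have p : (τ (g (H.src e))).1.mulVec (q (H.src e)) =
            (τ (g (H.tgt e))).1.mulVec (q (H.tgt e)) := by
          ext i
          fin_cases i
          exacts [p₀, p₁]
        refine hq e (hAF he) ?_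
        rw [hg e he, ← mulVec_map_mulVec, ← p, mulVec_map_mulVec, inv_mul_cancel, map_one]
        exact (Matrix.one_mulVec _).symm
      rw [hc₂] at s₁ s₀
      have s₀' : c 0 - c 1 = 0 := by
        refine (mul_eq_zero.1 ?_).resolve_left Complex.I_ne_zero
        rw [s₀, zero_mul, neg_zero]
      intro j
      fin_cases j
      · change c 0 = 0
        linear_combination (s₁ + s₀') / 2
      · change c 1 = 0
        linear_combination (s₁ - s₀') / 2
      · exact hc₂

end GainGraph

theorem Matrix.rank_map_algebraMap {K L m n : Type*} [Field K] [Field L] [Algebra K L]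
    [Finite m] [Fintype n] (A : Matrix m n K) : (A.map (algebraMap K L)).rank = A.rank := by
  classical
  have : Fintype m := Fintype.ofFinite m
  obtain ⟨κ, a, ha, hsp, hli⟩ := exists_linearIndependent' K A.row
  have : Finite κ := Finite.of_injective a ha
  have : Fintype κ := Fintype.ofFinite κ
  have hli' : LinearIndependent L ((A.map (algebraMap K L)).row ∘ a) :=
    linearIndependent_algebraMap_comp_iff.2 hli
  have hsp' : Submodule.span L (Set.range ((A.map (algebraMap K L)).row ∘ a)) =
      Submodule.span L (Set.range (A.map (algebraMap K L)).row) := by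
    refine le_antisymm (Submodule.span_mono (Set.range_comp_subset_range _ _))
      (Submodule.span_le.2 ?_)
    rintro _ ⟨i, rfl⟩
    have hi : A.row i ∈ Submodule.span K (Set.range (A.row ∘ a)) :=
      hsp ▸ Submodule.subset_span ⟨i, rfl⟩
    obtain ⟨c, hc⟩ := (Submodule.mem_span_range_iff_exists_fun K).1 hi
    refine (Submodule.mem_span_range_iff_exists_fun L).2 ⟨fun k => algebraMap K L (c k), ?_⟩
    ext j
    have := congrArg (algebraMap K L) (congrFun hc j)
    simpa [Finset.sum_apply, Algebra.smul_def] using this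
  rw [Matrix.rank_eq_finrank_span_row, Matrix.rank_eq_finrank_span_row, ← hsp, ← hsp',
    finrank_span_eq_card hli, finrank_span_eq_card hli']

theorem LinearMap.finrank_range_of_comp_eq {K ι A B : Type*} {A' B' : ι → Type*} [Field K] [Fintype ι]
    [AddCommGroup A] [Module K A] [AddCommGroup B] [Module K B] [∀ i, AddCommGroup (A' i)]
    [∀ i, Module K (A' i)] [∀ i, AddCommGroup (B' i)] [∀ i, Module K (B' i)]
    [∀ i, FiniteDimensional K (B' i)]
    {f : A →ₗ[K] B} {f' : ∀ i, A' i →ₗ[K] B' i} {φ : (∀ i, A' i) →ₗ[K] A}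
    {ψ : (∀ i, B' i) →ₗ[K] B} (hφ : Function.Surjective φ) (hψ : Function.Injective ψ)
    (h : ∀ x, f (φ x) = ψ fun i => f' i (x i)) :
    Module.finrank K (LinearMap.range f) = ∑ i, Module.finrank K (LinearMap.range (f' i)) := by
  classical
  let e : (∀ i, LinearMap.range (f' i)) →ₗ[K] B :=
    ψ ∘ₗ LinearMap.pi fun i => (LinearMap.range (f' i)).subtype ∘ₗ LinearMap.proj i
  have he : Function.Injective e := fun x y hxy => by
    ext i
    exact congrFun (hψ hxy) i
  have hr : LinearMap.range f = LinearMap.range e := by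
    apply le_antisymm
    · rintro _ ⟨x, rfl⟩
      obtain ⟨y, rfl⟩ := hφ x
      exact ⟨fun i => ⟨f' i (y i), y i, rfl⟩, (h y).symm⟩
    · rintro _ ⟨x, rfl⟩
      choose y hy using fun i => (x i).2
      refine ⟨φ y, (h y).trans (congrArg ψ (funext hy))⟩
  rw [hr, LinearMap.finrank_range_of_inj he, Module.finrank_pi_fintype]

theorem sum_rigidityMatrix_mul {V : Type*} [Fintype V] {d : ℕ} {G : SimpleGraph V}
    (p : V → Fin d → ℝ) {e : G.edgeSet} {a b : V} (h : e.1 = s(a, b)) (m : V × Fin d → ℂ) :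
    ∑ w, (rigidityMatrix G p e w : ℂ) * m w =
      ∑ i, ((p a i - p b i : ℝ) : ℂ) * (m (a, i) - m (b, i)) := by
  classical
  have hab : a ≠ b := by
    have := e.2
    rw [h] at this
    exact G.ne_of_adj this
  have hv : ∀ v i, rigidityMatrix G p e (v, i) =
      (if v = a then p a i - p b i else 0) + (if v = b then p b i - p a i else 0) := by
    intro v i
    by_cases hva : v = a
    · subst hva
      have hm : v ∈ e.1 := h ▸ Sym2.mem_mk_left v b
      have ho : Sym2.Mem.other hm = b := Sym2.congr_right.1 ((Sym2.other_spec hm).trans h)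
      simp only [rigidityMatrix, hm, dif_pos, ho, hab, if_true, if_false, add_zero]
    · by_cases hvb : v = b
      · subst hvb
        have hm : v ∈ e.1 := h ▸ Sym2.mem_mk_right a v
        have ho : Sym2.Mem.other hm = a :=
          Sym2.congr_right.1 ((Sym2.other_spec hm).trans (h.trans Sym2.eq_swap))
        simp only [rigidityMatrix, hm, dif_pos, ho, hva, if_true, if_false, zero_add]
      · have hm : v ∉ e.1 := by rw [h]; simp [hva, hvb]
        simp [rigidityMatrix, hm, hva, hvb]
  rw [Fintype.sum_prod_type, Finset.sum_comm]
  refine Finset.sum_congr rfl fun i _ => ?_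
  have hc : ∀ v, (rigidityMatrix G p e (v, i) : ℂ) * m (v, i) =
      (if v = a then ((p a i - p b i : ℝ) : ℂ) * m (v, i) else 0) +
        (if v = b then ((p b i - p a i : ℝ) : ℂ) * m (v, i) else 0) := by
    intro v
    rw [hv]
    split_ifs <;> push_cast <;> ring
  simp only [hc, Finset.sum_add_distrib, Finset.sum_ite_eq', Finset.mem_univ, if_true]
  push_cast
  ring

/-! ## Lifting motions of the quotient -/

namespace QuotientChoice

variable {Γ : Type*} [Group Γ] {V : Type*} {G : SimpleGraph V} {θ : Γ →* (G ≃g G)}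

theorem apply_mul (θ : Γ →* (G ≃g G)) (γ δ : Γ) (v : V) : θ (γ * δ) v = θ γ (θ δ v) := by
  rw [map_mul, RelIso.mul_apply]

theorem mk_apply (γ : Γ) (v : V) :
    Quotient.mk (vertexOrbitSetoid θ) (θ γ v) = Quotient.mk (vertexOrbitSetoid θ) v :=
  (Quotient.sound ⟨γ, rfl⟩ : Quotient.mk (vertexOrbitSetoid θ) v = _).symm

theorem label_spec (C : QuotientChoice θ) (v : V) :
    θ (C.label v) (C.rep (Quotient.mk (vertexOrbitSetoid θ) v)) = v :=
  (C.exists_label v).choose_spec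

theorem _root_.IsFreeOnVertices.eq_of_apply_eq (hθ : IsFreeOnVertices θ) {γ δ : Γ} {v : V}
    (h : θ γ v = θ δ v) : γ = δ := by
  by_contra hne
  refine hθ (δ⁻¹ * γ) (fun h' => hne (inv_mul_eq_one.1 h').symm) v ?_
  rw [apply_mul, h, ← apply_mul, inv_mul_cancel, map_one]
  rfl

theorem label_apply (hθ : IsFreeOnVertices θ) (C : QuotientChoice θ) (γ : Γ) (v : V) :
    C.label (θ γ v) = γ * C.label v := by
  refine hθ.eq_of_apply_eq (v := C.rep (Quotient.mk (vertexOrbitSetoid θ) v)) ?_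
  have := C.label_spec (θ γ v)
  rw [mk_apply] at this
  rw [this, apply_mul, label_spec]

theorem label_rep (hθ : IsFreeOnVertices θ) (C : QuotientChoice θ) (o : VertexOrbit θ) :
    C.label (C.rep o) = 1 := by
  refine hθ.eq_of_apply_eq (v := C.rep o) ?_
  have := C.label_spec (C.rep o)
  rw [C.rep_spec] at this
  rw [this, map_one]
  rfl

theorem apply_eq_mulVec_quotientPlacement {d : ℕ} (C : QuotientChoice θ)
    {τ : Γ →* Matrix.orthogonalGroup (Fin d) ℝ} {q : V → Fin d → ℝ}
    (hq : ∀ (γ : Γ) (v : V), (τ γ).1.mulVec (q v) = q (θ γ v)) (v : V) :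
    q v = (τ (C.label v)).1.mulVec
      (C.quotientPlacement q (Quotient.mk (vertexOrbitSetoid θ) v)) := by
  rw [quotientPlacement, hq, label_spec]

theorem exists_apply_dart_edge (C : QuotientChoice θ) (e : G.edgeSet) :
    ∃ γ : Γ, Sym2.map (θ γ) (C.dart (Quotient.mk (edgeOrbitSetoid θ) e)).edge = e.1 :=
  Quotient.exact (C.dart_spec (Quotient.mk (edgeOrbitSetoid θ) e))

/-- The label of the start of the edge `e`, oriented like the representative of its orbit. -/
noncomputable def edgeLabel (C : QuotientChoice θ) (e : G.edgeSet) : Γ :=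
  (C.exists_apply_dart_edge e).choose *
    C.label (C.dart (Quotient.mk (edgeOrbitSetoid θ) e)).fst

/-- The image of an edge under `γ`. -/
def mapEdge (θ : Γ →* (G ≃g G)) (γ : Γ) (e : G.edgeSet) : G.edgeSet :=
  ⟨Sym2.map (θ γ) e.1, by
    obtain ⟨e, he⟩ := e
    induction e with
    | _ a b => exact (θ γ).map_adj_iff.2 he⟩

theorem edgeLabel_mapEdge (hθ : IsFreeOnVertices θ) (h2 : ∀ γ : Γ, γ ^ 2 = 1 → γ = 1)
    (C : QuotientChoice θ) (γ : Γ) (o : EdgeOrbit θ) :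
    Quotient.mk (edgeOrbitSetoid θ) (mapEdge θ γ ⟨(C.dart o).edge, (C.dart o).edge_mem⟩) = o ∧
    C.edgeLabel (mapEdge θ γ ⟨(C.dart o).edge, (C.dart o).edge_mem⟩) =
      γ * C.label (C.dart o).fst := by
  set e := mapEdge θ γ ⟨(C.dart o).edge, (C.dart o).edge_mem⟩ with he
  have ho : Quotient.mk (edgeOrbitSetoid θ) e = o := by
    rw [← C.dart_spec o]
    exact (Quotient.sound ⟨γ, rfl⟩ : Quotient.mk (edgeOrbitSetoid θ) _ = _).symm
  refine ⟨ho, ?_⟩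
  have hs := (C.exists_apply_dart_edge e).choose_spec
  rw [edgeLabel]
  generalize (C.exists_apply_dart_edge e).choose = δ at hs
  rw [ho] at hs ⊢
  congr 1
  have hs' : s(θ δ (C.dart o).fst, θ δ (C.dart o).snd) =
      s(θ γ (C.dart o).fst, θ γ (C.dart o).snd) := hs
  rcases Sym2.eq_iff.1 hs' with ⟨h, -⟩ | ⟨h, h'⟩
  · exact hθ.eq_of_apply_eq h
  · have h₁ : θ (γ⁻¹ * δ) (C.dart o).fst = (C.dart o).snd := by
      rw [apply_mul, h, ← apply_mul, inv_mul_cancel, map_one]; rfl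
    have h₂ : θ (γ⁻¹ * δ) (C.dart o).snd = (C.dart o).fst := by
      rw [apply_mul, h', ← apply_mul, inv_mul_cancel, map_one]; rfl
    have h₃ : (γ⁻¹ * δ) ^ 2 = 1 := by
      refine hθ.eq_of_apply_eq (v := (C.dart o).fst) ?_
      rw [pow_two, apply_mul, h₁, h₂, map_one]
      rfl
    exact (inv_mul_eq_one.1 (h2 _ h₃)).symm

/-- The motion of `G` with components `m j` in the isotypic components of the characters `ρ j`. -/
noncomputable def liftMotion {J : Type*} [Fintype J] (C : QuotientChoice θ)
    (τ : Γ →* Matrix.orthogonalGroup (Fin 2) ℝ) (ρ : J → Γ →* ℂ) :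
    (J → VertexOrbit θ × Fin 2 → ℂ) →ₗ[ℂ] (V × Fin 2 → ℂ) where
  toFun m w := ∑ j, ρ j (C.label w.1) * ∑ k, ((τ (C.label w.1)).1 w.2 k : ℂ) *
    m j (Quotient.mk (vertexOrbitSetoid θ) w.1, k)
  map_add' m n := by
    ext w
    simp only [Pi.add_apply, mul_add, Finset.sum_add_distrib]
  map_smul' c m := by
    ext w
    simp only [Pi.smul_apply, smul_eq_mul, RingHom.id_apply, Finset.mul_sum]
    exact Finset.sum_congr rfl fun j _ => Finset.sum_congr rfl fun k _ => by ring

/-- The tensions of the edges of `G` with components `x j` in the isotypic components of the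
characters `ρ j`. -/
noncomputable def liftTension {J : Type*} [Fintype J] (C : QuotientChoice θ) (ρ : J → Γ →* ℂ) :
    (J → EdgeOrbit θ → ℂ) →ₗ[ℂ] (G.edgeSet → ℂ) where
  toFun x e := ∑ j, ρ j (C.edgeLabel e) * x j (Quotient.mk (edgeOrbitSetoid θ) e)
  map_add' x y := by
    ext e
    simp only [Pi.add_apply, mul_add, Finset.sum_add_distrib]
  map_smul' c x := by
    ext e
    simp only [Pi.smul_apply, smul_eq_mul, RingHom.id_apply, Finset.mul_sum]
    exact Finset.sum_congr rfl fun j _ => by ring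

theorem liftTension_injective {J : Type*} [Fintype J] (hθ : IsFreeOnVertices θ)
    (h2 : ∀ γ : Γ, γ ^ 2 = 1 → γ = 1) (C : QuotientChoice θ) {ρ : J → Γ →* ℂ}
    (hρ : Function.Injective ρ) : Function.Injective (C.liftTension ρ) := by
  rw [← LinearMap.ker_eq_bot, LinearMap.ker_eq_bot']
  intro x hx
  have hli := (linearIndependent_monoidHom Γ ℂ).comp ρ hρ
  ext j o
  refine Fintype.linearIndependent_iff.1 hli (fun j => x j o) ?_ j
  ext γ
  have h := C.edgeLabel_mapEdge hθ h2 (γ * (C.label (C.dart o).fst)⁻¹) o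
  have hxe := congrFun hx
    (mapEdge θ (γ * (C.label (C.dart o).fst)⁻¹) ⟨(C.dart o).edge, (C.dart o).edge_mem⟩)
  simp only [liftTension, LinearMap.coe_mk, AddHom.coe_mk, h.1, h.2, inv_mul_cancel_right,
    Pi.zero_apply] at hxe
  rw [Finset.sum_apply]
  simpa [mul_comm] using hxe

theorem _root_.exists_sum_character_mul_eq {J : Type*} [Fintype J] [Fintype Γ]
    {ρ : J → Γ →* ℂ} (hρ : Function.Injective ρ) (hJ : Fintype.card J = Fintype.card Γ)
    (y : Γ → ℂ) : ∃ a : J → ℂ, ∀ γ, ∑ j, ρ j γ * a j = y γ := by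
  have hli := (linearIndependent_monoidHom Γ ℂ).comp ρ hρ
  have hsp := hli.span_eq_top_of_card_eq_finrank' (by
    rw [Module.finrank_fintype_fun_eq_card, hJ])
  have hy : y ∈ Submodule.span ℂ (Set.range ((fun f : Γ →* ℂ => (f : Γ → ℂ)) ∘ ρ)) :=
    hsp ▸ Submodule.mem_top
  obtain ⟨a, ha⟩ := (Submodule.mem_span_range_iff_exists_fun ℂ).1 hy
  refine ⟨a, fun γ => ?_⟩
  rw [← ha, Finset.sum_apply]
  simp [mul_comm]

theorem liftMotion_surjective {J : Type*} [Fintype J] [Fintype Γ] (C : QuotientChoice θ)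
    (τ : Γ →* Matrix.orthogonalGroup (Fin 2) ℝ) {ρ : J → Γ →* ℂ} (hρ : Function.Injective ρ)
    (hJ : Fintype.card J = Fintype.card Γ) : Function.Surjective (C.liftMotion τ ρ) := by
  intro x
  choose a ha using fun (o : VertexOrbit θ) (k : Fin 2) => exists_sum_character_mul_eq hρ hJ
    fun γ => ∑ i, ((τ γ).1 i k : ℂ) * x (θ γ (C.rep o), i)
  refine ⟨fun j w => a w.1 w.2 j, ?_⟩
  ext ⟨v, i⟩
  have horth : ∀ i', ∑ k, ((τ (C.label v)).1 i k : ℂ) * (τ (C.label v)).1 i' k =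
      if i = i' then 1 else 0 := by
    intro i'
    have := congrFun (congrFun
      ((Matrix.mem_orthogonalGroup_iff (Fin 2) ℝ).1 (τ (C.label v)).2) i) i'
    simp only [Matrix.mul_apply, Matrix.transpose_apply, Matrix.one_apply] at this
    have := congrArg (fun r : ℝ => (r : ℂ)) this
    simpa [apply_ite] using this
  calc ∑ j, ρ j (C.label v) * ∑ k, ((τ (C.label v)).1 i k : ℂ) *
        a (Quotient.mk (vertexOrbitSetoid θ) v) k j
      = ∑ k, ((τ (C.label v)).1 i k : ℂ) * ∑ j, ρ j (C.label v) *
          a (Quotient.mk (vertexOrbitSetoid θ) v) k j := by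
        simp only [Finset.mul_sum]
        rw [Finset.sum_comm]
        exact Finset.sum_congr rfl fun k _ => Finset.sum_congr rfl fun j _ => by ring
    _ = ∑ i', (∑ k, ((τ (C.label v)).1 i k : ℂ) * (τ (C.label v)).1 i' k) * x (v, i') := by
        simp only [ha, label_spec, Finset.mul_sum, Finset.sum_mul]
        rw [Finset.sum_comm]
        exact Finset.sum_congr rfl fun k _ => Finset.sum_congr rfl fun j _ => by ring
    _ = x (v, i) := by simp [horth]

end QuotientChoice

namespace QuotientChoice

variable {Γ : Type*} [Group Γ] {V : Type*} {G : SimpleGraph V} {θ : Γ →* (G ≃g G)}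

theorem rigidityMatrix_liftMotion [Fintype V] [Fintype (VertexOrbit θ)] (hθ : IsFreeOnVertices θ)
    (C : QuotientChoice θ) {τ : Γ →* Matrix.orthogonalGroup (Fin 2) ℝ} (hτ : IsRotationAction τ)
    {J : Type*} [Fintype J] (ρ : J → Γ →* ℂ) {q : V → Fin 2 → ℝ}
    (hq : ∀ (γ : Γ) (v : V), (τ γ).1.mulVec (q v) = q (θ γ v))
    (m : J → VertexOrbit θ × Fin 2 → ℂ) (e : G.edgeSet) :
    ∑ w, (rigidityMatrix G q e w : ℂ) * C.liftMotion τ ρ m w =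
      C.liftTension ρ (fun j o => ∑ w, C.quotientGainGraph.orbitRigidityMatrix τ (ρ j)
        (C.quotientPlacement q) o w * m j w) e := by
  have hs := (C.exists_apply_dart_edge e).choose_spec
  simp only [liftTension, LinearMap.coe_mk, AddHom.coe_mk, edgeLabel]
  generalize (C.exists_apply_dart_edge e).choose = γ at hs ⊢
  set o := Quotient.mk (edgeOrbitSetoid θ) e
  have hs' : e.1 = s(θ γ (C.dart o).fst, θ γ (C.dart o).snd) := hs.symm
  rw [sum_rigidityMatrix_mul q hs']
  set g := γ * C.label (C.dart o).fst with hg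
  set h := C.quotientGainGraph.gain o with hh
  set u := C.quotientGainGraph.src o with hu
  set v := C.quotientGainGraph.tgt o with hv
  have hla : C.label (θ γ (C.dart o).fst) = g := label_apply hθ C _ _
  have hlb : C.label (θ γ (C.dart o).snd) = g * h := by
    rw [label_apply hθ, hg, hh]
    simp only [quotientGainGraph]
    group
  have hoa : Quotient.mk (vertexOrbitSetoid θ) (θ γ (C.dart o).fst) = u := mk_apply _ _
  have hob : Quotient.mk (vertexOrbitSetoid θ) (θ γ (C.dart o).snd) = v := mk_apply _ _
  rw [C.apply_eq_mulVec_quotientPlacement hq (θ γ (C.dart o).fst),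
    C.apply_eq_mulVec_quotientPlacement hq (θ γ (C.dart o).snd), hla, hlb, hoa, hob]
  generalize C.quotientPlacement q = r
  simp only [liftMotion, LinearMap.coe_mk, AddHom.coe_mk, hla, hlb, hoa, hob]
  simp only [← Finset.sum_sub_distrib, Finset.mul_sum]
  rw [Finset.sum_comm]
  refine Finset.sum_congr rfl fun j _ => ?_
  rw [← Finset.mul_sum]
  have hO := GainGraph.sum_orbitRigidityMatrix_mul (H := C.quotientGainGraph) (ρ := ρ j) (q := r)
    hτ o (fun v k => m j (v, k))
  simp only [← hu, ← hv, ← hh, Prod.mk.eta] at hO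
  rw [hO]
  simp only [Fin.sum_univ_two, IsRotationAction.mulVec_zero, hτ.mulVec_one, map_mul (ρ j),
    hτ.mul_zero_zero, hτ.mul_zero_one, hτ.one_one, hτ.one_zero]
  have hg2 : ((τ g).1 0 0 : ℂ) ^ 2 + (τ g).1 0 1 ^ 2 = 1 := by
    exact_mod_cast IsRotationAction.sq_add_sq (τ := τ) g
  have hh2 : ((τ h).1 0 0 : ℂ) ^ 2 + (τ h).1 0 1 ^ 2 = 1 := by
    exact_mod_cast IsRotationAction.sq_add_sq (τ := τ) h
  push_cast
  generalize ((τ g).1 0 0 : ℂ) = c at *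
  generalize ((τ g).1 0 1 : ℂ) = s at *
  generalize ((τ h).1 0 0 : ℂ) = c' at *
  generalize ((τ h).1 0 1 : ℂ) = s' at *
  generalize ρ j g = x
  generalize ρ j h = y
  generalize m j (u, 0) = m₀
  generalize m j (u, 1) = m₁
  generalize m j (v, 0) = n₀
  generalize m j (v, 1) = n₁
  linear_combination x * (((r u 0 - (c' * r v 0 + s' * r v 1)) * m₀ +
      (r u 1 - (c' * r v 1 - s' * r v 0)) * m₁) -
      y * ((r u 0 - (c' * r v 0 + s' * r v 1)) * (c' * n₀ + s' * n₁) +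
        (r u 1 - (c' * r v 1 - s' * r v 0)) * (c' * n₁ - s' * n₀))) * hg2 +
    x * y * (r v 0 * n₀ + r v 1 * n₁) * hh2

/-- The rank of the rigidity matrix of a symmetric framework is the sum of the ranks of the orbit
rigidity matrices of the characters. -/
theorem rank_rigidityMatrix [Fintype V] [Fintype Γ] [Fintype (VertexOrbit θ)]
    (hθ : IsFreeOnVertices θ) (h2 : ∀ γ : Γ, γ ^ 2 = 1 → γ = 1)
    (C : QuotientChoice θ) {τ : Γ →* Matrix.orthogonalGroup (Fin 2) ℝ} (hτ : IsRotationAction τ)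
    {J : Type*} [Fintype J] {ρ : J → Γ →* ℂ} (hρ : Function.Injective ρ)
    (hJ : Fintype.card J = Fintype.card Γ) {q : V → Fin 2 → ℝ}
    (hq : ∀ (γ : Γ) (v : V), (τ γ).1.mulVec (q v) = q (θ γ v)) :
    (rigidityMatrix G q).rank = ∑ j, (C.quotientGainGraph.orbitRigidityMatrix τ (ρ j)
      (C.quotientPlacement q)).rank := by
  classical
  rw [← Matrix.rank_map_algebraMap (L := ℂ) (rigidityMatrix G q)]
  refine LinearMap.finrank_range_of_comp_eq (C.liftMotion_surjective τ hρ hJ)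
    (C.liftTension_injective hθ h2 hρ) fun m => ?_
  ext e
  exact C.rigidityMatrix_liftMotion hθ hτ ρ hq m e

end QuotientChoice

/-! ## The linear matroid and the regular frameworks -/

theorem Set.exists_finset_coe {α : Type*} [Finite α] (s : Set α) : ∃ F : Finset α, (F : Set α) = s :=
  ⟨s.toFinite.toFinset, s.toFinite.coe_toFinset⟩

theorem LinearIndepOn.finrank_span_image {K ι M : Type*} [Field K] [AddCommGroup M] [Module K M]
    {v : ι → M} {F : Finset ι} (h : LinearIndepOn K v F) :
    Module.finrank K (Submodule.span K (v '' F)) = F.card := by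
  have := finrank_span_eq_card (R := K) (b := fun i : (F : Set ι) => v i) h
  rw [Set.image_eq_range, this]
  simp

/-- The matroid of the linearly independent subfamilies of a finite family of vectors. -/
theorem Matroid.exists_indep_iff_linearIndepOn (K : Type*) {ι M : Type*} [Field K]
    [AddCommGroup M] [Module K M] [Finite ι] (v : ι → M) :
    ∃ N : Matroid ι, N.E = Set.univ ∧ ∀ s, N.Indep s ↔ LinearIndepOn K v s := by
  refine ⟨(IndepMatroid.ofFinite Set.finite_univ (LinearIndepOn K v) (linearIndepOn_empty K v)
    (fun _ _ h hs => h.mono hs) ?_ (fun _ _ => Set.subset_univ _)).matroid, rfl,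
    fun _ => Iff.rfl⟩
  intro I J hI hJ hlt
  by_contra! hc
  obtain ⟨I, rfl⟩ := I.exists_finset_coe
  obtain ⟨J, rfl⟩ := J.exists_finset_coe
  have hsp : Submodule.span K (v '' J) ≤ Submodule.span K (v '' I) := by
    rw [Submodule.span_le]
    rintro _ ⟨e, he, rfl⟩
    by_contra hn
    have := hI.notMem_span_iff.1 hn
    exact hc e he this.2 this.1
  have : Module.Finite K (Submodule.span K (v '' I)) :=
    FiniteDimensional.span_of_finite K ((Finset.finite_toSet I).image v)
  have h := Submodule.finrank_mono hsp
  rw [hI.finrank_span_image, hJ.finrank_span_image] at h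
  rw [Set.ncard_coe_finset, Set.ncard_coe_finset] at hlt
  omega

namespace Matrix

variable {K m n : Type*} [Field K] [Finite m] [Fintype n] {A : Matrix m n K}

theorem card_le_rank_of_linearIndepOn {F : Finset m} (h : LinearIndepOn K A.row F) :
    F.card ≤ A.rank := by
  rw [Matrix.rank_eq_finrank_span_row, ← h.finrank_span_image]
  exact Submodule.finrank_mono (Submodule.span_mono (Set.image_subset_range _ _))

theorem exists_linearIndepOn_card_eq_rank (A : Matrix m n K) :
    ∃ F : Finset m, LinearIndepOn K A.row F ∧ F.card = A.rank := by
  obtain ⟨b, -, -, hb, hli⟩ := exists_linearIndepOn_extension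
    (linearIndepOn_empty K A.row) (Set.empty_subset Set.univ)
  obtain ⟨F, rfl⟩ := b.exists_finset_coe
  refine ⟨F, hli, ?_⟩
  rw [Matrix.rank_eq_finrank_span_row, ← hli.finrank_span_image]
  rw [Set.image_univ] at hb
  rw [le_antisymm (Submodule.span_mono (Set.image_subset_range _ _)) (Submodule.span_le.2 hb)]

theorem linearIndependent_row_of_card_le_rank [Fintype m] (h : Fintype.card m ≤ A.rank) :
    LinearIndependent K A.row := by
  rw [linearIndependent_iff_card_le_finrank_span, Set.finrank, ← Matrix.rank_eq_finrank_span_row]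
  exact h

end Matrix

namespace GainGraph

variable {Γ V E : Type*} [Group Γ] {H : GainGraph Γ V E}
  {τ : Γ →* Matrix.orthogonalGroup (Fin 2) ℝ}

theorem Sparse.image_completeGainGraph [DecidableEq (V × V × Γ)] {F : Finset E} (h : H.Sparse F) :
    (completeGainGraph Γ V).Sparse (F.image fun e => (H.src e, H.tgt e, H.gain e)) := by
  classical
  intro A hA hne
  set t : E → V × V × Γ := fun e => (H.src e, H.tgt e, H.gain e) with ht
  set B := F.filter fun e => t e ∈ A with hB
  have hBA : B.image t = A := by
    ext x
    simp only [hB, Finset.mem_image, Finset.mem_filter]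
    constructor
    · rintro ⟨e, ⟨-, he⟩, rfl⟩
      exact he
    · intro hx
      obtain ⟨e, he, rfl⟩ := Finset.mem_image.1 (hA hx)
      exact ⟨e, ⟨he, hx⟩, rfl⟩
  have hv : (completeGainGraph Γ V).verts A = H.verts B := by
    ext v
    rw [mem_verts, mem_verts, ← hBA]
    simp [Finset.mem_image, completeGainGraph, ht]
  have hc : A.card ≤ B.card := hBA ▸ Finset.card_image_le
  have hBne : B.Nonempty := by
    rw [← hBA] at hne
    exact Finset.image_nonempty.1 hne
  have := h B (Finset.filter_subset _ _) hBne
  rw [hv]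
  refine ⟨by omega, ?_⟩
  rintro ⟨g, hg⟩
  have := this.2 ⟨g, fun e he => hg (t e) ((Finset.mem_filter.1 he).2)⟩
  omega

theorem Sparse.injOn_triple {F : Finset E} (h : H.Sparse F) :
    Set.InjOn (fun e => (H.src e, H.tgt e, H.gain e)) (F : Set E) := by
  classical
  intro e he e' he' hee
  by_contra hne
  obtain ⟨hs, ht, hg⟩ : H.src e = H.src e' ∧ H.tgt e = H.tgt e' ∧ H.gain e = H.gain e' := by
    simpa using hee
  have hA := h {e, e'} (by
    intro x hx
    rcases Finset.mem_insert.1 hx with rfl | hx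
    · exact he
    · rw [Finset.mem_singleton.1 hx]; exact he') ⟨e, by simp⟩
  have hv : H.verts {e, e'} = {H.src e, H.tgt e} := by
    ext v
    rw [mem_verts]
    simp only [Finset.mem_insert, Finset.mem_singleton, exists_eq_or_imp, exists_eq_left, ← hs,
      ← ht, or_self]
    exact or_congr eq_comm eq_comm
  rw [hv, Finset.card_pair hne] at hA
  by_cases hl : H.src e = H.tgt e
  · have := hA.1
    simp [hl] at this
  · have := hA.2 ⟨fun v => if v = H.tgt e then H.gain e else 1, by
      intro x hx
      rcases Finset.mem_insert.1 hx with rfl | hx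
      · simp [hl]
      · rw [Finset.mem_singleton.1 hx, ← hs, ← ht, ← hg]
        simp [hl]⟩
    rw [Finset.card_pair hl] at this
    omega

/-- A generic placement makes the rows of all sparse edge sets independent. -/
theorem exists_forall_linearIndepOn [Fintype V] [Finite E] {J : Type*} [Finite J]
    (hτ : IsRotationAction τ) (ρ : J → Γ →* ℂ) : ∃ q : V → Fin 2 → ℝ, ∀ (j : J) (F : Finset E),
      H.Sparse F → LinearIndepOn ℂ (H.orbitRigidityMatrix τ (ρ j) q).row F := by
  classical
  have key : ∀ᶠ q in residual (V → Fin 2 → ℝ), ∀ (j : J) (F : Finset E),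
      H.Sparse F → LinearIndepOn ℂ (H.orbitRigidityMatrix τ (ρ j) q).row F := by
    refine Filter.eventually_all.2 fun j => Filter.eventually_all.2 fun F => ?_
    by_cases hF : H.Sparse F
    · filter_upwards [Sparse.eventually_linearIndepOn hτ (ρ j) _ _ rfl
        hF.image_completeGainGraph] with q hq _
      rw [Finset.coe_image] at hq
      exact hq.comp_of_image hF.injOn_triple
    · exact Filter.Eventually.of_forall fun q h => absurd h hF
  exact (dense_of_mem_residual key).nonempty

theorem sparse_singleton {e : E} (he : H.src e = H.tgt e → H.gain e ≠ 1) : H.Sparse {e} := by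
  intro A hA hne
  obtain rfl := (Finset.subset_singleton_iff.1 hA).resolve_left hne.ne_empty
  have hpos := Finset.card_pos.2 ⟨_, src_mem_verts (H := H) (Finset.mem_singleton_self e)⟩
  refine ⟨by rw [Finset.card_singleton]; omega, ?_⟩
  rintro ⟨g, hg⟩
  have hl : H.src e ≠ H.tgt e := fun h => he h (by
    rw [hg e (by simp), h, inv_mul_cancel])
  have : 2 ≤ (H.verts {e}).card := by
    classical
    rw [← Finset.card_pair hl]
    refine Finset.card_le_card fun v hv => ?_
    rw [mem_verts]
    rcases Finset.mem_insert.1 hv with rfl | hv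
    · exact ⟨e, by simp, Or.inl rfl⟩
    · exact ⟨e, by simp, Or.inr (Finset.mem_singleton.1 hv).symm⟩
  rw [Finset.card_singleton]
  omega

theorem orbitRigidityMatrix_row_ne {ρ : Γ → ℂ} {q : V → Fin 2 → ℝ} {e : E}
    (h : LinearIndepOn ℂ (H.orbitRigidityMatrix τ ρ q).row ({e} : Finset E)) :
    q (H.src e) ≠ (τ (H.gain e)).1.mulVec (q (H.tgt e)) := by
  intro hq
  have h₀ : (H.orbitRigidityMatrix τ ρ q).row e ≠ 0 := h.ne_zero (by simp)
  apply h₀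
  ext w
  have h₂ : ((τ (H.gain e))⁻¹ : Matrix.orthogonalGroup (Fin 2) ℝ).1.mulVec (q (H.src e)) =
      q (H.tgt e) := by
    rw [hq, Matrix.mulVec_mulVec, ← Submonoid.coe_mul, inv_mul_cancel]
    exact Matrix.one_mulVec _
  simp only [Matrix.row, orbitRigidityMatrix, h₂]
  simp [hq]

end GainGraph

namespace QuotientChoice

variable {Γ : Type*} [Group Γ] {V : Type*} {G : SimpleGraph V} {θ : Γ →* (G ≃g G)}

theorem gain_ne_one (C : QuotientChoice θ) {o : EdgeOrbit θ}
    (h : C.quotientGainGraph.src o = C.quotientGainGraph.tgt o) :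
    C.quotientGainGraph.gain o ≠ 1 := by
  intro hg
  have h' : Quotient.mk (vertexOrbitSetoid θ) (C.dart o).fst =
    Quotient.mk (vertexOrbitSetoid θ) (C.dart o).snd := h
  have hl : C.label (C.dart o).fst = C.label (C.dart o).snd := inv_mul_eq_one.1 hg
  have := C.label_spec (C.dart o).fst
  rw [hl, h', label_spec] at this
  exact (C.dart o).adj.ne this.symm

theorem src_ne_mulVec_tgt {τ : Γ →* Matrix.orthogonalGroup (Fin 2) ℝ} (C : QuotientChoice θ)
    {q : V → Fin 2 → ℝ} (hq : IsSymmetricFramework θ τ q) (o : EdgeOrbit θ) :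
    C.quotientPlacement q (C.quotientGainGraph.src o) ≠
      (τ (C.quotientGainGraph.gain o)).1.mulVec
        (C.quotientPlacement q (C.quotientGainGraph.tgt o)) := by
  intro h
  refine hq.1 _ _ (C.dart o).adj ?_
  have h₁ := C.apply_eq_mulVec_quotientPlacement hq.2 (C.dart o).fst
  rw [h₁, C.apply_eq_mulVec_quotientPlacement hq.2 (C.dart o).snd]
  change (τ (C.label (C.dart o).fst)).1.mulVec
    (C.quotientPlacement q (C.quotientGainGraph.src o)) = _
  rw [h, mulVec_map_mulVec]
  simp only [quotientGainGraph, mul_inv_cancel_left]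

/-- The symmetric placement with given positions of the representatives. -/
theorem exists_isSymmetricFramework {τ : Γ →* Matrix.orthogonalGroup (Fin 2) ℝ}
    (hθ : IsFreeOnVertices θ) (C : QuotientChoice θ) {r : VertexOrbit θ → Fin 2 → ℝ}
    (hr : ∀ o, r (C.quotientGainGraph.src o) ≠
      (τ (C.quotientGainGraph.gain o)).1.mulVec (r (C.quotientGainGraph.tgt o))) :
    ∃ q : V → Fin 2 → ℝ, IsSymmetricFramework θ τ q ∧ C.quotientPlacement q = r := by
  set q : V → Fin 2 → ℝ := fun v =>
    (τ (C.label v)).1.mulVec (r (Quotient.mk (vertexOrbitSetoid θ) v)) with hqdef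
  have hsym : ∀ (γ : Γ) (v : V), (τ γ).1.mulVec (q v) = q (θ γ v) := by
    intro γ v
    simp only [hqdef]
    rw [mulVec_map_mulVec, label_apply hθ, mk_apply]
  have hinj : ∀ γ (x y : Fin 2 → ℝ), (τ γ).1.mulVec x = (τ γ).1.mulVec y → x = y := by
    intro γ x y h
    have := congrArg (τ γ⁻¹).1.mulVec h
    rw [mulVec_map_mulVec, mulVec_map_mulVec, inv_mul_cancel, map_one] at this
    exact (Matrix.one_mulVec x).symm.trans (this.trans (Matrix.one_mulVec y))
  have hdart : ∀ o, q (C.dart o).fst ≠ q (C.dart o).snd := by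
    intro o h
    refine hr o (hinj (C.label (C.dart o).fst) _ _ ?_)
    rw [mulVec_map_mulVec]
    simp only [quotientGainGraph, mul_inv_cancel_left]
    exact h
  refine ⟨q, ⟨fun a b hab h => ?_, hsym⟩, ?_⟩
  · obtain ⟨γ, hγ⟩ := C.exists_apply_dart_edge ⟨s(a, b), hab⟩
    generalize (Quotient.mk (edgeOrbitSetoid θ) ⟨s(a, b), hab⟩ : EdgeOrbit θ) = o at hγ
    have hs : s(θ γ (C.dart o).fst, θ γ (C.dart o).snd) = s(a, b) := hγ
    have hab' : q (θ γ (C.dart o).fst) = q (θ γ (C.dart o).snd) := by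
      rcases Sym2.eq_iff.1 hs with ⟨h₁, h₂⟩ | ⟨h₁, h₂⟩
      · rw [h₁, h₂, h]
      · rw [h₁, h₂, h]
    rw [← hsym, ← hsym] at hab'
    exact hdart o (hinj _ _ _ hab')
  · ext o i
    simp only [quotientPlacement, hqdef, label_rep hθ, C.rep_spec, map_one]
    exact congrFun (Matrix.one_mulVec _) i

end QuotientChoice

/-- The ranks of the rigidity matrices of regular frameworks, for the groups of odd order acting by
rotations all of whose orbit rigidity matrices have a nontrivial motion. -/
theorem IsRegularFramework.exists_matroid {Γ : Type*} [Group Γ] [Fintype Γ]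
    (h2 : ∀ γ : Γ, γ ^ 2 = 1 → γ = 1) {V : Type*} [Fintype V] {G : SimpleGraph V}
    {θ : Γ →* (G ≃g G)} (hθ : IsFreeOnVertices θ)
    {τ : Γ →* Matrix.orthogonalGroup (Fin 2) ℝ} (hτ : IsRotationAction τ)
    {J : Type*} [Fintype J] {ρ : J → Γ →* ℂ} (hρ : Function.Injective ρ)
    (hJ : Fintype.card J = Fintype.card Γ) (hm : ∀ j, GainGraph.HasMotion τ (ρ j))
    {p : V → Fin 2 → ℝ} (hp : IsRegularFramework θ τ p) (C : QuotientChoice θ) :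
    (∃ M : Matroid (EdgeOrbit θ), M.E = Set.univ ∧
      (∀ F : Set (EdgeOrbit θ), M.Indep F ↔ C.quotientGainGraph.IsGainSparse 2 3 1 F) ∧
      ((rigidityMatrix G p).rank : ℕ∞) = Fintype.card Γ * M.eRank) ∧
    (∀ j : J, LinearIndependent ℂ (C.quotientGainGraph.orbitRigidityMatrix τ (ρ j)
        (C.quotientPlacement p)).row ↔ C.quotientGainGraph.IsGainSparse 2 3 1 Set.univ) := by
  classical
  have : Fintype (VertexOrbit θ) := Fintype.ofFinite _
  have : Fintype (EdgeOrbit θ) := Fintype.ofFinite _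
  have : Nonempty J := Fintype.card_pos_iff.1 (hJ ▸ Fintype.card_pos)
  obtain ⟨r, hr⟩ := GainGraph.exists_forall_linearIndepOn (H := C.quotientGainGraph) hτ ρ
  obtain ⟨q, hq, hqr⟩ := C.exists_isSymmetricFramework (τ := τ) (r := r) hθ fun o =>
    GainGraph.orbitRigidityMatrix_row_ne
      (hr (Classical.arbitrary J) _ (GainGraph.sparse_singleton C.gain_ne_one))
  rw [← hqr] at hr
  have hsp : ∀ {q' : V → Fin 2 → ℝ}, IsSymmetricFramework θ τ q' → ∀ j (F : Finset (EdgeOrbit θ)),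
      LinearIndepOn ℂ (C.quotientGainGraph.orbitRigidityMatrix τ (ρ j)
        (C.quotientPlacement q')).row F → C.quotientGainGraph.Sparse F := fun hq' j F hF =>
    GainGraph.sparse_of_linearIndepOn hτ (hm j) (fun o _ => C.src_ne_mulVec_tgt hq' o) hF
  obtain ⟨M, hME, hM⟩ := Matroid.exists_indep_iff_linearIndepOn ℂ
    (C.quotientGainGraph.orbitRigidityMatrix τ (ρ (Classical.arbitrary J))
      (C.quotientPlacement q)).row
  have hMs : ∀ F : Finset (EdgeOrbit θ), M.Indep F ↔ C.quotientGainGraph.Sparse F := fun F => by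
    rw [hM]
    exact ⟨hsp hq _ F, hr _ F⟩
  obtain ⟨B, hB⟩ := M.exists_isBase
  obtain ⟨B, rfl⟩ := B.exists_finset_coe
  have hBr : (B.card : ℕ∞) = M.eRank := by
    rw [← hB.encard_eq_eRank, Set.encard_coe_eq_coe_finsetCard]
  have hle : ∀ {q' : V → Fin 2 → ℝ}, IsSymmetricFramework θ τ q' → ∀ j,
      (C.quotientGainGraph.orbitRigidityMatrix τ (ρ j) (C.quotientPlacement q')).rank ≤ B.card := by
    intro q' hq' j
    obtain ⟨F, hF, hc⟩ := Matrix.exists_linearIndepOn_card_eq_rank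
      (C.quotientGainGraph.orbitRigidityMatrix τ (ρ j) (C.quotientPlacement q'))
    have := ((hMs F).2 (hsp hq' j F hF)).encard_le_eRank
    rw [← hBr, Set.encard_coe_eq_coe_finsetCard] at this
    rw [← hc]
    exact_mod_cast this
  have hge : ∀ j, B.card ≤
      (C.quotientGainGraph.orbitRigidityMatrix τ (ρ j) (C.quotientPlacement q)).rank := fun j =>
    Matrix.card_le_rank_of_linearIndepOn (hr j B ((hMs B).1 hB.indep))
  have hsum : ∑ j, (C.quotientGainGraph.orbitRigidityMatrix τ (ρ j)
      (C.quotientPlacement p)).rank = ∑ _j : J, B.card := by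
    refine le_antisymm (Finset.sum_le_sum fun j _ => hle hp.1 j) ?_
    calc ∑ _j : J, B.card ≤ ∑ j, (C.quotientGainGraph.orbitRigidityMatrix τ (ρ j)
          (C.quotientPlacement q)).rank := Finset.sum_le_sum fun j _ => hge j
      _ = (rigidityMatrix G q).rank := (C.rank_rigidityMatrix hθ h2 hτ hρ hJ hq.2).symm
      _ ≤ (rigidityMatrix G p).rank := hp.2 q hq
      _ = _ := C.rank_rigidityMatrix hθ h2 hτ hρ hJ hp.1.2
  have heq : ∀ j, (C.quotientGainGraph.orbitRigidityMatrix τ (ρ j)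
      (C.quotientPlacement p)).rank = B.card := fun j =>
    (Finset.sum_eq_sum_iff_of_le fun j _ => hle hp.1 j).1 hsum j (Finset.mem_univ j)
  refine ⟨⟨M, hME, fun F => ?_, ?_⟩, fun j => ⟨fun h => ?_, fun h => ?_⟩⟩
  · obtain ⟨F, rfl⟩ := F.exists_finset_coe
    rw [hMs, GainGraph.isGainSparse_coe_iff]
  · rw [C.rank_rigidityMatrix hθ h2 hτ hρ hJ hp.1.2, hsum, ← hBr, Finset.sum_const,
      Finset.card_univ, hJ, smul_eq_mul, Nat.cast_mul]
  · rw [← Finset.coe_univ, GainGraph.isGainSparse_coe_iff]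
    exact hsp hp.1 j _ (h.linearIndepOn _)
  · rw [← Finset.coe_univ, GainGraph.isGainSparse_coe_iff, ← hMs] at h
    have := h.encard_le_eRank
    rw [← hBr, Set.encard_coe_eq_coe_finsetCard, Finset.card_univ] at this
    refine Matrix.linearIndependent_row_of_card_le_rank ?_
    rw [heq]
    exact_mod_cast this

/-! ## The threefold rotation group -/

theorem mem_rotationPointGroup_apply {k : ℕ} {A : Matrix.orthogonalGroup (Fin 2) ℝ}
    (h : A ∈ rotationPointGroup k) : A.1 1 1 = A.1 0 0 ∧ A.1 1 0 = -A.1 0 1 := by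
  obtain ⟨n, rfl⟩ := Subgroup.mem_zpowers_iff.1 h
  have hmul : ∀ A B : Matrix.orthogonalGroup (Fin 2) ℝ, A.1 1 1 = A.1 0 0 ∧ A.1 1 0 = -A.1 0 1 →
      B.1 1 1 = B.1 0 0 ∧ B.1 1 0 = -B.1 0 1 →
      (A * B).1 1 1 = (A * B).1 0 0 ∧ (A * B).1 1 0 = -(A * B).1 0 1 := by
    rintro A B ⟨h₁, h₂⟩ ⟨h₃, h₄⟩
    simp only [Submonoid.coe_mul, Matrix.mul_apply, Fin.sum_univ_two, h₁, h₂, h₃, h₄]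
    constructor <;> ring
  have hinv : ∀ A : Matrix.orthogonalGroup (Fin 2) ℝ, A.1 1 1 = A.1 0 0 ∧ A.1 1 0 = -A.1 0 1 →
      A⁻¹.1 1 1 = A⁻¹.1 0 0 ∧ A⁻¹.1 1 0 = -A⁻¹.1 0 1 := by
    rintro A ⟨h₁, h₂⟩
    refine ⟨h₁, ?_⟩
    change A.1 0 1 = -A.1 1 0
    rw [h₂, neg_neg]
  have hR : (planeRotation k).1 1 1 = (planeRotation k).1 0 0 ∧
      (planeRotation k).1 1 0 = -(planeRotation k).1 0 1 := by
    simp [planeRotation]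
  have hpow : ∀ n : ℕ, ((planeRotation k) ^ n).1 1 1 = ((planeRotation k) ^ n).1 0 0 ∧
      ((planeRotation k) ^ n).1 1 0 = -((planeRotation k) ^ n).1 0 1 := by
    intro n
    induction n with
    | zero => simp
    | succ n ih => rw [pow_succ]; exact hmul _ _ ih hR
  cases n with
  | ofNat n => rw [Int.ofNat_eq_natCast, zpow_natCast]; exact hpow n
  | negSucc n => rw [zpow_negSucc]; exact hinv _ (hpow _)

theorem multiplicative_zmod_three_pow (γ : Multiplicative (ZMod 3)) : γ ^ 3 = 1 := by
  revert γ
  decide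

section Threefold

variable {τ : Multiplicative (ZMod 3) →* Matrix.orthogonalGroup (Fin 2) ℝ}

theorem isRotationAction_of_mem_rotationPointGroup (hτ : Function.Injective τ)
    (hτC : ∀ γ, τ γ ∈ rotationPointGroup 3) : IsRotationAction τ where
  one_one h := (mem_rotationPointGroup_apply (hτC h)).1
  one_zero h := (mem_rotationPointGroup_apply (hτC h)).2
  zero_one_ne_zero h hh hs := by
    obtain ⟨h₁, h₂⟩ := mem_rotationPointGroup_apply (hτC h)
    have h3 : (τ (h * h * h)).1 0 0 = 1 := by
      rw [← pow_two, ← pow_succ, multiplicative_zmod_three_pow, map_one]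
      simp
    have hc : (τ h).1 0 0 = 1 := by
      have hsq := IsRotationAction.sq_add_sq (τ := τ) h
      simp only [map_mul, Submonoid.coe_mul, Matrix.mul_apply, Fin.sum_univ_two, h₂, hs] at h3
      rw [hs] at hsq
      linear_combination h3 - (τ h).1 0 0 * hsq
    refine hh (hτ ?_)
    rw [map_one]
    ext i j
    fin_cases i <;> fin_cases j <;> simp [h₁, h₂, hs, hc]

theorem IsRotationAction.zero_zero_eq_neg_half (hτ : IsRotationAction τ)
    {h : Multiplicative (ZMod 3)} (hh : h ≠ 1) : (τ h).1 0 0 = -(1 / 2) := by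
  have h3 : (τ (h * h * h)).1 0 0 = 1 := by
    rw [← pow_two, ← pow_succ, multiplicative_zmod_three_pow, map_one]
    simp
  have hsq := IsRotationAction.sq_add_sq (τ := τ) h
  have hs := hτ.zero_one_ne_zero h hh
  rw [hτ.mul_zero_zero, hτ.mul_zero_zero, hτ.mul_zero_one] at h3
  generalize (τ h).1 0 0 = c at *
  generalize (τ h).1 0 1 = s at *
  have hc : (c - 1) * (2 * c + 1) ^ 2 = 0 := by linear_combination h3 + 3 * c * hsq
  rcases mul_eq_zero.1 hc with hc | hc
  · refine absurd ?_ hs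
    have : s ^ 2 = 0 := by
      rw [sub_eq_zero.1 hc] at hsq
      linarith
    exact pow_eq_zero_iff (two_ne_zero) |>.1 this
  · have := pow_eq_zero_iff (two_ne_zero) |>.1 hc
    linarith

theorem IsRotationAction.hasMotion (hτ : IsRotationAction τ) (ρ : Multiplicative (ZMod 3) →* ℂ) :
    GainGraph.HasMotion τ ρ := by
  set γ : Multiplicative (ZMod 3) := Multiplicative.ofAdd 1
  have hγ : γ ≠ 1 := by decide
  have hgen : ∀ h : Multiplicative (ZMod 3), h = 1 ∨ h = γ ∨ h = γ * γ := by decide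
  have h3 : ρ γ ^ 3 = 1 := by rw [← map_pow, multiplicative_zmod_three_pow, map_one]
  by_cases h1 : ρ γ = 1
  · left
    intro h
    rcases hgen h with rfl | rfl | rfl <;> simp [h1]
  right
  have hx : ρ γ ^ 2 + ρ γ + 1 = 0 := by
    have : (ρ γ - 1) * (ρ γ ^ 2 + ρ γ + 1) = 0 := by linear_combination h3
    exact (mul_eq_zero.1 this).resolve_left (sub_ne_zero.2 h1)
  have hc : ((τ γ).1 0 0 : ℂ) = -(1 / 2) := by
    rw [hτ.zero_zero_eq_neg_half hγ]
    push_cast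
    ring
  have hs : ((τ γ).1 0 1 : ℂ) ≠ 0 := by exact_mod_cast hτ.zero_one_ne_zero γ hγ
  have hsq : ((τ γ).1 0 0 : ℂ) ^ 2 + (τ γ).1 0 1 ^ 2 = 1 := by
    exact_mod_cast IsRotationAction.sq_add_sq (τ := τ) γ
  rw [hc] at hsq
  obtain ⟨ζ, hζ⟩ : ∃ ζ : ℂ, ((τ γ).1 0 1 : ℂ) * ζ = ρ γ ^ 2 + 1 / 2 :=
    ⟨(ρ γ ^ 2 + 1 / 2) / (τ γ).1 0 1, mul_div_cancel₀ _ hs⟩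
  have hζ2 : ζ ^ 2 = -1 := by
    have h34 : ((τ γ).1 0 1 : ℂ) ^ 2 = 3 / 4 := by linear_combination hsq
    have : ((τ γ).1 0 1 : ℂ) ^ 2 * ζ ^ 2 = -(3 / 4) := by
      rw [← mul_pow, hζ]
      linear_combination ρ γ * h3 + hx
    rw [h34] at this
    linear_combination (4 / 3) * this
  have hone : ρ γ * ((τ γ).1 0 0 + (τ γ).1 0 1 * ζ) = 1 := by
    rw [hc, hζ]
    linear_combination h3
  refine ⟨ζ, hζ2, fun h => ?_⟩
  rcases hgen h with rfl | rfl | rfl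
  · simp
  · exact hone
  · rw [hτ.mul_zero_zero, hτ.mul_zero_one, map_mul]
    push_cast
    linear_combination (ρ γ * ((τ γ).1 0 0 + (τ γ).1 0 1 * ζ) + 1) * hone -
      ρ γ ^ 2 * (τ γ).1 0 1 ^ 2 * hζ2

end Threefold

/-- `cyclicCharacter k j` as a monoid homomorphism. -/
noncomputable def cyclicCharacterHom (k : ℕ) [NeZero k] (j : ℕ) :
    Multiplicative (ZMod k) →* ℂ where
  toFun := cyclicCharacter k j
  map_one' := by simp [cyclicCharacter]
  map_mul' a b := by
    have h := (Complex.isPrimitiveRoot_exp k (NeZero.ne k)).pow_eq_one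
    simp only [cyclicCharacter, toAdd_mul, ZMod.val_add, pow_mul]
    rw [← pow_eq_pow_mod _ h, pow_add, mul_pow]

theorem cyclicCharacterHom_injective (k : ℕ) [Fact (1 < k)] [NeZero k] :
    Function.Injective fun j : Fin k => cyclicCharacterHom k j := by
  intro i j hij
  have := DFunLike.congr_fun hij (Multiplicative.ofAdd 1)
  simp only [cyclicCharacterHom, MonoidHom.coe_mk, OneHom.coe_mk, cyclicCharacter, toAdd_ofAdd,
    ZMod.val_one, one_mul] at this
  exact Fin.ext ((Complex.isPrimitiveRoot_exp k (NeZero.ne k)).pow_inj i.2 j.2 this)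

theorem mainTheorem7 {V : Type*} [Fintype V] (G : SimpleGraph V)
    (θ : Multiplicative (ZMod 3) →* (G ≃g G)) (hθ : IsFreeOnVertices θ)
    (τ : Multiplicative (ZMod 3) →* Matrix.orthogonalGroup (Fin 2) ℝ)
    (hτ : Function.Injective τ) (hτC : ∀ γ, τ γ ∈ rotationPointGroup 3)
    (p : V → Fin 2 → ℝ) (hp : IsRegularFramework θ τ p)
    (C : QuotientChoice θ) :
    (∃ M : Matroid (EdgeOrbit θ), M.E = Set.univ ∧
      (∀ F : Set (EdgeOrbit θ), M.Indep F ↔ C.quotientGainGraph.IsGainSparse 2 3 1 F) ∧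
      ((rigidityMatrix G p).rank : ℕ∞) = 3 * M.eRank) ∧
    (∀ j : ℕ, j = 1 ∨ j = 2 →
      (LinearIndependent ℂ (C.quotientGainGraph.orbitRigidityMatrix τ (cyclicCharacter 3 j)
          (C.quotientPlacement p)).row ↔
        C.quotientGainGraph.IsGainSparse 2 3 1 Set.univ)) := by
  have : Fact (1 < 3) := ⟨by norm_num⟩
  have hrot := isRotationAction_of_mem_rotationPointGroup hτ hτC
  obtain ⟨⟨M, hME, hM, hr⟩, hj⟩ := hp.exists_matroid (by decide) hθ hrot
    (cyclicCharacterHom_injective 3) (by simp) (fun j => hrot.hasMotion _) C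
  refine ⟨⟨M, hME, hM, by simpa using hr⟩, ?_⟩
  rintro j (rfl | rfl)
  · exact hj 1
  · exact hj 2
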